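/- **Setting.** Let $D$ be a connected Lie group with Lie algebra $\mathfrak d$ (the bracket $[\cdot,\cdot]_{\mathfrak d}$ being defined by right-invariant vector fields), let $\langle\cdot,\cdot\rangle$ be a symmetric, nondegenerate, ad-invariant bilinear form of signature $(n,n)$ on $\mathfrak d$, and let $G\subseteq D$ be a connected closed subgroup whose Lie algebra $\mathfrak g\subset\mathfrak d$ is a maximal isotropic subspace. Let $p:D\to S=D/G$ be the projection (quotient by right multiplication, with the smooth structure making $p$ a submersion), $\mathrm{Inv}:D\to D$ the inversion, and $\overline p=p\circ\mathrm{Inv}$. For $u\in\mathfrak d$ let $u^l,u^r$ be the left/right-invariant vector fields with value $u$ at $1$, let $\theta^L,\theta^R$ be the Maurer–Cartan forms, $\theta^L(u^l)=\theta^R(u^r)=u$, and let $\rho_S(u)$ be the infinitesimal dressing action on $S$, $\rho_S(u)_{p(a)}=dp(u^r_a)$; write $\rho=\rho_S|_{\mathfrak g}$. Fix an isotropic connection on the principal $G$-bundle $p$, given by a form $s\in\Omega^1(S,\mathfrak d)$ with $\rho_S(s(X))=X$ and $\langle s(X),s(Y)\rangle=0$ for all $X,Y\in T_xS$, $x\in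 S$; its connection form is $\theta\in\Omega^1(D,\mathfrak g)$, $\theta_a=\theta^L_a-\mathrm{Ad}_{a^{-1}}(p^*s)_a$. Put $$\sigma(u)(X)=\langle s(X),u\rangle\quad(u\in\mathfrak g),\qquad L_S=\{(\rho(u),\sigma(u)) : u\in\mathfrak g\}\subset TS\oplus T^*S,$$ $$\phi_S=\tfrac12\langle ds,s\rangle+\tfrac16\langle[s,s]_{\mathfrak d},s\rangle\in\Omega^3(S),\qquad \omega_D=\tfrac12\left(\langle\theta^R,\mathrm{Inv}^*\theta\rangle-\langle\theta^L,\theta\rangle\right)\in\Omega^2(D).$$ *Dirac structures.* For a closed 3-form $\phi$ on a manifold $M$, a $\phi$-twisted Dirac structure is a smooth subbundle $L\subset TM\oplus T^*M$, lagrangian for the pairing $\beta(X)+\alpha(Y)$ of $(X,\alpha)$ and $(Y,\beta)$, whose sections are closed under $[\![(X,\alpha),(Y,\beta)]\!]_\phi=([X,Y],\mathcal L_X\beta-i_Yd\alpha+i_Yi_X\phi)$. A strong Dirac map $J:(M,L,\phi)\to(M',L',\phi')$ between manifolds with such structures is a smooth map with $\phi=J^*\phi'$, $L'_{J(x)}=\{(dJ_xX,\beta)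 : (X,dJ_x^*\beta)\in L_x\}$ and $\ker dJ_x\cap L_x=0$ for all $x\in M$ (where $T_xM\subset T_xM\oplus T_x^*M$). It is a presymplectic realization when $L=\{(X,i_X\omega)\}$ is the graph of a 2-form $\omega\in\Omega^2(M)$. If $L'=\{(\rho'(v),\sigma'(v)) : v\in\mathfrak k\}$ for an action $\rho'$ of a Lie algebra $\mathfrak k$ on $M'$ and a linear map $\sigma':\mathfrak k\to\Omega^1(M')$, the induced action of $\mathfrak k$ on $M$ is the Lie algebra action $\rho_M$ uniquely determined by $dJ\circ\rho_M=\rho'$ and $(\rho_M(v),J^*\sigma'(v))\in L$. **Theorem 4.3.** The map $$(p,\overline p):(D,\omega_D)\to(S\times S,\ L_S\times L_S,\ \phi_S\times\phi_S)$$ (where $\phi_S\times\phi_S=\mathrm{pr}_1^*\phi_S+\mathrm{pr}_2^*\phi_S$) is a presymplectic realization; in particular its source and target are twisted Dirac manifolds for the 3-forms $p^*\phi_S+\overline p^*\phi_S$ and $\phi_S\times\phi_S$. The induced $\mathfrak g\times\mathfrak g$-action on $D$ is $(u,v)\mapsto u^r-v^l$. -/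

import Mathlib

open scoped Manifold ContDiff

noncomputable section

namespace DiracManin

/-! ### Instances on tangent spaces -/

instance completeSpace_of_finiteDimensional {E : Type*} [NormedAddCommGroup E] [NormedSpace ℝ E]
    [FiniteDimensional ℝ E] : CompleteSpace E :=
  FiniteDimensional.complete ℝ E

section TangentInstances

variable {E H M : Type*} [NormedAddCommGroup E] [NormedSpace ℝ E] [TopologicalSpace H]
  {I : ModelWithCorners ℝ E H} [TopologicalSpace M] [ChartedSpace H M]

instance tangentSpace_t2 (x : M) : T2Space (TangentSpace I x) :=
  inferInstanceAs (T2Space E)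

instance tangentSpace_finiteDimensional [FiniteDimensional ℝ E] (x : M) :
    FiniteDimensional ℝ (TangentSpace I x) :=
  inferInstanceAs (FiniteDimensional ℝ E)

instance lieGroup_minSmoothness [Group M] [LieGroup I ∞ M] :
    LieGroup I (minSmoothness ℝ 3) M := by
  rw [minSmoothness_of_isRCLikeNormedField]
  infer_instance

end TangentInstances

/-! ### Alternating forms on a finite-dimensional space, wedge products -/

section Wedge

variable {T U V W : Type*}
  [AddCommGroup T] [Module ℝ T] [TopologicalSpace T] [IsTopologicalAddGroup T]
  [ContinuousSMul ℝ T] [T2Space T] [FiniteDimensional ℝ T]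
  [AddCommGroup U] [Module ℝ U] [TopologicalSpace U] [IsTopologicalAddGroup U]
  [ContinuousSMul ℝ U]
  [AddCommGroup V] [Module ℝ V] [TopologicalSpace V]
  [AddCommGroup W] [Module ℝ W] [TopologicalSpace W]

theorem continuous_alternatingMap {k : ℕ} (f : T [⋀^Fin k]→ₗ[ℝ] U) : Continuous f := by
  let b := Module.finBasis ℝ T
  have h : (f : (Fin k → T) → U) = fun v => ∑ j : Fin k → Fin (Module.finrank ℝ T),
      (∏ i, b.repr (v i) (j i)) • f (fun i => b (j i)) := by
    funext v
    conv_lhs => rw [show v = fun i => ∑ j, b.repr (v i) j • b j from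
      funext fun i => (b.sum_repr (v i)).symm]
    rw [← AlternatingMap.coe_multilinearMap, MultilinearMap.map_sum]
    refine Finset.sum_congr rfl fun j _ => ?_
    rw [MultilinearMap.map_smul_univ]
  rw [h]
  refine continuous_finsetSum _ fun j _ => ?_
  refine Continuous.smul (continuous_finsetProd _ fun i _ => ?_) continuous_const
  exact ((b.coord (j i)).continuous_of_finiteDimensional).comp (continuous_apply i)

/-- Every alternating form on a finite-dimensional space, as a continuous alternating form. -/
def toContinuousForm {k : ℕ} (f : T [⋀^Fin k]→ₗ[ℝ] U) : T [⋀^Fin k]→L[ℝ] U :=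
  { f with cont := continuous_alternatingMap f }

/-- The wedge product of a `V`-valued `k`-form and a `W`-valued `l`-form with respect to a bilinear
map `b : V × W → U`, i.e. the sum over `(k, l)`-shuffles of `± b (α (…)) (β (…))`. -/
def wedge {k l : ℕ} (b : V →ₗ[ℝ] W →ₗ[ℝ] U) (α : T [⋀^Fin k]→L[ℝ] V) (β : T [⋀^Fin l]→L[ℝ] W) :
    T [⋀^Fin (k + l)]→L[ℝ] U :=
  toContinuousForm (((TensorProduct.lift b).compAlternatingMap
    (α.toAlternatingMap.domCoprod β.toAlternatingMap)).domDomCongr finSumFinEquiv)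

/-- The normalization of the wedge product:
`k! l! (α ∧ β) (v) = ∑_σ sgn(σ) b (α (v_σ(1), …, v_σ(k))) (β (v_σ(k+1), …, v_σ(k+l)))`. -/
theorem smul_wedge_apply {k l : ℕ} (b : V →ₗ[ℝ] W →ₗ[ℝ] U) (α : T [⋀^Fin k]→L[ℝ] V)
    (β : T [⋀^Fin l]→L[ℝ] W) (v : Fin (k + l) → T) :
    (k.factorial * l.factorial) • wedge b α β v =
      ∑ σ : Equiv.Perm (Fin k ⊕ Fin l), Equiv.Perm.sign σ •
        b (α fun i => v (finSumFinEquiv (σ (Sum.inl i))))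
          (β fun i => v (finSumFinEquiv (σ (Sum.inr i)))) := by
  have h := MultilinearMap.domCoprod_alternization_eq α.toAlternatingMap β.toAlternatingMap
  have h2 := congrArg (fun f => TensorProduct.lift b (f (fun i => v (finSumFinEquiv i)))) h
  simp only [MultilinearMap.alternatization_apply, map_sum, AlternatingMap.smul_apply, map_nsmul,
    Fintype.card_fin] at h2
  have h3 : wedge b α β v = TensorProduct.lift b (α.toAlternatingMap.domCoprod β.toAlternatingMap
    fun i => v (finSumFinEquiv i)) := rfl
  rw [h3, ← h2]
  refine Finset.sum_congr rfl fun σ _ => ?_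
  rcases Int.units_eq_one_or (Equiv.Perm.sign σ) with h | h <;> rw [h] <;> simp

end Wedge

/-! ### Differential forms on a (boundaryless) manifold

A `V`-valued `k`-form on `M` is a function `η : Π x : M, TangentSpace I x [⋀^Fin k]→L[ℝ] V`. -/

section Forms

variable {E H M : Type*} [NormedAddCommGroup E] [NormedSpace ℝ E] [TopologicalSpace H]
  (I : ModelWithCorners ℝ E H) [TopologicalSpace M] [ChartedSpace H M]
  {V : Type*} [NormedAddCommGroup V] [NormedSpace ℝ V]

/-- The expression of a form in the preferred chart at `x₀`: its pull-back by the inverse of the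
chart. -/
def chartRep {k : ℕ} (η : Π x : M, TangentSpace I x [⋀^Fin k]→L[ℝ] V) (x₀ : M) :
    E → E [⋀^Fin k]→L[ℝ] V :=
  fun y => (η ((extChartAt I x₀).symm y)).compContinuousLinearMap
    (mfderiv 𝓘(ℝ, E) I (extChartAt I x₀).symm y : E →L[ℝ] _)

/-- Smoothness of a form: its expression in charts is smooth. -/
def IsSmoothForm {k : ℕ} (η : Π x : M, TangentSpace I x [⋀^Fin k]→L[ℝ] V) : Prop :=
  ∀ x₀ : M, ContDiffOn ℝ ∞ (chartRep I η x₀) (extChartAt I x₀).target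

/-- The exterior derivative `dη`, computed at `x` in the preferred chart at `x`. The convention is
`dα (X, Y) = X (α Y) - Y (α X) - α [X, Y]` for a 1-form `α`. -/
def dForm {k : ℕ} (η : Π x : M, TangentSpace I x [⋀^Fin k]→L[ℝ] V) (x : M) :
    TangentSpace I x [⋀^Fin (k + 1)]→L[ℝ] V :=
  (extDeriv (chartRep I η x) (extChartAt I x x)).compContinuousLinearMap
    (mfderiv I 𝓘(ℝ, E) (extChartAt I x) x : TangentSpace I x →L[ℝ] E)

/-- A field of linear maps `T_x M → V`, as a `V`-valued 1-form. -/
def oneForm {V : Type*} [AddCommGroup V] [Module ℝ V] [TopologicalSpace V]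
    (α : Π x : M, TangentSpace I x →L[ℝ] V) (x : M) : TangentSpace I x [⋀^Fin 1]→L[ℝ] V :=
  ContinuousAlternatingMap.ofSubsingleton ℝ (TangentSpace I x) V (0 : Fin 1) (α x)

/-- Smoothness of a vector field. -/
def IsSmoothField [IsManifold I ∞ M] (X : Π x : M, TangentSpace I x) : Prop :=
  ContMDiff I I.tangent ∞ (fun x => (⟨x, X x⟩ : TangentBundle I M))

/-- The 1-form `Y ↦ η (X, Y)`. -/
def contract₂ {x : M} (η : TangentSpace I x [⋀^Fin 2]→L[ℝ] ℝ) (X : TangentSpace I x) :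
    TangentSpace I x →L[ℝ] ℝ :=
  η.toContinuousMultilinearMap.toContinuousLinearMap ![X, 0] 1

/-- The 1-form `Z ↦ φ (X, Y, Z)`. -/
def contract₃ {x : M} (φ : TangentSpace I x [⋀^Fin 3]→L[ℝ] ℝ) (X Y : TangentSpace I x) :
    TangentSpace I x →L[ℝ] ℝ :=
  φ.toContinuousMultilinearMap.toContinuousLinearMap ![X, Y, 0] 2

@[simp] theorem contract₂_apply {x : M} (η : TangentSpace I x [⋀^Fin 2]→L[ℝ] ℝ)
    (X Y : TangentSpace I x) : contract₂ I η X Y = η ![X, Y] := by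
  have h : Function.update ![X, 0] 1 Y = ![X, Y] := by
    ext i; fin_cases i <;> simp
  simp [contract₂, h]

@[simp] theorem contract₃_apply {x : M} (φ : TangentSpace I x [⋀^Fin 3]→L[ℝ] ℝ)
    (X Y Z : TangentSpace I x) : contract₃ I φ X Y Z = φ ![X, Y, Z] := by
  have h : Function.update ![X, Y, 0] 2 Z = ![X, Y, Z] := by
    ext i; fin_cases i <;> simp
  simp [contract₃, h]

/-- The Lie derivative of a 1-form, `𝓛_X α = i_X dα + d (α X)`. -/
def lieDerivOneForm (X : Π x : M, TangentSpace I x) (α : Π x : M, TangentSpace I x →L[ℝ] ℝ)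
    (x : M) : TangentSpace I x →L[ℝ] ℝ :=
  contract₂ I (dForm I (oneForm I α) x) (X x) +
    (show TangentSpace I x →L[ℝ] ℝ from mfderiv I 𝓘(ℝ, ℝ) (fun y => α y (X y)) x)

end Forms

section Pullback

variable {E H M E' H' M' : Type*} [NormedAddCommGroup E] [NormedSpace ℝ E] [TopologicalSpace H]
  (I : ModelWithCorners ℝ E H) [TopologicalSpace M] [ChartedSpace H M]
  [NormedAddCommGroup E'] [NormedSpace ℝ E'] [TopologicalSpace H']
  (I' : ModelWithCorners ℝ E' H') [TopologicalSpace M'] [ChartedSpace H' M']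

/-- The pull-back of a form by a map. -/
def pullbackForm {k : ℕ} (J : M → M') (η : Π y : M', TangentSpace I' y [⋀^Fin k]→L[ℝ] ℝ) (x : M) :
    TangentSpace I x [⋀^Fin k]→L[ℝ] ℝ :=
  (η (J x)).compContinuousLinearMap (mfderiv I I' J x)

end Pullback

/-! ### Dirac structures -/

section Dirac

variable {E H M : Type*} [NormedAddCommGroup E] [NormedSpace ℝ E] [TopologicalSpace H]
  (I : ModelWithCorners ℝ E H) [TopologicalSpace M] [ChartedSpace H M]

/-- The fibre `T_x M ⊕ T_x^* M`. -/
abbrev GenTangent (x : M) : Type _ := TangentSpace I x × (TangentSpace I x →L[ℝ] ℝ)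

/-- `L` is a smooth subbundle of `TM ⊕ T^*M`, given that it has constant rank (which is automatic
for lagrangian families): through every element of `L` there passes a smooth section of `L`. -/
def IsSmoothFamily [IsManifold I ∞ M] (L : Π x : M, Submodule ℝ (GenTangent I x)) : Prop :=
  ∀ (x : M), ∀ e ∈ L x, ∃ (X : Π y : M, TangentSpace I y) (α : Π y : M, TangentSpace I y →L[ℝ] ℝ),
    IsSmoothField I X ∧ IsSmoothForm I (oneForm I α) ∧ (∀ y, (X y, α y) ∈ L y) ∧ (X x, α x) = e

/-- `L` is lagrangian, i.e. `L = L^⊥` pointwise, for `⟨(X, α), (Y, β)⟩ = β X + α Y`. -/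
def IsLagrangian (L : Π x : M, Submodule ℝ (GenTangent I x)) : Prop :=
  ∀ (x : M) (e : GenTangent I x), e ∈ L x ↔ ∀ f ∈ L x, f.2 e.1 + e.2 f.1 = 0

/-- The `φ`-twisted Courant bracket
`⟦(X, α), (Y, β)⟧_φ = ([X, Y], 𝓛_X β - i_Y dα + i_Y i_X φ)`. -/
def courant (φ : Π x : M, TangentSpace I x [⋀^Fin 3]→L[ℝ] ℝ)
    (X : Π x : M, TangentSpace I x) (α : Π x : M, TangentSpace I x →L[ℝ] ℝ)
    (Y : Π x : M, TangentSpace I x) (β : Π x : M, TangentSpace I x →L[ℝ] ℝ) (x : M) :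
    GenTangent I x :=
  (VectorField.mlieBracket I X Y x,
    lieDerivOneForm I X β x - contract₂ I (dForm I (oneForm I α) x) (Y x)
      + contract₃ I (φ x) (X x) (Y x))

/-- `φ`-twisted Dirac structures on `M`, where `φ` is a closed 3-form. -/
structure IsDirac [IsManifold I ∞ M] (L : Π x : M, Submodule ℝ (GenTangent I x))
    (φ : Π x : M, TangentSpace I x [⋀^Fin 3]→L[ℝ] ℝ) : Prop where
  smooth_twist : IsSmoothForm I φ
  closed_twist : ∀ x, dForm I φ x = 0
  smooth : IsSmoothFamily I L
  lagrangian : IsLagrangian I L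
  involutive : ∀ (X : Π x : M, TangentSpace I x) (α : Π x : M, TangentSpace I x →L[ℝ] ℝ)
    (Y : Π x : M, TangentSpace I x) (β : Π x : M, TangentSpace I x →L[ℝ] ℝ),
    IsSmoothField I X → IsSmoothForm I (oneForm I α) →
    IsSmoothField I Y → IsSmoothForm I (oneForm I β) →
    (∀ x, (X x, α x) ∈ L x) → (∀ x, (Y x, β x) ∈ L x) →
    ∀ x, courant I φ X α Y β x ∈ L x

/-- The graph `{(X, i_X η)}` of a 2-form. -/
def graph (η : Π x : M, TangentSpace I x [⋀^Fin 2]→L[ℝ] ℝ) (x : M) :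
    Submodule ℝ (GenTangent I x) where
  carrier := {e | ∀ Y, e.2 Y = η x ![e.1, Y]}
  zero_mem' := by
    intro Y
    exact ((η x).map_coord_zero (m := ![0, Y]) 0 rfl).symm
  add_mem' := by
    intro e f he hf Y
    have hu (Z : TangentSpace I x) : Function.update ![0, Y] 0 Z = ![Z, Y] := by
      ext i; fin_cases i <;> simp
    have h := (η x).map_update_add ![0, Y] 0 e.1 f.1
    rw [hu, hu, hu] at h
    rw [Prod.snd_add, add_apply, he Y, hf Y, Prod.fst_add, h]
  smul_mem' := by
    intro c e he Y
    have hu (Z : TangentSpace I x) : Function.update ![0, Y] 0 Z = ![Z, Y] := by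
      ext i; fin_cases i <;> simp
    have h := (η x).map_update_smul ![0, Y] 0 c e.1
    rw [hu, hu] at h
    rw [Prod.smul_snd, smul_apply, he Y, Prod.smul_fst, h]

end Dirac

section DiracMaps

variable {E H M E' H' M' : Type*} [NormedAddCommGroup E] [NormedSpace ℝ E] [TopologicalSpace H]
  (I : ModelWithCorners ℝ E H) [TopologicalSpace M] [ChartedSpace H M] [IsManifold I ∞ M]
  [NormedAddCommGroup E'] [NormedSpace ℝ E'] [TopologicalSpace H']
  (I' : ModelWithCorners ℝ E' H') [TopologicalSpace M'] [ChartedSpace H' M'] [IsManifold I' ∞ M']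

/-- Strong Dirac maps `J : (M, L, φ) → (M', L', φ')`. -/
structure IsStrongDiracMap (L : Π x : M, Submodule ℝ (GenTangent I x))
    (φ : Π x : M, TangentSpace I x [⋀^Fin 3]→L[ℝ] ℝ)
    (L' : Π y : M', Submodule ℝ (GenTangent I' y))
    (φ' : Π y : M', TangentSpace I' y [⋀^Fin 3]→L[ℝ] ℝ) (J : M → M') : Prop where
  dirac_source : IsDirac I L φ
  dirac_target : IsDirac I' L' φ'
  smooth : ContMDiff I I' ∞ J
  twist : ∀ x, φ x = pullbackForm I I' J φ' x
  /-- `L'` is the forward image of `L`. -/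
  forward : ∀ (x : M) (e : GenTangent I' (J x)), e ∈ L' (J x) ↔
    ∃ X : TangentSpace I x, mfderiv I I' J x X = e.1 ∧ (X, e.2.comp (mfderiv I I' J x)) ∈ L x
  transversal : ∀ (x : M) (X : TangentSpace I x),
    mfderiv I I' J x X = 0 → (X, (0 : TangentSpace I x →L[ℝ] ℝ)) ∈ L x → X = 0

/-- `J : (M, η) → (M', L', φ')` is a presymplectic realization: a strong Dirac map for which the
Dirac structure on the source is (the graph of) a 2-form. -/
def IsPresymplecticRealization (η : Π x : M, TangentSpace I x [⋀^Fin 2]→L[ℝ] ℝ)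
    (L' : Π y : M', Submodule ℝ (GenTangent I' y))
    (φ' : Π y : M', TangentSpace I' y [⋀^Fin 3]→L[ℝ] ℝ) (J : M → M') : Prop :=
  IsSmoothForm I η ∧
    ∃ φ : Π x : M, TangentSpace I x [⋀^Fin 3]→L[ℝ] ℝ, IsStrongDiracMap I I' (graph I η) φ L' φ' J

/-- Let `L'` be the Dirac structure `{(ρ v, σ v) | v ∈ 𝔨}`, for an action `ρ` of the Lie algebra
`(𝔨, br)` on `M'` and a linear map `σ` from `𝔨` to 1-forms on `M'`. The action of `𝔨` on `M` induced
by a strong Dirac map `J : (M, L) → (M', L')` is the Lie algebra action `ρM` uniquely determined by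
`dJ ∘ ρM = ρ` and `(ρM v, J^* (σ v)) ∈ L`. -/
structure IsInducedAction {𝔨 : Type*} [AddCommGroup 𝔨] [Module ℝ 𝔨] (br : 𝔨 → 𝔨 → 𝔨)
    (ρ : 𝔨 → Π y : M', TangentSpace I' y) (σ : 𝔨 → Π y : M', TangentSpace I' y →L[ℝ] ℝ)
    (L : Π x : M, Submodule ℝ (GenTangent I x)) (J : M → M')
    (ρM : 𝔨 → Π x : M, TangentSpace I x) : Prop where
  map_add : ∀ u v x, ρM (u + v) x = ρM u x + ρM v x
  map_smul : ∀ (c : ℝ) v x, ρM (c • v) x = c • ρM v x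
  smooth : ∀ v, IsSmoothField I (ρM v)
  bracket : ∀ u v x, ρM (br u v) x = VectorField.mlieBracket I (ρM u) (ρM v) x
  equivariant : ∀ v x, mfderiv I I' J x (ρM v x) = ρ v (J x)
  moment : ∀ v x, (ρM v x, (σ v (J x)).comp (mfderiv I I' J x)) ∈ L x
  unique : ∀ v x (X : TangentSpace I x), mfderiv I I' J x X = ρ v (J x) →
    (X, (σ v (J x)).comp (mfderiv I I' J x)) ∈ L x → X = ρM v x

end DiracMaps

section Products

variable {E H M E' H' M' : Type*} [NormedAddCommGroup E] [NormedSpace ℝ E] [TopologicalSpace H]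
  (I : ModelWithCorners ℝ E H) [TopologicalSpace M] [ChartedSpace H M]
  [NormedAddCommGroup E'] [NormedSpace ℝ E'] [TopologicalSpace H']
  (I' : ModelWithCorners ℝ E' H') [TopologicalSpace M'] [ChartedSpace H' M']

/-- The covector `pr₁^* β₁ + pr₂^* β₂` on a product. -/
def prodCovector (z : M × M') (β₁ : TangentSpace I z.1 →L[ℝ] ℝ) (β₂ : TangentSpace I' z.2 →L[ℝ] ℝ) :
    TangentSpace (I.prod I') z →L[ℝ] ℝ :=
  β₁.comp (mfderiv (I.prod I') I Prod.fst z) + β₂.comp (mfderiv (I.prod I') I' Prod.snd z)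

/-- The tangent vector `(X₁, X₂)` to a product. -/
def prodVector (z : M × M') (X₁ : TangentSpace I z.1) (X₂ : TangentSpace I' z.2) :
    TangentSpace (I.prod I') z :=
  (X₁, X₂)

/-- The product `L × L'` of two families of subspaces. -/
def prodFamily (L : Π x : M, Submodule ℝ (GenTangent I x))
    (L' : Π y : M', Submodule ℝ (GenTangent I' y)) (z : M × M') :
    Submodule ℝ (GenTangent (I.prod I') z) where
  carrier := {e | ∃ β₁ β₂, (mfderiv (I.prod I') I Prod.fst z e.1, β₁) ∈ L z.1 ∧
    (mfderiv (I.prod I') I' Prod.snd z e.1, β₂) ∈ L' z.2 ∧ e.2 = prodCovector I I' z β₁ β₂}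
  zero_mem' := by
    refine ⟨0, 0, ?_, ?_, ?_⟩
    · have h := map_zero (mfderiv (I.prod I') I (Prod.fst : M × M' → M) z)
      exact (congrArg (fun X => (X, (0 : TangentSpace I z.1 →L[ℝ] ℝ)) ∈ L z.1) h).mpr
        (L z.1).zero_mem
    · have h := map_zero (mfderiv (I.prod I') I' (Prod.snd : M × M' → M') z)
      exact (congrArg (fun X => (X, (0 : TangentSpace I' z.2 →L[ℝ] ℝ)) ∈ L' z.2) h).mpr
        (L' z.2).zero_mem
    · rw [prodCovector, ContinuousLinearMap.zero_comp, ContinuousLinearMap.zero_comp, add_zero]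
      rfl
  add_mem' := by
    rintro e f ⟨β₁, β₂, h₁, h₂, h₃⟩ ⟨γ₁, γ₂, k₁, k₂, k₃⟩
    refine ⟨β₁ + γ₁, β₂ + γ₂, ?_, ?_, ?_⟩
    · have h := map_add (mfderiv (I.prod I') I (Prod.fst : M × M' → M) z) e.1 f.1
      exact (congrArg (fun X => (X, β₁ + γ₁) ∈ L z.1) h).mpr ((L z.1).add_mem h₁ k₁)
    · have h := map_add (mfderiv (I.prod I') I' (Prod.snd : M × M' → M') z) e.1 f.1
      exact (congrArg (fun X => (X, β₂ + γ₂) ∈ L' z.2) h).mpr ((L' z.2).add_mem h₂ k₂)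
    · rw [Prod.snd_add, h₃, k₃]
      simp only [prodCovector, ContinuousLinearMap.add_comp]
      abel
  smul_mem' := by
    rintro c e ⟨β₁, β₂, h₁, h₂, h₃⟩
    refine ⟨c • β₁, c • β₂, ?_, ?_, ?_⟩
    · have h := map_smul (mfderiv (I.prod I') I (Prod.fst : M × M' → M) z) c e.1
      exact (congrArg (fun X => (X, c • β₁) ∈ L z.1) h).mpr ((L z.1).smul_mem c h₁)
    · have h := map_smul (mfderiv (I.prod I') I' (Prod.snd : M × M' → M') z) c e.1
      exact (congrArg (fun X => (X, c • β₂) ∈ L' z.2) h).mpr ((L' z.2).smul_mem c h₂)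
    · rw [Prod.smul_snd, h₃]
      simp only [prodCovector, ContinuousLinearMap.smul_comp, smul_add]

/-- The form `pr₁^* φ + pr₂^* φ'` on a product. -/
def prodForm {k : ℕ} (φ : Π x : M, TangentSpace I x [⋀^Fin k]→L[ℝ] ℝ)
    (φ' : Π y : M', TangentSpace I' y [⋀^Fin k]→L[ℝ] ℝ) (z : M × M') :
    TangentSpace (I.prod I') z [⋀^Fin k]→L[ℝ] ℝ :=
  pullbackForm (I.prod I') I Prod.fst φ z + pullbackForm (I.prod I') I' Prod.snd φ' z

end Products

/-! ### Manin pairs -/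

/-- `(𝔡, 𝔤)` is a Manin pair for the bilinear form `B`: `B` is symmetric, nondegenerate,
ad-invariant and of signature `(n, n)`, and the Lie subalgebra `𝔤` is maximal isotropic. (These
conditions are insensitive to replacing the Lie bracket by its opposite.) -/
structure IsManinPair {𝔡 : Type*} [LieRing 𝔡] [LieAlgebra ℝ 𝔡] (B : LinearMap.BilinForm ℝ 𝔡)
    (𝔤 : LieSubalgebra ℝ 𝔡) : Prop where
  symm : ∀ x y, B x y = B y x
  nondegenerate : B.Nondegenerate
  invariant : ∀ x y z : 𝔡, B ⁅x, y⁆ z + B y ⁅x, z⁆ = 0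
  signature : ∃ (n : ℕ) (b : Module.Basis (Fin n ⊕ Fin n) ℝ 𝔡),
    (∀ i, B (b (Sum.inl i)) (b (Sum.inl i)) = 1) ∧ (∀ i, B (b (Sum.inr i)) (b (Sum.inr i)) = -1) ∧
    ∀ i j, i ≠ j → B (b i) (b j) = 0
  isotropic : ∀ x ∈ 𝔤, ∀ y ∈ 𝔤, B x y = 0
  maximal : ∀ W : Submodule ℝ 𝔡, (∀ x ∈ W, ∀ y ∈ W, B x y = 0) →
    𝔤.toSubmodule ≤ W → W = 𝔤.toSubmodule

/-! ### Lie groups: translations, Maurer-Cartan forms, adjoint action -/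

section LieGroups

variable {E H D : Type*} [NormedAddCommGroup E] [NormedSpace ℝ E] [TopologicalSpace H]
  (I : ModelWithCorners ℝ E H) [TopologicalSpace D] [ChartedSpace H D] [Group D]

/-- The left-invariant vector field `u^l`. -/
def leftField (u : GroupLieAlgebra I D) (a : D) : TangentSpace I a :=
  mulInvariantVectorField u a

/-- The right-invariant vector field `u^r`. -/
def rightField (u : GroupLieAlgebra I D) (a : D) : TangentSpace I a :=
  (mfderiv I I (fun x : D => x * a) 1 : E →L[ℝ] E) u

/-- The left Maurer-Cartan form, `θ^L (u^l) = u`. -/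
def thetaL (a : D) : TangentSpace I a →L[ℝ] GroupLieAlgebra I D :=
  (mfderiv I I (fun x : D => a⁻¹ * x) a : E →L[ℝ] E)

/-- The right Maurer-Cartan form, `θ^R (u^r) = u`. -/
def thetaR (a : D) : TangentSpace I a →L[ℝ] GroupLieAlgebra I D :=
  (mfderiv I I (fun x : D => x * a⁻¹) a : E →L[ℝ] E)

/-- The adjoint action `Ad_a`. -/
def Ad (a : D) : GroupLieAlgebra I D →L[ℝ] GroupLieAlgebra I D :=
  (mfderiv I I (fun x : D => a * x * a⁻¹) 1 : E →L[ℝ] E)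

/-- `𝔤` is the Lie algebra of the closed subgroup `G` of `D`, i.e. the set of velocities at `1` of
smooth curves in `D` that lie in `G`. -/
def IsLieAlgebraOf (G : Subgroup D) (𝔤 : Set (GroupLieAlgebra I D)) : Prop :=
  ∀ u : GroupLieAlgebra I D, u ∈ 𝔤 ↔ ∃ γ : ℝ → D, ContMDiff 𝓘(ℝ, ℝ) I ∞ γ ∧ γ 0 = 1 ∧
    (∀ t, γ t ∈ G) ∧ (mfderiv 𝓘(ℝ, ℝ) I γ 0 : ℝ →L[ℝ] E) 1 = (u : E)

variable (D) in
/-- The Lie algebra of `D` as its underlying normed space. -/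
def toModel : GroupLieAlgebra I D ≃L[ℝ] E :=
  ContinuousLinearEquiv.refl ℝ E

/-- The Lie bracket of `𝔡` defined by means of right-invariant vector fields, as a bilinear map. It
is the opposite of the bracket `⁅·, ·⁆` on `GroupLieAlgebra`, which is defined by means of
left-invariant vector fields. -/
def rightBracket [CompleteSpace E] [LieGroup I ∞ D] :
    GroupLieAlgebra I D →ₗ[ℝ] GroupLieAlgebra I D →ₗ[ℝ] GroupLieAlgebra I D :=
  -(LieAlgebra.ad ℝ (GroupLieAlgebra I D) : GroupLieAlgebra I D →ₗ[ℝ] _)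

end LieGroups

/-! ### The homogeneous space `S = D/G` and the forms defined by a connection splitting -/

section Quotient

variable {E H D F K : Type*} [NormedAddCommGroup E] [NormedSpace ℝ E] [TopologicalSpace H]
  (I : ModelWithCorners ℝ E H) [TopologicalSpace D] [ChartedSpace H D] [Group D]
  [NormedAddCommGroup F] [NormedSpace ℝ F] [TopologicalSpace K]
  (I' : ModelWithCorners ℝ F K) (G : Subgroup D) [ChartedSpace K (D ⧸ G)]

/-- The projection `p : D → D/G`. The smooth structure of `D/G` is the unique one for which `p` is a
submersion. -/
def proj (a : D) : D ⧸ G := (a : D ⧸ G)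

/-- The infinitesimal dressing action `ρ_S` at `x ∈ D/G`: the derivative at `1` of `a ↦ a • x`. -/
def dressing (x : D ⧸ G) : GroupLieAlgebra I D →L[ℝ] TangentSpace I' x :=
  (mfderiv I I' (fun a : D => a • x) 1 : E →L[ℝ] F)

variable (B : LinearMap.BilinForm ℝ (GroupLieAlgebra I D))
  (s : Π x : D ⧸ G, TangentSpace I' x →L[ℝ] GroupLieAlgebra I D)

/-- Isotropic connections on `p : D → D/G`, as smooth 1-forms `s ∈ Ω¹(S, 𝔡)` with `ρ_S ∘ s = id`
and isotropic image; the horizontal space at `a` is the right translate by `a` of the image of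
`s` at `p a`. -/
structure IsIsotropicSplitting : Prop where
  smooth : IsSmoothForm I' (oneForm I' fun x => (toModel D I : GroupLieAlgebra I D →L[ℝ] E).comp (s x))
  splitting : ∀ x (X : TangentSpace I' x), dressing I I' G x (s x X) = X
  isotropic : ∀ x (X Y : TangentSpace I' x), B (s x X) (s x Y) = 0

/-- The covector `σ(u)_x : X ↦ ⟨s(X), u⟩`, linear in `u`. -/
def sigma [FiniteDimensional ℝ E] (x : D ⧸ G) :
    GroupLieAlgebra I D →ₗ[ℝ] (TangentSpace I' x →L[ℝ] ℝ) where
  toFun u := (LinearMap.toContinuousLinearMap (B.flip u)).comp (s x)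
  map_add' u v := by ext X; simp
  map_smul' c u := by ext X; simp

/-- The family `L_S = {(ρ(u), σ(u)) | u ∈ 𝔤}`. -/
def diracS [FiniteDimensional ℝ E] (𝔤 : Submodule ℝ (GroupLieAlgebra I D)) (x : D ⧸ G) :
    Submodule ℝ (GenTangent I' x) :=
  𝔤.map ((dressing I I' G x : GroupLieAlgebra I D →ₗ[ℝ] TangentSpace I' x).prod
    (sigma I I' G B s x))

/-- The exterior derivative `ds ∈ Ω²(S, 𝔡)`. -/
def dSplitting (x : D ⧸ G) : TangentSpace I' x [⋀^Fin 2]→L[ℝ] GroupLieAlgebra I D :=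
  ((toModel D I).symm : E →L[ℝ] GroupLieAlgebra I D).compContinuousAlternatingMap
    (dForm I' (oneForm I' fun y => (toModel D I : GroupLieAlgebra I D →L[ℝ] E).comp (s y)) x)

/-- The 3-form `φ_S = ½ ⟨ds, s⟩ + ⅙ ⟨[s, s], s⟩`. -/
def phiS [CompleteSpace E] [FiniteDimensional ℝ F] [LieGroup I ∞ D] (x : D ⧸ G) :
    TangentSpace I' x [⋀^Fin 3]→L[ℝ] ℝ :=
  (1 / 2 : ℝ) • wedge B (dSplitting I I' G s x) (oneForm I' s x) +
    (1 / 6 : ℝ) • wedge B (wedge (rightBracket I) (oneForm I' s x) (oneForm I' s x))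
      (oneForm I' s x)

/-- The connection 1-form `θ_a = θ^L_a - Ad_{a⁻¹} (p^* s)` on `D`, with values in `𝔤 ⊆ 𝔡`. -/
def connectionForm (a : D) : TangentSpace I a →L[ℝ] GroupLieAlgebra I D :=
  thetaL I a - (Ad I a⁻¹).comp ((s (proj G a)).comp (mfderiv I I' (proj G) a))

/-- The 2-form `ω_D = ½ (⟨θ^R, Inv^* θ⟩ - ⟨θ^L, θ⟩)` on `D`. -/
def omegaD [FiniteDimensional ℝ E] (a : D) : TangentSpace I a [⋀^Fin 2]→L[ℝ] ℝ :=
  (1 / 2 : ℝ) • (wedge B (oneForm I (thetaR I) a)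
      (oneForm I (fun b => (connectionForm I I' G s b⁻¹).comp (mfderiv I I (fun c : D => c⁻¹) b)) a)
    - wedge B (oneForm I (thetaL I) a) (oneForm I (connectionForm I I' G s) a))

end Quotient

end DiracManin

end

/-! The whole argument rests on the operator `P = s ∘ ρ_S` on `𝔡`. Its image (that of `s`) and its
kernel (the stabilizer, `Ad_a 𝔤` at `p(a)`) are both isotropic, so `P + Pᵀ = 1` for the given form.
Consequently `u ↦ (ρ_S u, ⟨s, u⟩)` identifies `𝔡` isometrically with each fibre of `TS ⊕ T^*S`, and
`L_S` becomes the constant subbundle with fibre `𝔤`. A maximal isotropic subspace in signature `(n,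
n)` equals its own orthogonal, so `L_S` is lagrangian; it is involutive because `𝔤` is a subalgebra.
The curvature `ds + ½[s, s]` takes values in the stabilizers, and `dφ_S = ½⟨curvature, curvature⟩`
(the term `⟨[s, s], [s, s]⟩` dies by Jacobi), so `φ_S` is closed. All this is carried out for an
abstract `IsSplitAction` (`projection_add_adjoint`, `ker_curvature`, `extD_twist`, `involutive`,
`isDirac`). The class is stable under products, which takes care of `S × S` at once.

On `D`, invariance of the form gives `ω_D = η + Inv^*η` with `η = ½⟨θ^R, p^*s⟩`. The stabilizer
properties and the Maurer-Cartan equation give `dη = -p^*φ_S` plus a multiple of the Cartan 3-form.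
The latter changes sign under inversion, whence `dω_D = -(p^*φ_S + p̄^*φ_S)`. As the graph of any
2-form is Dirac for minus its differential, the source is Dirac for the required twist.

The rest follows from one identity. If `X = w^r` satisfies `dp X = ρ_S u` and `dp̄ X = ρ_S v`, then
the 1-form `p^*⟨s, u⟩ + p̄^*⟨s, v⟩ - i_X ω_D` evaluates on `w'^r` to `⟨u - Ad_a v - w, w'⟩`. By
nondegeneracy the moment condition is equivalent to `X = u^r - v^l` (`moment_iff`). This gives the
formula for the induced action and its uniqueness, the trivial kernel intersection (`u = v = 0`),
and the forward image condition, where vanishing of `dp (v^l)` and `dp̄ (u^r)` detects `u, v ∈ 𝔤`.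
-/

noncomputable section

namespace DiracManin

set_option linter.unusedSectionVars false

/-! ### Smooth families of alternating forms -/

section FormValued

variable {E' T V W U : Type*} [NormedAddCommGroup E'] [NormedSpace ℝ E']
  [NormedAddCommGroup T] [NormedSpace ℝ T] [FiniteDimensional ℝ T]
  [NormedAddCommGroup V] [NormedSpace ℝ V] [FiniteDimensional ℝ V]
  [NormedAddCommGroup W] [NormedSpace ℝ W] [FiniteDimensional ℝ W]
  [NormedAddCommGroup U] [NormedSpace ℝ U] [FiniteDimensional ℝ U]

/-- Evaluation of an alternating form at all families of vectors of a basis. -/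
def basisEval (T V : Type*) [NormedAddCommGroup T] [NormedSpace ℝ T] [FiniteDimensional ℝ T]
    [NormedAddCommGroup V] [NormedSpace ℝ V] (k : ℕ) :
    (T [⋀^Fin k]→L[ℝ] V) →ₗ[ℝ] ((Fin k → Fin (Module.finrank ℝ T)) → V) where
  toFun f j := f fun i => Module.finBasis ℝ T (j i)
  map_add' _ _ := rfl
  map_smul' _ _ := rfl

theorem basisEval_injective (k : ℕ) : Function.Injective (basisEval T V k) := by
  intro f g h
  apply ContinuousAlternatingMap.toAlternatingMap_injective
  apply AlternatingMap.coe_multilinearMap_injective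
  exact Module.Basis.ext_multilinear (fun _ => Module.finBasis ℝ T) fun j => congrFun h j

/-- On finite-dimensional spaces of forms every linear or bilinear operation, in particular the
wedge product, is automatically continuous and hence smooth. -/
instance finiteDimensional_continuousAlternatingMap (k : ℕ) :
    FiniteDimensional ℝ (T [⋀^Fin k]→L[ℝ] V) :=
  FiniteDimensional.of_injective (basisEval T V k) (basisEval_injective k)

/-- Smoothness of a form-valued map can be checked on constant vectors. -/
theorem contDiffOn_form_iff {k : ℕ} {n : WithTop ℕ∞} {f : E' → T [⋀^Fin k]→L[ℝ] V} {s : Set E'} :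
    ContDiffOn ℝ n f s ↔ ∀ v : Fin k → T, ContDiffOn ℝ n (fun y => f y v) s := by
  constructor
  · intro h v
    exact (ContinuousAlternatingMap.apply ℝ T V v).contDiff.comp_contDiffOn h
  · intro h
    obtain ⟨g, hg⟩ := (basisEval T V k).exists_leftInverse_of_injective
      (LinearMap.ker_eq_bot.mpr (basisEval_injective k))
    have h1 : ContDiffOn ℝ n (fun y => basisEval T V k (f y)) s :=
      contDiffOn_pi.mpr fun j => h _
    refine ((LinearMap.toContinuousLinearMap g).contDiff.comp_contDiffOn h1).congr fun y _ => ?_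
    exact (LinearMap.congr_fun hg (f y)).symm

theorem fderiv_form_apply {k : ℕ} {f : E' → T [⋀^Fin k]→L[ℝ] V} {y : E'}
    (hf : DifferentiableAt ℝ f y) (v : Fin k → T) (X : E') :
    fderiv ℝ (fun z => f z v) y X = fderiv ℝ f y X v :=
  congrArg (fun L => L X)
    ((ContinuousAlternatingMap.apply ℝ T V v).hasFDerivAt.comp y hf.hasFDerivAt).fderiv

end FormValued

/-! ### Wedge products in low degree -/

section WedgeEval

variable {T U V W : Type*}
  [AddCommGroup T] [Module ℝ T] [TopologicalSpace T] [IsTopologicalAddGroup T]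
  [ContinuousSMul ℝ T] [T2Space T] [FiniteDimensional ℝ T]
  [AddCommGroup U] [Module ℝ U] [TopologicalSpace U] [IsTopologicalAddGroup U]
  [ContinuousSMul ℝ U]
  [AddCommGroup V] [Module ℝ V] [TopologicalSpace V]
  [AddCommGroup W] [Module ℝ W] [TopologicalSpace W]

theorem form_swap₂ (η : T [⋀^Fin 2]→L[ℝ] V) (X Y : T) : η ![Y, X] = -η ![X, Y] := by
  have h := η.toAlternatingMap.map_swap ![X, Y] (i := 0) (j := 1) (by decide)
  have h2 : (![X, Y] ∘ Equiv.swap (0 : Fin 2) 1) = ![Y, X] := by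
    ext i; fin_cases i <;> simp
  rw [h2] at h
  exact h

/-- Permutations of a single `Fin (k + l)` can be enumerated by `decide` in low degree. -/
theorem smul_wedge_apply_perm {k l : ℕ} (b : V →ₗ[ℝ] W →ₗ[ℝ] U) (α : T [⋀^Fin k]→L[ℝ] V)
    (β : T [⋀^Fin l]→L[ℝ] W) (v : Fin (k + l) → T) :
    (k.factorial * l.factorial) • wedge b α β v =
      ∑ σ : Equiv.Perm (Fin (k + l)), Equiv.Perm.sign σ •
        b (α fun i => v (σ (Fin.castAdd l i))) (β fun i => v (σ (Fin.natAdd k i))) := by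
  rw [smul_wedge_apply, ← Equiv.sum_comp (finSumFinEquiv (m := k) (n := l)).permCongr]
  refine Finset.sum_congr rfl fun σ _ => ?_
  simp [Equiv.permCongr_apply]

theorem wedge_one_one (b : V →ₗ[ℝ] W →ₗ[ℝ] U) (α : T [⋀^Fin 1]→L[ℝ] V) (β : T [⋀^Fin 1]→L[ℝ] W)
    (X Y : T) :
    wedge b α β ![X, Y] = b (α ![X]) (β ![Y]) - b (α ![Y]) (β ![X]) := by
  have h := smul_wedge_apply_perm b α β ![X, Y]
  rw [show (Nat.factorial 1 * Nat.factorial 1) = 1 from rfl, one_smul] at h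
  refine h.trans ?_
  have hu : (Finset.univ : Finset (Equiv.Perm (Fin (1 + 1)))) = {1, Equiv.swap 0 1} := by decide
  rw [hu, Finset.sum_pair (by decide), Equiv.Perm.sign_one, Equiv.Perm.sign_swap (by decide),
    one_smul, Units.neg_smul, one_smul, ← sub_eq_add_neg]
  congr 1
  · congr 2
    · congr 1; ext i; fin_cases i; rfl
    · ext i; fin_cases i; rfl
  · congr 2
    · congr 1; ext i; fin_cases i; rfl
    · ext i; fin_cases i; rfl

theorem wedge_two_one (b : V →ₗ[ℝ] W →ₗ[ℝ] U) (η : T [⋀^Fin 2]→L[ℝ] V) (β : T [⋀^Fin 1]→L[ℝ] W)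
    (X Y Z : T) :
    wedge b η β ![X, Y, Z] =
      b (η ![X, Y]) (β ![Z]) - b (η ![X, Z]) (β ![Y]) + b (η ![Y, Z]) (β ![X]) := by
  have h := smul_wedge_apply_perm b η β ![X, Y, Z]
  have hu : (Finset.univ : Finset (Equiv.Perm (Fin (2 + 1)))) =
      {1, Equiv.swap 0 1, Equiv.swap 0 2, Equiv.swap 1 2, Equiv.swap 0 1 * Equiv.swap 1 2,
        Equiv.swap 1 2 * Equiv.swap 0 1} := by decide
  have key : ∀ (σ : Equiv.Perm (Fin (2 + 1))) (i j k : Fin 3), σ 0 = i → σ 1 = j → σ 2 = k →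
      b (η fun m => ![X, Y, Z] (σ (Fin.castAdd 1 m))) (β fun m => ![X, Y, Z] (σ (Fin.natAdd 2 m))) =
        b (η ![![X, Y, Z] i, ![X, Y, Z] j]) (β ![![X, Y, Z] k]) := by
    rintro σ _ _ _ rfl rfl rfl
    congr 2
    · congr 1; ext m; fin_cases m <;> rfl
    · ext m; fin_cases m; rfl
  rw [hu, Finset.sum_insert (by decide), Finset.sum_insert (by decide),
    Finset.sum_insert (by decide), Finset.sum_insert (by decide), Finset.sum_insert (by decide),
    Finset.sum_singleton, key 1 0 1 2 rfl rfl rfl,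
    key (Equiv.swap 0 1) 1 0 2 (by decide) (by decide) (by decide),
    key (Equiv.swap 0 2) 2 1 0 (by decide) (by decide) (by decide),
    key (Equiv.swap 1 2) 0 2 1 (by decide) (by decide) (by decide),
    key (Equiv.swap 0 1 * Equiv.swap 1 2) 1 2 0 (by decide) (by decide) (by decide),
    key (Equiv.swap 1 2 * Equiv.swap 0 1) 2 0 1 (by decide) (by decide) (by decide),
    Equiv.Perm.sign_mul, Equiv.Perm.sign_mul, Equiv.Perm.sign_one,
    Equiv.Perm.sign_swap (by decide), Equiv.Perm.sign_swap (by decide),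
    Equiv.Perm.sign_swap (by decide)] at h
  rw [show (Nat.factorial 2 * Nat.factorial 1) = 2 from rfl] at h
  simp only [Matrix.cons_val_zero, Matrix.cons_val_one, Matrix.cons_val_two, Matrix.head_cons,
    Matrix.tail_cons, one_smul, Units.neg_smul, mul_neg, mul_one, neg_neg] at h
  rw [form_swap₂ η X Y, form_swap₂ η X Z, form_swap₂ η Y Z] at h
  simp only [map_neg, LinearMap.neg_apply, neg_neg] at h
  -- The six permutations agree in pairs, by exchanging the two arguments of `η`; this doubling is
  -- the factor `2! 1!` of the normalization.
  have h2 : (2 : ℝ) • wedge b η β ![X, Y, Z] = (2 : ℝ) • (b (η ![X, Y]) (β ![Z]) -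
      b (η ![X, Z]) (β ![Y]) + b (η ![Y, Z]) (β ![X])) := by
    rw [two_smul, two_smul, ← two_nsmul]
    refine h.trans ?_
    abel
  exact smul_right_injective _ (two_ne_zero' ℝ) h2

end WedgeEval

/-! ### Exterior derivative and Leibniz rules on a vector space -/

section ExtDerivWedge

variable {T V W U : Type*}
  [NormedAddCommGroup T] [NormedSpace ℝ T] [FiniteDimensional ℝ T]
  [NormedAddCommGroup V] [NormedSpace ℝ V] [FiniteDimensional ℝ V]
  [NormedAddCommGroup W] [NormedSpace ℝ W] [FiniteDimensional ℝ W]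
  [NormedAddCommGroup U] [NormedSpace ℝ U] [FiniteDimensional ℝ U]

theorem extDeriv_one {α : T → T [⋀^Fin 1]→L[ℝ] V} {y : T} (h : DifferentiableAt ℝ α y) (X Y : T) :
    extDeriv α y ![X, Y] = fderiv ℝ α y X ![Y] - fderiv ℝ α y Y ![X] := by
  rw [extDeriv_apply h, Fin.sum_univ_two]
  simp only [fderiv_form_apply h]
  have h0 : Fin.removeNth (0 : Fin 2) ![X, Y] = ![Y] := by ext i; fin_cases i; rfl
  have h1 : Fin.removeNth (1 : Fin 2) ![X, Y] = ![X] := by ext i; fin_cases i; rfl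
  rw [h0, h1]
  simp [sub_eq_add_neg]

theorem extDeriv_two {η : T → T [⋀^Fin 2]→L[ℝ] V} {y : T} (h : DifferentiableAt ℝ η y)
    (X Y Z : T) :
    extDeriv η y ![X, Y, Z] =
      fderiv ℝ η y X ![Y, Z] - fderiv ℝ η y Y ![X, Z] + fderiv ℝ η y Z ![X, Y] := by
  rw [extDeriv_apply h, Fin.sum_univ_three]
  simp only [fderiv_form_apply h]
  have h0 : Fin.removeNth (0 : Fin 3) ![X, Y, Z] = ![Y, Z] := by ext i; fin_cases i <;> rfl
  have h1 : Fin.removeNth (1 : Fin 3) ![X, Y, Z] = ![X, Z] := by ext i; fin_cases i <;> rfl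
  have h2 : Fin.removeNth (2 : Fin 3) ![X, Y, Z] = ![X, Y] := by ext i; fin_cases i <;> rfl
  rw [h0, h1, h2]
  simp [sub_eq_add_neg]

theorem extDeriv_three {η : T → T [⋀^Fin 3]→L[ℝ] V} {y : T} (h : DifferentiableAt ℝ η y)
    (X Y Z Q : T) :
    extDeriv η y ![X, Y, Z, Q] =
      fderiv ℝ η y X ![Y, Z, Q] - fderiv ℝ η y Y ![X, Z, Q] + fderiv ℝ η y Z ![X, Y, Q]
        - fderiv ℝ η y Q ![X, Y, Z] := by
  rw [extDeriv_apply h, Fin.sum_univ_four]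
  simp only [fderiv_form_apply h]
  have h0 : Fin.removeNth (0 : Fin 4) ![X, Y, Z, Q] = ![Y, Z, Q] := by ext i; fin_cases i <;> rfl
  have h1 : Fin.removeNth (1 : Fin 4) ![X, Y, Z, Q] = ![X, Z, Q] := by ext i; fin_cases i <;> rfl
  have h2 : Fin.removeNth (2 : Fin 4) ![X, Y, Z, Q] = ![X, Y, Q] := by ext i; fin_cases i <;> rfl
  have h3 : Fin.removeNth (3 : Fin 4) ![X, Y, Z, Q] = ![X, Y, Z] := by ext i; fin_cases i <;> rfl
  rw [h0, h1, h2, h3]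
  simp [sub_eq_add_neg]

/-- Cancelling the factorials allows identities between wedge products to be read off from the sum
over all permutations. -/
theorem wedge_ext_smul {k l : ℕ} {x y : T [⋀^Fin (k + l)]→L[ℝ] U}
    (h : ∀ v, (k.factorial * l.factorial) • x v = (k.factorial * l.factorial) • y v) : x = y := by
  ext v
  have h0 : ((k.factorial * l.factorial : ℕ) : ℝ) ≠ 0 := by positivity
  have h1 := h v
  rw [← Nat.cast_smul_eq_nsmul ℝ, ← Nat.cast_smul_eq_nsmul ℝ] at h1
  exact smul_right_injective _ h0 h1

theorem wedge_add_left {k l : ℕ} (b : V →ₗ[ℝ] W →ₗ[ℝ] U) (α α' : T [⋀^Fin k]→L[ℝ] V)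
    (β : T [⋀^Fin l]→L[ℝ] W) : wedge b (α + α') β = wedge b α β + wedge b α' β := by
  refine wedge_ext_smul fun v => ?_
  rw [ContinuousAlternatingMap.add_apply, smul_add]
  simp only [smul_wedge_apply, ← Finset.sum_add_distrib]
  refine Finset.sum_congr rfl fun σ _ => ?_
  rw [← smul_add, ContinuousAlternatingMap.add_apply, map_add, LinearMap.add_apply]

theorem wedge_add_right {k l : ℕ} (b : V →ₗ[ℝ] W →ₗ[ℝ] U) (α : T [⋀^Fin k]→L[ℝ] V)
    (β β' : T [⋀^Fin l]→L[ℝ] W) : wedge b α (β + β') = wedge b α β + wedge b α β' := by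
  refine wedge_ext_smul fun v => ?_
  rw [ContinuousAlternatingMap.add_apply, smul_add]
  simp only [smul_wedge_apply, ← Finset.sum_add_distrib]
  refine Finset.sum_congr rfl fun σ _ => ?_
  rw [← smul_add, ContinuousAlternatingMap.add_apply, map_add]

theorem wedge_smul_left {k l : ℕ} (b : V →ₗ[ℝ] W →ₗ[ℝ] U) (c : ℝ) (α : T [⋀^Fin k]→L[ℝ] V)
    (β : T [⋀^Fin l]→L[ℝ] W) : wedge b (c • α) β = c • wedge b α β := by
  refine wedge_ext_smul fun v => ?_
  rw [ContinuousAlternatingMap.smul_apply, smul_comm]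
  simp only [smul_wedge_apply, Finset.smul_sum]
  refine Finset.sum_congr rfl fun σ _ => ?_
  rw [smul_comm, ContinuousAlternatingMap.smul_apply, map_smul, LinearMap.smul_apply]

theorem wedge_smul_right {k l : ℕ} (b : V →ₗ[ℝ] W →ₗ[ℝ] U) (c : ℝ) (α : T [⋀^Fin k]→L[ℝ] V)
    (β : T [⋀^Fin l]→L[ℝ] W) : wedge b α (c • β) = c • wedge b α β := by
  refine wedge_ext_smul fun v => ?_
  rw [ContinuousAlternatingMap.smul_apply, smul_comm]
  simp only [smul_wedge_apply, Finset.smul_sum]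
  refine Finset.sum_congr rfl fun σ _ => ?_
  rw [smul_comm, ContinuousAlternatingMap.smul_apply, map_smul]

/-- The wedge product as a continuous bilinear map. -/
def wedgeCLM (k l : ℕ) (b : V →ₗ[ℝ] W →ₗ[ℝ] U) :
    (T [⋀^Fin k]→L[ℝ] V) →L[ℝ] (T [⋀^Fin l]→L[ℝ] W) →L[ℝ] (T [⋀^Fin (k + l)]→L[ℝ] U) :=
  LinearMap.toContinuousBilinearMap (LinearMap.mk₂ ℝ (wedge b) (wedge_add_left b)
    (wedge_smul_left b) (wedge_add_right b) (wedge_smul_right b))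

theorem wedgeCLM_apply {k l : ℕ} (b : V →ₗ[ℝ] W →ₗ[ℝ] U) (α : T [⋀^Fin k]→L[ℝ] V)
    (β : T [⋀^Fin l]→L[ℝ] W) : wedgeCLM k l b α β = wedge b α β := rfl

theorem contDiffOn_wedge {E' : Type*} [NormedAddCommGroup E'] [NormedSpace ℝ E'] {k l : ℕ}
    (b : V →ₗ[ℝ] W →ₗ[ℝ] U) {n : WithTop ℕ∞} {s : Set E'}
    {α : E' → T [⋀^Fin k]→L[ℝ] V} {β : E' → T [⋀^Fin l]→L[ℝ] W} (hα : ContDiffOn ℝ n α s)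
    (hβ : ContDiffOn ℝ n β s) : ContDiffOn ℝ n (fun y => wedge b (α y) (β y)) s := by
  have h : ContDiff ℝ n fun p : (T [⋀^Fin k]→L[ℝ] V) × (T [⋀^Fin l]→L[ℝ] W) =>
      wedge b p.1 p.2 := (wedgeCLM (T := T) k l b).isBoundedBilinearMap.contDiff
  exact ContDiff.comp_contDiffOn (g := fun p : (T [⋀^Fin k]→L[ℝ] V) × (T [⋀^Fin l]→L[ℝ] W) =>
    wedge b p.1 p.2) (f := fun y => (α y, β y)) h (hα.prodMk hβ)

theorem fderiv_wedge {k l : ℕ} (b : V →ₗ[ℝ] W →ₗ[ℝ] U)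
    {α : T → T [⋀^Fin k]→L[ℝ] V} {β : T → T [⋀^Fin l]→L[ℝ] W} {y : T}
    (hα : DifferentiableAt ℝ α y) (hβ : DifferentiableAt ℝ β y) (X : T) :
    fderiv ℝ (fun z => wedge b (α z) (β z)) y X =
      wedge b (α y) (fderiv ℝ β y X) + wedge b (fderiv ℝ α y X) (β y) := by
  have h := (wedgeCLM k l b).fderiv_of_bilinear hα hβ
  simp only [wedgeCLM_apply] at h
  rw [h]
  rfl

theorem differentiableAt_wedge {k l : ℕ} (b : V →ₗ[ℝ] W →ₗ[ℝ] U)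
    {α : T → T [⋀^Fin k]→L[ℝ] V} {β : T → T [⋀^Fin l]→L[ℝ] W} {y : T}
    (hα : DifferentiableAt ℝ α y) (hβ : DifferentiableAt ℝ β y) :
    DifferentiableAt ℝ (fun z => wedge b (α z) (β z)) y := by
  have h := (wedgeCLM (T := T) k l b).isBoundedBilinearMap.differentiableAt (α y, β y)
  exact h.comp (f := fun z => (α z, β z)) y (hα.prodMk hβ)

/-- The Leibniz rule `d (α ∧ β) = dα ∧ β - α ∧ dβ` for 1-forms. -/
theorem extDeriv_wedge_one_one (b : V →ₗ[ℝ] W →ₗ[ℝ] U)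
    {α : T → T [⋀^Fin 1]→L[ℝ] V} {β : T → T [⋀^Fin 1]→L[ℝ] W} {y : T}
    (hα : DifferentiableAt ℝ α y) (hβ : DifferentiableAt ℝ β y) (X Y Z : T) :
    extDeriv (fun z => wedge b (α z) (β z)) y ![X, Y, Z] =
      (b (extDeriv α y ![X, Y]) (β y ![Z]) - b (extDeriv α y ![X, Z]) (β y ![Y])
        + b (extDeriv α y ![Y, Z]) (β y ![X])) -
      (b (α y ![X]) (extDeriv β y ![Y, Z]) - b (α y ![Y]) (extDeriv β y ![X, Z])
        + b (α y ![Z]) (extDeriv β y ![X, Y])) := by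
  rw [extDeriv_two (differentiableAt_wedge b hα hβ)]
  simp only [fderiv_wedge b hα hβ, extDeriv_one hα, extDeriv_one hβ,
    ContinuousAlternatingMap.add_apply]
  rw [wedge_one_one, wedge_one_one, wedge_one_one, wedge_one_one, wedge_one_one, wedge_one_one]
  simp only [map_sub, LinearMap.sub_apply]
  abel

/-- The Leibniz rule `d (η ∧ β) = dη ∧ β + η ∧ dβ` for a 2-form `η` and a 1-form `β`. -/
theorem extDeriv_wedge_two_one (b : V →ₗ[ℝ] W →ₗ[ℝ] U)
    {η : T → T [⋀^Fin 2]→L[ℝ] V} {β : T → T [⋀^Fin 1]→L[ℝ] W} {y : T}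
    (hη : DifferentiableAt ℝ η y) (hβ : DifferentiableAt ℝ β y) (X Y Z Q : T) :
    extDeriv (fun z => wedge b (η z) (β z)) y ![X, Y, Z, Q] =
      (b (extDeriv η y ![X, Y, Z]) (β y ![Q]) - b (extDeriv η y ![X, Y, Q]) (β y ![Z])
        + b (extDeriv η y ![X, Z, Q]) (β y ![Y]) - b (extDeriv η y ![Y, Z, Q]) (β y ![X])) +
      (b (η y ![X, Y]) (extDeriv β y ![Z, Q]) - b (η y ![X, Z]) (extDeriv β y ![Y, Q])
        + b (η y ![X, Q]) (extDeriv β y ![Y, Z]) + b (η y ![Y, Z]) (extDeriv β y ![X, Q])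
        - b (η y ![Y, Q]) (extDeriv β y ![X, Z]) + b (η y ![Z, Q]) (extDeriv β y ![X, Y])) := by
  rw [extDeriv_three (differentiableAt_wedge b hη hβ)]
  simp only [fderiv_wedge b hη hβ, extDeriv_one hβ, extDeriv_two hη,
    ContinuousAlternatingMap.add_apply]
  rw [wedge_two_one, wedge_two_one, wedge_two_one, wedge_two_one, wedge_two_one, wedge_two_one,
    wedge_two_one, wedge_two_one]
  simp only [map_sub, map_add, LinearMap.sub_apply, LinearMap.add_apply]
  abel

end ExtDerivWedge

/-! ### Derivatives as maps of model spaces, and derivatives of charts -/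

section Derivative

variable {E H M E' H' M' E'' H'' M'' : Type*}
  [NormedAddCommGroup E] [NormedSpace ℝ E] [TopologicalSpace H]
  (I : ModelWithCorners ℝ E H) [TopologicalSpace M] [ChartedSpace H M]
  [NormedAddCommGroup E'] [NormedSpace ℝ E'] [TopologicalSpace H']
  (I' : ModelWithCorners ℝ E' H') [TopologicalSpace M'] [ChartedSpace H' M']
  [NormedAddCommGroup E''] [NormedSpace ℝ E''] [TopologicalSpace H'']
  (I'' : ModelWithCorners ℝ E'' H'') [TopologicalSpace M''] [ChartedSpace H'' M'']

/-- The derivative of a map between manifolds, as a map between the model spaces. -/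
def mder (f : M → M') (x : M) : E →L[ℝ] E' := mfderiv I I' f x

variable {I I' I''}

theorem mder_comp {g : M' → M''} {f : M → M'} {x : M} (hg : MDifferentiableAt I' I'' g (f x))
    (hf : MDifferentiableAt I I' f x) :
    mder I I'' (g ∘ f) x = (mder I' I'' g (f x)).comp (mder I I' f x) :=
  mfderiv_comp x hg hf

theorem mder_comp_apply {g : M' → M''} {f : M → M'} {x : M}
    (hg : MDifferentiableAt I' I'' g (f x)) (hf : MDifferentiableAt I I' f x) (X : E) :
    mder I I'' (fun y => g (f y)) x X = mder I' I'' g (f x) (mder I I' f x X) :=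
  congrArg (fun L => L X) (mder_comp hg hf)

theorem mder_congr {f g : M → M'} {x : M} (h : f =ᶠ[nhds x] g) : mder I I' f x = mder I I' g x :=
  h.mfderiv_eq

theorem mder_eq_fderiv {f : E → E'} {x : E} : mder 𝓘(ℝ, E) 𝓘(ℝ, E') f x = fderiv ℝ f x :=
  mfderiv_eq_fderiv

theorem mder_id (x : M) : mder I I (fun y : M => y) x = ContinuousLinearMap.id ℝ E :=
  mfderiv_id

theorem mder_const (c : M') (x : M) : mder I I' (fun _ : M => c) x = 0 :=
  mfderiv_const

variable [I.Boundaryless]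

theorem mder_extChartAt_self [IsManifold I ∞ M] (x : M) :
    mder I 𝓘(ℝ, E) (extChartAt I x) x = ContinuousLinearMap.id ℝ E :=
  have : IsManifold I 1 M := IsManifold.of_le (n := ∞) (by simp)
  mfderiv_extChartAt_self

theorem mder_extChartAt_symm_self [IsManifold I ∞ M] (x : M) :
    mder 𝓘(ℝ, E) I (extChartAt I x).symm (extChartAt I x x) = ContinuousLinearMap.id ℝ E := by
  have : IsManifold I 1 M := IsManifold.of_le (n := ∞) (by simp)
  have h := mfderivWithin_range_extChartAt_symm (I := I) (x := x)
  rw [I.range_eq_univ, mfderivWithin_univ] at h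
  exact h

theorem mdifferentiableAt_extChartAt_symm [IsManifold I ∞ M] {x : M} {y : E}
    (hy : y ∈ (extChartAt I x).target) :
    MDifferentiableAt 𝓘(ℝ, E) I (extChartAt I x).symm y := by
  have : IsManifold I 1 M := IsManifold.of_le (n := ∞) (by simp)
  have h := mdifferentiableWithinAt_extChartAt_symm (I := I) hy
  rwa [I.range_eq_univ, mdifferentiableWithinAt_univ] at h

theorem mdifferentiableAt_extChartAt_of_mem [IsManifold I ∞ M] {x y : M}
    (hy : y ∈ (extChartAt I x).source) :
    MDifferentiableAt I 𝓘(ℝ, E) (extChartAt I x) y := by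
  have : IsManifold I 1 M := IsManifold.of_le (n := ∞) (by simp)
  exact mdifferentiableAt_extChartAt (by rwa [extChartAt_source] at hy)

theorem mder_symm_mder_chart [IsManifold I ∞ M] {x y : M} (hy : y ∈ (extChartAt I x).source)
    (X : E) :
    mder 𝓘(ℝ, E) I (extChartAt I x).symm (extChartAt I x y)
      (mder I 𝓘(ℝ, E) (extChartAt I x) y X) = X := by
  rw [← mder_comp_apply (mdifferentiableAt_extChartAt_symm ((extChartAt I x).map_source hy))
    (mdifferentiableAt_extChartAt_of_mem hy)]
  have h : (fun z => (extChartAt I x).symm (extChartAt I x z)) =ᶠ[nhds y] fun z => z :=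
    Filter.eventuallyEq_of_mem ((isOpen_extChartAt_source x).mem_nhds hy)
      fun z hz => (extChartAt I x).left_inv hz
  rw [mder_congr h, mder_id]
  rfl

theorem mder_chart_mder_symm [IsManifold I ∞ M] {x : M} {y : E}
    (hy : y ∈ (extChartAt I x).target) (X : E) :
    mder I 𝓘(ℝ, E) (extChartAt I x) ((extChartAt I x).symm y)
      (mder 𝓘(ℝ, E) I (extChartAt I x).symm y X) = X := by
  rw [← mder_comp_apply
    (mdifferentiableAt_extChartAt_of_mem ((extChartAt I x).map_target hy))
    (mdifferentiableAt_extChartAt_symm hy)]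
  have h : (fun z => (extChartAt I x) ((extChartAt I x).symm z)) =ᶠ[nhds y] fun z => z :=
    Filter.eventuallyEq_of_mem ((isOpen_extChartAt_target x).mem_nhds hy)
      fun z hz => (extChartAt I x).right_inv hz
  rw [mder_congr h, mder_id]
  rfl

theorem contMDiffAt_extChartAt_symm [IsManifold I ∞ M] {x : M} {y : E}
    (hy : y ∈ (extChartAt I x).target) : ContMDiffAt 𝓘(ℝ, E) I ∞ (extChartAt I x).symm y :=
  (contMDiffOn_extChartAt_symm x).contMDiffAt ((isOpen_extChartAt_target x).mem_nhds hy)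

theorem contDiffOn_comp_chart_symm [IsManifold I ∞ M] {f : M → E'}
    (hf : ContMDiff I 𝓘(ℝ, E') ∞ f) (x : M) :
    ContDiffOn ℝ ∞ (fun y => f ((extChartAt I x).symm y)) (extChartAt I x).target :=
  contMDiffOn_iff_contDiffOn.mp (hf.comp_contMDiffOn (contMDiffOn_extChartAt_symm x))

theorem mder_eq_fderiv_chart [IsManifold I ∞ M] {f : M → E'} {x : M}
    (hf : MDifferentiableAt I 𝓘(ℝ, E') f x) (X : E) :
    mder I 𝓘(ℝ, E') f x X =
      fderiv ℝ (fun y => f ((extChartAt I x).symm y)) (extChartAt I x x) X := by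
  rw [← mder_eq_fderiv, mder_comp_apply (I' := I) (g := f)
    (by rwa [extChartAt_to_inv]) (mdifferentiableAt_extChartAt_symm (mem_extChartAt_target x)),
    mder_extChartAt_symm_self, extChartAt_to_inv]
  rfl

end Derivative

/-! ### Forms in charts and naturality of the exterior derivative -/

section FlatPullback

variable {E H M E' E'' V : Type*}
  [NormedAddCommGroup E] [NormedSpace ℝ E] [FiniteDimensional ℝ E] [TopologicalSpace H]
  {I : ModelWithCorners ℝ E H} [TopologicalSpace M] [ChartedSpace H M]
  [NormedAddCommGroup E'] [NormedSpace ℝ E'] [FiniteDimensional ℝ E']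
  [NormedAddCommGroup E''] [NormedSpace ℝ E'']
  [NormedAddCommGroup V] [NormedSpace ℝ V] [FiniteDimensional ℝ V]

/-- Evaluation of smooth families of forms on smooth families of vectors is smooth. -/
theorem contDiffOn_form_apply {k : ℕ} {n : WithTop ℕ∞} {s : Set E''}
    {α : E'' → E [⋀^Fin k]→L[ℝ] V} {v : Fin k → E'' → E} (hα : ContDiffOn ℝ n α s)
    (hv : ∀ i, ContDiffOn ℝ n (v i) s) : ContDiffOn ℝ n (fun y => α y fun i => v i y) s := by
  let b := Module.finBasis ℝ E
  -- Multilinear expansion in a basis reduces the claim to products of coordinate functions and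
  -- evaluations on constant vectors.
  have h : (fun y => α y fun i => v i y) = fun y => ∑ j : Fin k → Fin (Module.finrank ℝ E),
      (∏ i, b.coord (j i) (v i y)) • α y fun i => b (j i) := by
    funext y
    conv_lhs => rw [show (fun i => v i y) = fun i => ∑ j, b.repr (v i y) j • b j from
      funext fun i => (b.sum_repr (v i y)).symm]
    have h1 := MultilinearMap.map_sum (α y).toMultilinearMap fun i j => b.repr (v i y) j • b j
    refine h1.trans (Finset.sum_congr rfl fun j _ => ?_)
    exact MultilinearMap.map_smul_univ (α y).toMultilinearMap (fun i => b.repr (v i y) (j i))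
      fun i => b (j i)
  rw [h]
  refine ContDiffOn.sum fun j _ => ContDiffOn.smul (contDiffOn_prod fun i _ => ?_) ?_
  · exact (LinearMap.toContinuousLinearMap (b.coord (j i))).contDiff.comp_contDiffOn (hv i)
  · exact contDiffOn_form_iff.mp hα _

/-- The pull-back of a form on a manifold by a map from a vector space. -/
def flatPullback (I : ModelWithCorners ℝ E H) {k : ℕ} (g : E'' → M) (η : M → E [⋀^Fin k]→L[ℝ] V)
    (y : E'') : E'' [⋀^Fin k]→L[ℝ] V :=
  (η (g y)).compContinuousLinearMap (mder 𝓘(ℝ, E'') I g y)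

/-- The expression of a form in a chart. -/
def chartForm (I : ModelWithCorners ℝ E H) {k : ℕ} (η : M → E [⋀^Fin k]→L[ℝ] V) (x : M) :
    E → E [⋀^Fin k]→L[ℝ] V :=
  flatPullback I (extChartAt I x).symm η

/-- Smoothness of forms, for forms regarded as functions with values in forms on the model space. -/
def SmoothForm (I : ModelWithCorners ℝ E H) {k : ℕ} (η : M → E [⋀^Fin k]→L[ℝ] V) : Prop :=
  ∀ x : M, ContDiffOn ℝ ∞ (chartForm I η x) (extChartAt I x).target

/-- The exterior derivative, for forms regarded as functions with values in forms on the model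
space. -/
def extD (I : ModelWithCorners ℝ E H) {k : ℕ} (η : M → E [⋀^Fin k]→L[ℝ] V) (x : M) :
    E [⋀^Fin (k + 1)]→L[ℝ] V :=
  extDeriv (chartForm I η x) (extChartAt I x x)

variable [I.Boundaryless] [IsManifold I ∞ M]

/-- Inserting the identity as inverse chart after chart turns a pull-back from a manifold into one
between vector spaces, to which the flat naturality of `extDeriv` applies. -/
theorem flatPullback_eq_chartForm {k : ℕ} {g : E'' → M} {η : M → E [⋀^Fin k]→L[ℝ] V} {y : E''}
    {x : M} (hg : MDifferentiableAt 𝓘(ℝ, E'') I g y) (hx : g y ∈ (extChartAt I x).source) :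
    flatPullback I g η y =
      ContinuousAlternatingMap.compContinuousLinearMap (chartForm I η x (extChartAt I x (g y)))
        (fderiv ℝ (fun z => extChartAt I x (g z)) y) := by
  ext v
  have h1 : (extChartAt I x).symm (extChartAt I x (g y)) = g y := (extChartAt I x).left_inv hx
  change η (g y) (fun i => mder 𝓘(ℝ, E'') I g y (v i)) =
    η ((extChartAt I x).symm (extChartAt I x (g y)))
      (fun i => mder 𝓘(ℝ, E) I (extChartAt I x).symm (extChartAt I x (g y))
        (fderiv ℝ (fun z => extChartAt I x (g z)) y (v i)))
  rw [h1]
  congr 1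
  funext i
  rw [← mder_eq_fderiv, mder_comp_apply (mdifferentiableAt_extChartAt_of_mem hx) hg,
    mder_symm_mder_chart hx]

theorem contDiffAt_chart_comp {g : E'' → M} {y : E''} {x : M}
    (hg : ContMDiffAt 𝓘(ℝ, E'') I ∞ g y) (hx : g y ∈ (extChartAt I x).source) :
    ContDiffAt ℝ ∞ (fun z => extChartAt I x (g z)) y :=
  contMDiffAt_iff_contDiffAt.mp
    (ContMDiffAt.comp (I' := I) y (contMDiffAt_extChartAt' (by rwa [extChartAt_source] at hx)) hg)

theorem flatPullback_eventuallyEq {k : ℕ} {g : E'' → M} {η : M → E [⋀^Fin k]→L[ℝ] V} {y : E''}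
    {x : M} (hg : ContMDiffAt 𝓘(ℝ, E'') I ∞ g y) (hx : g y ∈ (extChartAt I x).source) :
    flatPullback I g η =ᶠ[nhds y] fun z =>
      ContinuousAlternatingMap.compContinuousLinearMap (chartForm I η x (extChartAt I x (g z)))
        (fderiv ℝ (fun w => extChartAt I x (g w)) z) := by
  have h1 : ∀ᶠ z in nhds y, g z ∈ (extChartAt I x).source :=
    hg.continuousAt.eventually_mem ((isOpen_extChartAt_source x).mem_nhds hx)
  have h2 : ∀ᶠ z in nhds y, ContMDiffAt 𝓘(ℝ, E'') I 1 g z :=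
    (contMDiffAt_iff_contMDiffAt_nhds (by simp)).mp (hg.of_le (mod_cast le_top))
  filter_upwards [h1, h2] with z hz1 hz2
  exact flatPullback_eq_chartForm (hz2.mdifferentiableAt one_ne_zero) hz1

theorem differentiableAt_chartForm {k : ℕ} {η : M → E [⋀^Fin k]→L[ℝ] V} (hη : SmoothForm I η)
    {x : M} {y : E} (hy : y ∈ (extChartAt I x).target) :
    DifferentiableAt ℝ (chartForm I η x : E → E [⋀^Fin k]→L[ℝ] V) y :=
  ((hη x).contDiffAt ((isOpen_extChartAt_target x).mem_nhds hy)).differentiableAt (by simp)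

theorem dForm_eq_extD {k : ℕ} (η : M → E [⋀^Fin k]→L[ℝ] V) (x : M) :
    dForm I η x = extD I η x := by
  ext v
  change extDeriv (chartForm I η x) (extChartAt I x x)
    (fun i => mder I 𝓘(ℝ, E) (extChartAt I x) x (v i)) = _
  rw [mder_extChartAt_self]
  rfl

/-- Near `y` the pull-back factors through the chart centred at `g y`, which is the chart used to
define `extD` at that point. The flat naturality statement then finishes, the derivative of the
chart at its centre being the identity. -/
theorem extDeriv_flatPullback {k : ℕ} {η : M → E [⋀^Fin k]→L[ℝ] V}
    (hη : SmoothForm I η) {y : E''} {g : E'' → M} (hg : ContMDiffAt 𝓘(ℝ, E'') I ∞ g y) :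
    extDeriv (flatPullback I g η) y = flatPullback I g (extD I η) y := by
  have hx := mem_extChartAt_source (I := I) (g y)
  rw [(flatPullback_eventuallyEq hg hx).extDeriv_eq,
    extDeriv_pullback (r := ∞) (f := fun z => extChartAt I (g y) (g z))
      (differentiableAt_chartForm hη (mem_extChartAt_target _)) (contDiffAt_chart_comp hg hx)
      (by rw [minSmoothness_of_isRCLikeNormedField]; exact ENat.LEInfty.out)]
  rw [flatPullback_eq_chartForm (hg.mdifferentiableAt (by simp)) hx]
  ext v
  change extDeriv (chartForm I η (g y)) _ _ = extD I η ((extChartAt I (g y)).symm _)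
    (fun i => mder 𝓘(ℝ, E) I (extChartAt I (g y)).symm _ _)
  rw [mder_extChartAt_symm_self, extChartAt_to_inv]
  rfl

theorem contDiffOn_flatPullback {k : ℕ} {η : M → E [⋀^Fin k]→L[ℝ] V}
    (hη : SmoothForm I η) {g : E' → M} {s : Set E'} (hs : IsOpen s)
    (hg : ContMDiffOn 𝓘(ℝ, E') I ∞ g s) : ContDiffOn ℝ ∞ (flatPullback I g η) s := by
  intro y hy
  have hgy : ContMDiffAt 𝓘(ℝ, E') I ∞ g y := hg.contMDiffAt (hs.mem_nhds hy)
  have hx := mem_extChartAt_source (I := I) (g y)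
  refine ContDiffAt.contDiffWithinAt (ContDiffAt.congr_of_eventuallyEq ?_
    (flatPullback_eventuallyEq (x := g y) hgy hx))
  set f : E' → E := fun z => extChartAt I (g y) (g z)
  have hs' : IsOpen (s ∩ g ⁻¹' (extChartAt I (g y)).source) :=
    hg.continuousOn.isOpen_inter_preimage hs (isOpen_extChartAt_source _)
  set t := s ∩ g ⁻¹' (extChartAt I (g y)).source
  have hf : ContDiffOn ℝ ∞ f t := fun z hz => (contDiffAt_chart_comp
    (hg.contMDiffAt (hs.mem_nhds hz.1)) hz.2).contDiffWithinAt
  suffices h : ContDiffOn ℝ ∞ (fun z => ContinuousAlternatingMap.compContinuousLinearMap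
      (chartForm I η (g y) (f z)) (fderiv ℝ f z)) t from
    h.contDiffAt (hs'.mem_nhds ⟨hy, hx⟩)
  refine contDiffOn_form_iff.mpr fun v => ?_
  refine contDiffOn_form_apply (α := fun z => chartForm I η (g y) (f z))
    (v := fun i z => fderiv ℝ f z (v i)) ?_ fun i => ?_
  · exact (hη (g y)).comp hf fun z hz => (extChartAt I (g y)).map_source hz.2
  · exact (hf.fderiv_of_isOpen hs' (by simp)).clm_apply contDiffOn_const

/-- Independence of the chart: this is naturality for the inverse chart at `x`, at points where
`extD` is defined by a different chart. Smoothness of `extD I η` and `d² = 0` come from it. -/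
theorem chartForm_extD {k : ℕ} {η : M → E [⋀^Fin k]→L[ℝ] V} (hη : SmoothForm I η) {x : M} {y : E}
    (hy : y ∈ (extChartAt I x).target) :
    chartForm I (extD I η) x y = extDeriv (chartForm I η x) y :=
  (extDeriv_flatPullback hη (contMDiffAt_extChartAt_symm hy)).symm

theorem SmoothForm.extD {k : ℕ} {η : M → E [⋀^Fin k]→L[ℝ] V} (hη : SmoothForm I η) :
    SmoothForm I (extD I η) := by
  intro x
  have h : ContDiffOn ℝ ∞ (fderiv ℝ (chartForm I η x)) (extChartAt I x).target :=
    (hη x).fderiv_of_isOpen (isOpen_extChartAt_target x) (by simp)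
  refine ContDiffOn.congr ?_ fun y hy => chartForm_extD hη hy
  exact (ContinuousAlternatingMap.alternatizeUncurryFinCLM ℝ E V).contDiff.comp_contDiffOn h

theorem extD_extD {k : ℕ} {η : M → E [⋀^Fin k]→L[ℝ] V} (hη : SmoothForm I η) (x : M) :
    extD I (extD I η) x = 0 := by
  have h : chartForm I (DiracManin.extD I η) x =ᶠ[nhds (extChartAt I x x)]
      extDeriv (chartForm I η x) :=
    Filter.eventuallyEq_of_mem (extChartAt_target_mem_nhds x) fun y hy => chartForm_extD hη hy
  refine h.extDeriv_eq.trans ?_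
  refine extDeriv_extDeriv_apply (r := ∞) ((hη x).contDiffAt (extChartAt_target_mem_nhds x)) ?_
  rw [minSmoothness_of_isRCLikeNormedField]
  exact ENat.LEInfty.out

end FlatPullback

/-! ### Cartan formulas and related vector fields on a vector space -/

section FlatCartan

variable {E V : Type*} [NormedAddCommGroup E] [NormedSpace ℝ E]
  [NormedAddCommGroup V] [NormedSpace ℝ V]

open VectorField

theorem extDeriv_one_vectorField {α : E → E [⋀^Fin 1]→L[ℝ] V} {X Y : E → E} {y : E}
    (hα : DifferentiableAt ℝ α y) (hX : DifferentiableAt ℝ X y) (hY : DifferentiableAt ℝ Y y) :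
    extDeriv α y ![X y, Y y] = fderiv ℝ (fun z => α z ![Y z]) y (X y) -
      fderiv ℝ (fun z => α z ![X z]) y (Y y) - α y ![lieBracket ℝ X Y y] := by
  have h := extDeriv_apply_vectorField (V := ![X, Y]) hα
    (fun i => by fin_cases i; exacts [hX, hY])
  have e : (fun i => (![X, Y] : Fin 2 → E → E) i y) = ![X y, Y y] := by
    ext i; fin_cases i <;> rfl
  have h0 (z : E) : Fin.removeNth (0 : Fin 2) (fun i => (![X, Y] : Fin 2 → E → E) i z) =
      ![Y z] := by
    ext i; fin_cases i; rfl
  have h1 (z : E) : Fin.removeNth (1 : Fin 2) (fun i => (![X, Y] : Fin 2 → E → E) i z) =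
      ![X z] := by
    ext i; fin_cases i; rfl
  have hs : Finset.Ici (0 : Fin 1) = {0} := by decide
  rw [e] at h
  rw [h, Fin.sum_univ_two, Fin.sum_univ_one, hs, Finset.sum_singleton]
  simp only [h0, h1]
  have e2 (w : E) (v : Fin 0 → E) : Matrix.vecCons w v = ![w] := by
    ext i; fin_cases i; rfl
  rw [e2]
  simp [sub_eq_add_neg]

theorem extDeriv_two_vectorField {η : E → E [⋀^Fin 2]→L[ℝ] V} {X Y Z : E → E} {y : E}
    (hη : DifferentiableAt ℝ η y) (hX : DifferentiableAt ℝ X y) (hY : DifferentiableAt ℝ Y y)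
    (hZ : DifferentiableAt ℝ Z y) :
    extDeriv η y ![X y, Y y, Z y] = fderiv ℝ (fun z => η z ![Y z, Z z]) y (X y) -
      fderiv ℝ (fun z => η z ![X z, Z z]) y (Y y) + fderiv ℝ (fun z => η z ![X z, Y z]) y (Z y)
      - η y ![lieBracket ℝ X Y y, Z y] + η y ![lieBracket ℝ X Z y, Y y]
      - η y ![lieBracket ℝ Y Z y, X y] := by
  have h := extDeriv_apply_vectorField (V := ![X, Y, Z]) hη
    (fun i => by fin_cases i; exacts [hX, hY, hZ])
  have e : (fun i => (![X, Y, Z] : Fin 3 → E → E) i y) = ![X y, Y y, Z y] := by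
    ext i; fin_cases i <;> rfl
  have h0 (z : E) : Fin.removeNth (0 : Fin 3) (fun i => (![X, Y, Z] : Fin 3 → E → E) i z) =
      ![Y z, Z z] := by ext i; fin_cases i <;> rfl
  have h1 (z : E) : Fin.removeNth (1 : Fin 3) (fun i => (![X, Y, Z] : Fin 3 → E → E) i z) =
      ![X z, Z z] := by ext i; fin_cases i <;> rfl
  have h2 (z : E) : Fin.removeNth (2 : Fin 3) (fun i => (![X, Y, Z] : Fin 3 → E → E) i z) =
      ![X z, Y z] := by ext i; fin_cases i <;> rfl
  have hs0 : Finset.Ici (0 : Fin 2) = {0, 1} := by decide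
  have hs1 : Finset.Ici (1 : Fin 2) = {1} := by decide
  rw [e] at h
  rw [h, Fin.sum_univ_three, Fin.sum_univ_two, hs0, hs1, Finset.sum_pair (by decide),
    Finset.sum_singleton]
  simp only [h0, h1, h2]
  have k0 (w : E) : Matrix.vecCons w (Fin.removeNth (0 : Fin 2)
      ((Fin.castSucc (0 : Fin 2)).removeNth ![X y, Y y, Z y])) = ![w, Z y] := by
    ext i; fin_cases i <;> rfl
  have k1 (w : E) : Matrix.vecCons w (Fin.removeNth (1 : Fin 2)
      ((Fin.castSucc (0 : Fin 2)).removeNth ![X y, Y y, Z y])) = ![w, Y y] := by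
    ext i; fin_cases i <;> rfl
  have k2 (w : E) : Matrix.vecCons w (Fin.removeNth (1 : Fin 2)
      ((Fin.castSucc (1 : Fin 2)).removeNth ![X y, Y y, Z y])) = ![w, X y] := by
    ext i; fin_cases i <;> rfl
  rw [k0, k1, k2]
  simp [sub_eq_add_neg]
  abel

/-- The Lie bracket of vector fields that are related by a map. -/
theorem lieBracket_related {E' : Type*} [NormedAddCommGroup E'] [NormedSpace ℝ E'] {f : E → E'}
    {X Y : E → E} {X' Y' : E' → E'} {y : E} (hf : ContDiffAt ℝ ∞ f y)
    (hX : DifferentiableAt ℝ X y) (hY : DifferentiableAt ℝ Y y)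
    (hX' : DifferentiableAt ℝ X' (f y)) (hY' : DifferentiableAt ℝ Y' (f y))
    (hXX' : ∀ᶠ z in nhds y, fderiv ℝ f z (X z) = X' (f z))
    (hYY' : ∀ᶠ z in nhds y, fderiv ℝ f z (Y z) = Y' (f z)) :
    fderiv ℝ f y (lieBracket ℝ X Y y) = lieBracket ℝ X' Y' (f y) := by
  have hf1 : DifferentiableAt ℝ f y := hf.differentiableAt (by simp)
  have hf2 : DifferentiableAt ℝ (fderiv ℝ f) y :=
    (hf.fderiv_right (m := ∞) (by simp)).differentiableAt (by simp)
  have hsymm : IsSymmSndFDerivAt ℝ f y := hf.isSymmSndFDerivAt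
    (by rw [minSmoothness_of_isRCLikeNormedField]; exact ENat.LEInfty.out)
  -- Differentiating the relation `df (Z) = Z' ∘ f` produces a second derivative of `f`, which
  -- cancels in the bracket by symmetry.
  have key : ∀ {Z : E → E} {Z' : E' → E'} (W : E), DifferentiableAt ℝ Z y →
      DifferentiableAt ℝ Z' (f y) → (∀ᶠ z in nhds y, fderiv ℝ f z (Z z) = Z' (f z)) →
      fderiv ℝ f y (fderiv ℝ Z y W) = fderiv ℝ Z' (f y) (fderiv ℝ f y W) -
        fderiv ℝ (fderiv ℝ f) y W (Z y) := by
    intro Z Z' W hZ hZ' h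
    have h1 : fderiv ℝ (fun z => fderiv ℝ f z (Z z)) y W =
        fderiv ℝ (fun z => Z' (f z)) y W := by rw [Filter.EventuallyEq.fderiv_eq h]
    rw [fderiv_clm_apply hf2 hZ] at h1
    have h2 : fderiv ℝ (fun z => Z' (f z)) y W = fderiv ℝ Z' (f y) (fderiv ℝ f y W) :=
      congrArg (fun L => L W) (fderiv_comp y hZ' hf1)
    rw [h2] at h1
    rw [← h1]
    simp
  rw [lieBracket_eq, lieBracket_eq]
  simp only [map_sub]
  rw [key _ hY hY' hYY', key _ hX hX' hXX', hsymm.eq (X y) (Y y), hXX'.self_of_nhds,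
    hYY'.self_of_nhds]
  abel

end FlatCartan

/-! ### Vector fields and Lie brackets in charts -/

section Fields

variable {E H M E' H' M' V : Type*}
  [NormedAddCommGroup E] [NormedSpace ℝ E] [FiniteDimensional ℝ E] [TopologicalSpace H]
  {I : ModelWithCorners ℝ E H} [I.Boundaryless] [TopologicalSpace M] [ChartedSpace H M]
  [IsManifold I ∞ M]
  [NormedAddCommGroup E'] [NormedSpace ℝ E'] [FiniteDimensional ℝ E'] [TopologicalSpace H']
  {I' : ModelWithCorners ℝ E' H'} [I'.Boundaryless] [TopologicalSpace M'] [ChartedSpace H' M']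
  [IsManifold I' ∞ M']
  [NormedAddCommGroup V] [NormedSpace ℝ V] [FiniteDimensional ℝ V]

/-- Smoothness of vector fields, for fields regarded as functions with values in the model space. -/
def SmoothField (I : ModelWithCorners ℝ E H) [IsManifold I ∞ M] (X : M → E) : Prop :=
  IsSmoothField I X

/-- The Lie bracket of vector fields regarded as functions with values in the model space. -/
def lieB (I : ModelWithCorners ℝ E H) (X Y : M → E) (x : M) : E :=
  VectorField.mlieBracket I X Y x

/-- The expression of a vector field in a chart. -/
def fieldRep (I : ModelWithCorners ℝ E H) (X : M → E) (x : M) (y : E) : E :=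
  mder I 𝓘(ℝ, E) (extChartAt I x) ((extChartAt I x).symm y) (X ((extChartAt I x).symm y))

theorem fieldRep_self (X : M → E) (x : M) : fieldRep I X x (extChartAt I x x) = X x := by
  rw [fieldRep, extChartAt_to_inv, mder_extChartAt_self]
  rfl

theorem mder_symm_fieldRep (X : M → E) {x : M} {y : E} (hy : y ∈ (extChartAt I x).target) :
    mder 𝓘(ℝ, E) I (extChartAt I x).symm y (fieldRep I X x y) = X ((extChartAt I x).symm y) := by
  have h := mder_symm_mder_chart (I := I) ((extChartAt I x).map_target hy)
    (X ((extChartAt I x).symm y))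
  rwa [(extChartAt I x).right_inv hy] at h

theorem SmoothField.contDiffOn_fieldRep {X : M → E} (hX : SmoothField I X) (x : M) :
    ContDiffOn ℝ ∞ (fieldRep I X x) (extChartAt I x).target := by
  have : IsManifold I 1 M := IsManifold.of_le (n := ∞) (by simp)
  have h1 : ContMDiffOn 𝓘(ℝ, E) I.tangent ∞
      (fun y => (⟨(extChartAt I x).symm y, X ((extChartAt I x).symm y)⟩ : TangentBundle I M))
      (extChartAt I x).target :=
    ContMDiff.comp_contMDiffOn (g := fun x => (⟨x, X x⟩ : TangentBundle I M)) hX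
      (contMDiffOn_extChartAt_symm x)
  have h2 : ContMDiffOn I 𝓘(ℝ, E) ∞ (extChartAt I x) (extChartAt I x).source := by
    rw [extChartAt_source]
    exact contMDiffOn_extChartAt
  have h3 := h2.contMDiffOn_tangentMapWithin (m := ∞) (by simp)
    (isOpen_extChartAt_source x).uniqueMDiffOn
  have h4 := h3.comp h1 fun y hy => (extChartAt I x).map_target hy
  have h5 := (contMDiff_snd_tangentBundle_modelSpace E 𝓘(ℝ, E) (n := ∞)).comp_contMDiffOn h4
  refine (contMDiffOn_iff_contDiffOn.mp h5).congr fun y hy => ?_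
  have h6 := mfderivWithin_of_isOpen (I := I) (I' := 𝓘(ℝ, E)) (f := extChartAt I x)
    (isOpen_extChartAt_source x) ((extChartAt I x).map_target hy)
  change mfderiv I 𝓘(ℝ, E) (extChartAt I x) ((extChartAt I x).symm y) _ =
    mfderivWithin I 𝓘(ℝ, E) (extChartAt I x) (extChartAt I x).source ((extChartAt I x).symm y) _
  rw [h6]

theorem SmoothField.differentiableAt_fieldRep {X : M → E} (hX : SmoothField I X) (x : M) :
    DifferentiableAt ℝ (fieldRep I X x) (extChartAt I x x) :=
  ((hX.contDiffOn_fieldRep x).contDiffAt (extChartAt_target_mem_nhds x)).differentiableAt (by simp)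

/-- The manifold bracket uses the pull-back by the inverse chart, hence the inverse of its
derivative. On the target of the chart that inverse is the derivative of the chart, so the
pulled-back field is `fieldRep`. -/
theorem lieB_eq (X Y : M → E) (x : M) :
    lieB I X Y x =
      VectorField.lieBracket ℝ (fieldRep I X x) (fieldRep I Y x) (extChartAt I x x) := by
  have : IsManifold I 1 M := IsManifold.of_le (n := ∞) (by simp)
  let pull (Z : M → E) : E → E :=
    VectorField.mpullbackWithin 𝓘(ℝ, E) I (extChartAt I x).symm Z (Set.range I)
  have hpull (Z : M → E) : pull Z =ᶠ[nhds (extChartAt I x x)] fieldRep I Z x := by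
    refine Filter.eventuallyEq_of_mem (extChartAt_target_mem_nhds x) fun y hy => ?_
    have h0 : pull Z y = (mfderivWithin 𝓘(ℝ, E) I (extChartAt I x).symm (Set.range I) y).inverse
        (Z ((extChartAt I x).symm y)) := rfl
    rw [I.range_eq_univ, mfderivWithin_univ] at h0
    have h := ContinuousLinearMap.inverse_eq
      (f := (mder 𝓘(ℝ, E) I (extChartAt I x).symm y))
      (g := mder I 𝓘(ℝ, E) (extChartAt I x) ((extChartAt I x).symm y))
      (ContinuousLinearMap.ext fun v => by
        have := mder_symm_mder_chart (I := I) ((extChartAt I x).map_target hy) v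
        rwa [(extChartAt I x).right_inv hy] at this)
      (ContinuousLinearMap.ext fun v => mder_chart_mder_symm hy v)
    exact h0.trans (congrArg (fun L => L (Z ((extChartAt I x).symm y))) h)
  have h1 : lieB I X Y x = (mder I 𝓘(ℝ, E) (extChartAt I x) x).inverse
      (VectorField.lieBracketWithin ℝ (pull X) (pull Y)
        ((extChartAt I x).symm ⁻¹' Set.univ ∩ Set.range I) (extChartAt I x x)) :=
    VectorField.mlieBracketWithin_apply (I := I) (V := X) (W := Y)
  rw [mder_extChartAt_self, ContinuousLinearMap.inverse_id, Set.preimage_univ, Set.univ_inter,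
    I.range_eq_univ, VectorField.lieBracketWithin_univ] at h1
  refine h1.trans ?_
  exact (hpull X).lieBracket_vectorField_eq (hpull Y)

end Fields

/-! ### Cartan calculus on manifolds -/

section Fields

variable {E H M E' H' M' V W U : Type*}
  [NormedAddCommGroup E] [NormedSpace ℝ E] [FiniteDimensional ℝ E] [TopologicalSpace H]
  {I : ModelWithCorners ℝ E H} [I.Boundaryless] [TopologicalSpace M] [ChartedSpace H M]
  [IsManifold I ∞ M]
  [NormedAddCommGroup E'] [NormedSpace ℝ E'] [FiniteDimensional ℝ E'] [TopologicalSpace H']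
  {I' : ModelWithCorners ℝ E' H'} [I'.Boundaryless] [TopologicalSpace M'] [ChartedSpace H' M']
  [IsManifold I' ∞ M']
  [NormedAddCommGroup V] [NormedSpace ℝ V] [FiniteDimensional ℝ V]
  [NormedAddCommGroup W] [NormedSpace ℝ W] [FiniteDimensional ℝ W]
  [NormedAddCommGroup U] [NormedSpace ℝ U] [FiniteDimensional ℝ U]

theorem chartForm_apply_fieldRep {k : ℕ} (η : M → E [⋀^Fin k]→L[ℝ] V) (X : Fin k → M → E) {x : M}
    {y : E} (hy : y ∈ (extChartAt I x).target) :
    chartForm I η x y (fun i => fieldRep I (X i) x y) =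
      η ((extChartAt I x).symm y) (fun i => X i ((extChartAt I x).symm y)) := by
  change η _ (fun i => mder 𝓘(ℝ, E) I (extChartAt I x).symm y (fieldRep I (X i) x y)) = _
  simp only [mder_symm_fieldRep _ hy]

theorem chartForm_self {k : ℕ} (η : M → E [⋀^Fin k]→L[ℝ] V) (x : M) :
    chartForm I η x (extChartAt I x x) = η x := by
  ext v
  change η ((extChartAt I x).symm (extChartAt I x x))
    (fun i => mder 𝓘(ℝ, E) I (extChartAt I x).symm (extChartAt I x x) (v i)) = _
  rw [mder_extChartAt_symm_self, extChartAt_to_inv]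
  rfl

theorem contMDiff_of_chart {f : M → V}
    (h : ∀ x, ContDiffOn ℝ ∞ (fun y => f ((extChartAt I x).symm y)) (extChartAt I x).target) :
    ContMDiff I 𝓘(ℝ, V) ∞ f := by
  intro x
  have h1 : ContMDiffAt 𝓘(ℝ, E) 𝓘(ℝ, V) ∞ (fun y => f ((extChartAt I x).symm y))
      (extChartAt I x x) :=
    contMDiffAt_iff_contDiffAt.mpr ((h x).contDiffAt (extChartAt_target_mem_nhds x))
  have h2 := ContMDiffAt.comp x h1 (contMDiffAt_extChartAt (I := I) (n := ∞) (x := x))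
  refine h2.congr_of_eventuallyEq ?_
  refine Filter.eventuallyEq_of_mem (extChartAt_source_mem_nhds (I := I) x) fun _ hy => ?_
  exact congrArg f ((extChartAt I x).left_inv hy).symm

theorem SmoothForm.contMDiff_apply {k : ℕ} {η : M → E [⋀^Fin k]→L[ℝ] V} (hη : SmoothForm I η)
    {X : Fin k → M → E} (hX : ∀ i, SmoothField I (X i)) :
    ContMDiff I 𝓘(ℝ, V) ∞ fun x => η x fun i => X i x := by
  refine contMDiff_of_chart fun x => ?_
  refine (contDiffOn_form_apply (hη x) fun i => (hX i).contDiffOn_fieldRep x).congr fun y hy => ?_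
  exact (chartForm_apply_fieldRep η X hy).symm

theorem mder_chart_apply {k : ℕ} {η : M → E [⋀^Fin k]→L[ℝ] V} (hη : SmoothForm I η)
    {X : Fin k → M → E} (hX : ∀ i, SmoothField I (X i)) (x : M) (Z : E) :
    mder I 𝓘(ℝ, V) (fun y => η y fun i => X i y) x Z =
      fderiv ℝ (fun y => chartForm I η x y fun i => fieldRep I (X i) x y) (extChartAt I x x) Z := by
  rw [mder_eq_fderiv_chart ((hη.contMDiff_apply hX).mdifferentiableAt (by simp))]
  congr 1
  refine Filter.EventuallyEq.fderiv_eq (Filter.eventuallyEq_of_mem (extChartAt_target_mem_nhds x)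
    fun y hy => ?_)
  exact (chartForm_apply_fieldRep η X hy).symm

/-- A field of linear maps as a 1-form. -/
def toForm (α : M → E →L[ℝ] V) (x : M) : E [⋀^Fin 1]→L[ℝ] V :=
  ContinuousAlternatingMap.ofSubsingleton ℝ E V (0 : Fin 1) (α x)

@[simp] theorem toForm_apply (α : M → E →L[ℝ] V) (x : M) (v : Fin 1 → E) :
    toForm α x v = α x (v 0) := rfl

theorem SmoothForm.contMDiff_toForm_apply {α : M → E →L[ℝ] V} (hα : SmoothForm I (toForm α))
    {X : M → E} (hX : SmoothField I X) : ContMDiff I 𝓘(ℝ, V) ∞ fun x => α x (X x) :=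
  hα.contMDiff_apply (X := fun _ => X) fun _ => hX

/-- Cartan's formula for the exterior derivative of a 1-form. -/
theorem extD_toForm_apply {α : M → E →L[ℝ] V} (hα : SmoothForm I (toForm α)) {X Y : M → E}
    (hX : SmoothField I X) (hY : SmoothField I Y) (x : M) :
    extD I (toForm α) x ![X x, Y x] = mder I 𝓘(ℝ, V) (fun y => α y (Y y)) x (X x) -
      mder I 𝓘(ℝ, V) (fun y => α y (X y)) x (Y x) - α x (lieB I X Y x) := by
  have h := extDeriv_one_vectorField
    (differentiableAt_chartForm hα (mem_extChartAt_target (I := I) x))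
    (hX.differentiableAt_fieldRep x) (hY.differentiableAt_fieldRep x)
  rw [fieldRep_self, fieldRep_self, chartForm_self, ← lieB_eq] at h
  refine h.trans ?_
  have e (Z : M → E) (y : E) : ![fieldRep I Z x y] = fun i : Fin 1 => fieldRep I Z x y := by
    ext i; fin_cases i; rfl
  simp only [e]
  have h1 := mder_chart_apply hα (X := fun _ => X) (fun _ => hX) x (Y x)
  have h2 := mder_chart_apply hα (X := fun _ => Y) (fun _ => hY) x (X x)
  rw [← h1, ← h2]
  rfl

/-- Cartan's formula for the exterior derivative of a 2-form. -/
theorem extD_two_apply {η : M → E [⋀^Fin 2]→L[ℝ] V} (hη : SmoothForm I η) {X Y Z : M → E}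
    (hX : SmoothField I X) (hY : SmoothField I Y) (hZ : SmoothField I Z) (x : M) :
    extD I η x ![X x, Y x, Z x] = mder I 𝓘(ℝ, V) (fun y => η y ![Y y, Z y]) x (X x) -
      mder I 𝓘(ℝ, V) (fun y => η y ![X y, Z y]) x (Y x) +
      mder I 𝓘(ℝ, V) (fun y => η y ![X y, Y y]) x (Z x) -
      η x ![lieB I X Y x, Z x] + η x ![lieB I X Z x, Y x] - η x ![lieB I Y Z x, X x] := by
  have h := extDeriv_two_vectorField
    (differentiableAt_chartForm hη (mem_extChartAt_target (I := I) x))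
    (hX.differentiableAt_fieldRep x) (hY.differentiableAt_fieldRep x)
    (hZ.differentiableAt_fieldRep x)
  rw [fieldRep_self, fieldRep_self, fieldRep_self, chartForm_self, ← lieB_eq, ← lieB_eq,
    ← lieB_eq] at h
  refine h.trans ?_
  have key {P Q : M → E} (hP : SmoothField I P) (hQ : SmoothField I Q) (R : E) :
      mder I 𝓘(ℝ, V) (fun y => η y ![P y, Q y]) x R =
        fderiv ℝ (fun y => chartForm I η x y ![fieldRep I P x y, fieldRep I Q x y])
          (extChartAt I x x) R := by
    have h1 := mder_chart_apply hη (X := ![P, Q])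
      (fun i => by fin_cases i; exacts [hP, hQ]) x R
    have e1 (y : M) : (fun i => (![P, Q] : Fin 2 → M → E) i y) = ![P y, Q y] := by
      ext i; fin_cases i <;> rfl
    have e2 (y : E) : (fun i => fieldRep I ((![P, Q] : Fin 2 → M → E) i) x y) =
        ![fieldRep I P x y, fieldRep I Q x y] := by
      ext i; fin_cases i <;> rfl
    simp only [e1, e2] at h1
    exact h1
  rw [key hY hZ, key hX hZ, key hX hY]

theorem mder_eq_fderiv_charts {f : M → M'} {x : M} (hf : MDifferentiableAt I I' f x) (X : E) :
    mder I I' f x X = fderiv ℝ (fun y => extChartAt I' (f x) (f ((extChartAt I x).symm y)))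
      (extChartAt I x x) X := by
  have h1 := mdifferentiableAt_extChartAt_of_mem (I := I') (mem_extChartAt_source (I := I') (f x))
  have h2 : MDifferentiableAt I 𝓘(ℝ, E') (fun y => extChartAt I' (f x) (f y)) x :=
    MDifferentiableAt.comp x h1 hf
  have h3 := mder_eq_fderiv_chart h2 X
  rw [← h3, mder_comp_apply h1 hf, mder_extChartAt_self]
  rfl

/-- The Lie bracket of vector fields that are related by a map. -/
theorem lieB_related {f : M → M'} (hf : ContMDiff I I' ∞ f) {X Y : M → E} {X' Y' : M' → E'}
    (hX : SmoothField I X) (hY : SmoothField I Y) (hX' : SmoothField I' X')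
    (hY' : SmoothField I' Y') (hXX' : ∀ z, mder I I' f z (X z) = X' (f z))
    (hYY' : ∀ z, mder I I' f z (Y z) = Y' (f z)) (x : M) :
    mder I I' f x (lieB I X Y x) = lieB I' X' Y' (f x) := by
  rw [mder_eq_fderiv_charts (hf.mdifferentiableAt (by simp)), lieB_eq, lieB_eq]
  set g : E → E' := fun y => extChartAt I' (f x) (f ((extChartAt I x).symm y)) with hg
  have hgx : g (extChartAt I x x) = extChartAt I' (f x) (f x) := by
    simp only [hg, extChartAt_to_inv]
  have hcomp : ContMDiffAt 𝓘(ℝ, E) I' ∞ (fun y => f ((extChartAt I x).symm y))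
      (extChartAt I x x) :=
    hf.contMDiffAt.comp _ (contMDiffAt_extChartAt_symm (mem_extChartAt_target x))
  have hsrc : f ((extChartAt I x).symm (extChartAt I x x)) ∈ (extChartAt I' (f x)).source := by
    rw [extChartAt_to_inv]
    exact mem_extChartAt_source _
  have hgs : ContDiffAt ℝ ∞ g (extChartAt I x x) :=
    contDiffAt_chart_comp (g := fun y => f ((extChartAt I x).symm y)) hcomp hsrc
  have key {Z : M → E} {Z' : M' → E'} (hZ : ∀ z, mder I I' f z (Z z) = Z' (f z)) :
      ∀ᶠ y in nhds (extChartAt I x x), fderiv ℝ g y (fieldRep I Z x y) =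
        fieldRep I' Z' (f x) (g y) := by
    have e1 : ∀ᶠ y in nhds (extChartAt I x x),
        f ((extChartAt I x).symm y) ∈ (extChartAt I' (f x)).source :=
      hcomp.continuousAt.eventually_mem ((isOpen_extChartAt_source _).mem_nhds hsrc)
    filter_upwards [e1, extChartAt_target_mem_nhds (I := I) x] with y hy1 hy2
    have hs := mdifferentiableAt_extChartAt_symm (I := I) hy2
    have hfy := hf.mdifferentiableAt (x := (extChartAt I x).symm y) (by simp)
    rw [← mder_eq_fderiv, mder_comp_apply (I' := I') (g := extChartAt I' (f x))
      (f := fun y => f ((extChartAt I x).symm y)) (mdifferentiableAt_extChartAt_of_mem hy1)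
      (hfy.comp y hs), mder_comp_apply (I' := I) (g := f) hfy hs, mder_symm_fieldRep _ hy2, hZ,
      fieldRep, (extChartAt I' (f x)).left_inv hy1]
  rw [← hgx]
  refine lieBracket_related hgs (hX.differentiableAt_fieldRep x) (hY.differentiableAt_fieldRep x)
    ?_ ?_ (key hXX') (key hYY')
  · rw [hgx]; exact hX'.differentiableAt_fieldRep _
  · rw [hgx]; exact hY'.differentiableAt_fieldRep _

/-- The pull-back of vector-valued forms. -/
def formPull (I : ModelWithCorners ℝ E H) (I' : ModelWithCorners ℝ E' H') {k : ℕ} (f : M → M')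
    (η : M' → E' [⋀^Fin k]→L[ℝ] V) (x : M) : E [⋀^Fin k]→L[ℝ] V :=
  (η (f x)).compContinuousLinearMap (mder I I' f x)

theorem formPull_apply {k : ℕ} (f : M → M') (η : M' → E' [⋀^Fin k]→L[ℝ] V) (x : M)
    (v : Fin k → E) : formPull I I' f η x v = η (f x) fun i => mder I I' f x (v i) := rfl

theorem formPull_toForm (f : M → M') (α : M' → E' →L[ℝ] V) :
    formPull I I' f (toForm α) = toForm fun x => (α (f x)).comp (mder I I' f x) := by
  funext x
  ext v
  rfl

theorem chartForm_formPull {k : ℕ} {f : M → M'} (hf : ContMDiff I I' ∞ f)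
    (η : M' → E' [⋀^Fin k]→L[ℝ] V) {x : M} {y : E} (hy : y ∈ (extChartAt I x).target) :
    chartForm I (formPull I I' f η) x y =
      flatPullback I' (fun z => f ((extChartAt I x).symm z)) η y := by
  ext v
  change η _ (fun i => mder I I' f _ (mder 𝓘(ℝ, E) I _ y (v i))) =
    η _ (fun i => mder 𝓘(ℝ, E) I' _ y (v i))
  congr 1
  funext i
  rw [mder_comp_apply (I' := I) (g := f) (hf.mdifferentiableAt (by simp))
    (mdifferentiableAt_extChartAt_symm hy)]

theorem SmoothForm.formPull {k : ℕ} {η : M' → E' [⋀^Fin k]→L[ℝ] V} (hη : SmoothForm I' η)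
    {f : M → M'} (hf : ContMDiff I I' ∞ f) : SmoothForm I (formPull I I' f η) := fun x =>
  (contDiffOn_flatPullback hη (isOpen_extChartAt_target x)
    (hf.comp_contMDiffOn (contMDiffOn_extChartAt_symm x))).congr
      fun _ hy => chartForm_formPull hf η hy

theorem extD_formPull {k : ℕ} {η : M' → E' [⋀^Fin k]→L[ℝ] V} (hη : SmoothForm I' η)
    {f : M → M'} (hf : ContMDiff I I' ∞ f) (x : M) :
    extD I (formPull I I' f η) x = formPull I I' f (extD I' η) x := by
  have h1 : chartForm I (DiracManin.formPull I I' f η) x =ᶠ[nhds (extChartAt I x x)]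
      flatPullback I' (fun z => f ((extChartAt I x).symm z)) η :=
    Filter.eventuallyEq_of_mem (extChartAt_target_mem_nhds x)
      fun y hy => chartForm_formPull hf η hy
  refine h1.extDeriv_eq.trans ?_
  have h2 : ContMDiffAt 𝓘(ℝ, E) I' ∞ (fun z => f ((extChartAt I x).symm z)) (extChartAt I x x) :=
    hf.contMDiffAt.comp _ (contMDiffAt_extChartAt_symm (mem_extChartAt_target x))
  rw [extDeriv_flatPullback hη h2, ← chartForm_formPull hf _ (mem_extChartAt_target x),
    chartForm_self]

theorem chartForm_wedge {k l : ℕ} (b : V →ₗ[ℝ] W →ₗ[ℝ] U) (α : M → E [⋀^Fin k]→L[ℝ] V)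
    (β : M → E [⋀^Fin l]→L[ℝ] W) (x : M) (y : E) :
    chartForm I (fun z => wedge b (α z) (β z)) x y =
      wedge b (chartForm I α x y) (chartForm I β x y) := by
  refine wedge_ext_smul fun v => ?_
  rw [smul_wedge_apply]
  exact smul_wedge_apply b _ _ _

theorem SmoothForm.wedge {k l : ℕ} (b : V →ₗ[ℝ] W →ₗ[ℝ] U) {α : M → E [⋀^Fin k]→L[ℝ] V}
    {β : M → E [⋀^Fin l]→L[ℝ] W} (hα : SmoothForm I α) (hβ : SmoothForm I β) :
    SmoothForm I fun z => wedge b (α z) (β z) := fun x =>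
  (contDiffOn_wedge b (hα x) (hβ x)).congr fun y _ => chartForm_wedge b α β x y

theorem extD_wedge_one_one (b : V →ₗ[ℝ] W →ₗ[ℝ] U) {α : M → E [⋀^Fin 1]→L[ℝ] V}
    {β : M → E [⋀^Fin 1]→L[ℝ] W} (hα : SmoothForm I α) (hβ : SmoothForm I β) (x : M) (X Y Z : E) :
    extD I (fun z => DiracManin.wedge b (α z) (β z)) x ![X, Y, Z] =
      (b (extD I α x ![X, Y]) (β x ![Z]) - b (extD I α x ![X, Z]) (β x ![Y])
        + b (extD I α x ![Y, Z]) (β x ![X])) -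
      (b (α x ![X]) (extD I β x ![Y, Z]) - b (α x ![Y]) (extD I β x ![X, Z])
        + b (α x ![Z]) (extD I β x ![X, Y])) := by
  have h := extDeriv_wedge_one_one b (differentiableAt_chartForm hα (mem_extChartAt_target x))
    (differentiableAt_chartForm hβ (mem_extChartAt_target x)) X Y Z
  simp only [chartForm_self] at h
  rw [extD, funext (chartForm_wedge b α β x)]
  exact h

theorem extD_wedge_two_one (b : V →ₗ[ℝ] W →ₗ[ℝ] U) {η : M → E [⋀^Fin 2]→L[ℝ] V}
    {β : M → E [⋀^Fin 1]→L[ℝ] W} (hη : SmoothForm I η) (hβ : SmoothForm I β) (x : M)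
    (X Y Z Q : E) :
    extD I (fun z => DiracManin.wedge b (η z) (β z)) x ![X, Y, Z, Q] =
      (b (extD I η x ![X, Y, Z]) (β x ![Q]) - b (extD I η x ![X, Y, Q]) (β x ![Z])
        + b (extD I η x ![X, Z, Q]) (β x ![Y]) - b (extD I η x ![Y, Z, Q]) (β x ![X])) +
      (b (η x ![X, Y]) (extD I β x ![Z, Q]) - b (η x ![X, Z]) (extD I β x ![Y, Q])
        + b (η x ![X, Q]) (extD I β x ![Y, Z]) + b (η x ![Y, Z]) (extD I β x ![X, Q])
        - b (η x ![Y, Q]) (extD I β x ![X, Z]) + b (η x ![Z, Q]) (extD I β x ![X, Y])) := by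
  have h := extDeriv_wedge_two_one b (differentiableAt_chartForm hη (mem_extChartAt_target x))
    (differentiableAt_chartForm hβ (mem_extChartAt_target x)) X Y Z Q
  simp only [chartForm_self] at h
  rw [extD, funext (chartForm_wedge b η β x)]
  exact h

theorem SmoothForm.add {k : ℕ} {α β : M → E [⋀^Fin k]→L[ℝ] V} (hα : SmoothForm I α)
    (hβ : SmoothForm I β) : SmoothForm I fun x => α x + β x := fun x =>
  ((hα x).add (hβ x)).congr fun _ _ => rfl

theorem SmoothForm.smul {k : ℕ} (c : ℝ) {α : M → E [⋀^Fin k]→L[ℝ] V} (hα : SmoothForm I α) :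
    SmoothForm I fun x => c • α x := fun x =>
  ((hα x).const_smul c).congr fun _ _ => rfl

theorem SmoothForm.clm_comp {k : ℕ} (L : V →L[ℝ] W) {α : M → E [⋀^Fin k]→L[ℝ] V}
    (hα : SmoothForm I α) : SmoothForm I fun x => L.compContinuousAlternatingMap (α x) := fun x =>
  contDiffOn_form_iff.mpr fun v => L.contDiff.comp_contDiffOn (contDiffOn_form_iff.mp (hα x) v)

theorem extD_add {k : ℕ} {α β : M → E [⋀^Fin k]→L[ℝ] V} (hα : SmoothForm I α)
    (hβ : SmoothForm I β) (x : M) :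
    extD I (fun x => α x + β x) x = extD I α x + extD I β x :=
  extDeriv_add (differentiableAt_chartForm hα (mem_extChartAt_target x))
    (differentiableAt_chartForm hβ (mem_extChartAt_target x))

theorem extD_smul {k : ℕ} (c : ℝ) (α : M → E [⋀^Fin k]→L[ℝ] V) (x : M) :
    extD I (fun x => c • α x) x = c • extD I α x :=
  extDeriv_smul c (chartForm I α x)

theorem extD_clm_comp (L : V →L[ℝ] W) {α : M → E [⋀^Fin 1]→L[ℝ] V}
    (hα : SmoothForm I α) (x : M) (X Y : E) :
    extD I (fun x => L.compContinuousAlternatingMap (α x)) x ![X, Y] =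
      L (extD I α x ![X, Y]) := by
  have h1 := differentiableAt_chartForm hα (mem_extChartAt_target (I := I) x)
  have h2 := differentiableAt_chartForm (hα.clm_comp L) (mem_extChartAt_target (I := I) x)
  rw [extD, extD, extDeriv_one h1, extDeriv_one h2, ← fderiv_form_apply h1,
    ← fderiv_form_apply h1, ← fderiv_form_apply h2, ← fderiv_form_apply h2, map_sub]
  have h3 (v : Fin 1 → E) (P : E) : fderiv ℝ (fun z => chartForm I
      (fun x => L.compContinuousAlternatingMap (α x)) x z v) (extChartAt I x x) P =
      L (fderiv ℝ (fun z => chartForm I α x z v) (extChartAt I x x) P) :=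
    congrArg (fun K => K P) (L.hasFDerivAt.comp (extChartAt I x x)
      (((ContinuousAlternatingMap.apply ℝ E V v).differentiableAt.comp _ h1).hasFDerivAt)).fderiv
  rw [h3, h3]

theorem fderiv_bilin (b : V →ₗ[ℝ] W →ₗ[ℝ] U) {f : E → V} {g : E → W} {y : E}
    (hf : DifferentiableAt ℝ f y) (hg : DifferentiableAt ℝ g y) (X : E) :
    fderiv ℝ (fun z => b (f z) (g z)) y X = b (f y) (fderiv ℝ g y X) + b (fderiv ℝ f y X) (g y) :=
  congrArg (fun L => L X) ((LinearMap.toContinuousBilinearMap b).fderiv_of_bilinear hf hg)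

theorem contMDiff_bilin (b : V →ₗ[ℝ] W →ₗ[ℝ] U) {f : M → V} {g : M → W}
    (hf : ContMDiff I 𝓘(ℝ, V) ∞ f) (hg : ContMDiff I 𝓘(ℝ, W) ∞ g) :
    ContMDiff I 𝓘(ℝ, U) ∞ fun y => b (f y) (g y) := by
  refine contMDiff_of_chart fun x => ?_
  have h : ContDiff ℝ ∞ fun p : V × W => b p.1 p.2 :=
    (LinearMap.toContinuousBilinearMap b).isBoundedBilinearMap.contDiff
  exact ContDiff.comp_contDiffOn (g := fun p : V × W => b p.1 p.2)
    (f := fun y => (f ((extChartAt I x).symm y), g ((extChartAt I x).symm y))) h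
    ((contDiffOn_comp_chart_symm hf x).prodMk (contDiffOn_comp_chart_symm hg x))

theorem differentiableAt_comp_chart_symm {f : M → V} (hf : ContMDiff I 𝓘(ℝ, V) ∞ f) (x : M) :
    DifferentiableAt ℝ (fun y => f ((extChartAt I x).symm y)) (extChartAt I x x) :=
  ((contDiffOn_comp_chart_symm hf x).contDiffAt (extChartAt_target_mem_nhds x)).differentiableAt
    (by simp)

/-- The derivative of a bilinear expression. -/
theorem mder_bilin (b : V →ₗ[ℝ] W →ₗ[ℝ] U) {f : M → V} {g : M → W}
    (hf : ContMDiff I 𝓘(ℝ, V) ∞ f) (hg : ContMDiff I 𝓘(ℝ, W) ∞ g) (x : M) (X : E) :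
    mder I 𝓘(ℝ, U) (fun y => b (f y) (g y)) x X =
      b (f x) (mder I 𝓘(ℝ, W) g x X) + b (mder I 𝓘(ℝ, V) f x X) (g x) := by
  rw [mder_eq_fderiv_chart ((contMDiff_bilin b hf hg).mdifferentiableAt (by simp)),
    mder_eq_fderiv_chart (hf.mdifferentiableAt (by simp)),
    mder_eq_fderiv_chart (hg.mdifferentiableAt (by simp)),
    fderiv_bilin b (differentiableAt_comp_chart_symm hf x) (differentiableAt_comp_chart_symm hg x),
    extChartAt_to_inv]

/-- The Leibniz rule for the product of a 1-form and a function. -/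
theorem extD_toForm_bilin (b : V →ₗ[ℝ] W →ₗ[ℝ] U) {α : M → E →L[ℝ] U} {s : M → E →L[ℝ] V}
    {u : M → W} (hα : SmoothForm I (toForm α)) (hs : SmoothForm I (toForm s))
    (hu : ContMDiff I 𝓘(ℝ, W) ∞ u) (h : ∀ x X, α x X = b (s x X) (u x)) (x : M) (X Y : E) :
    extD I (toForm α) x ![X, Y] = b (extD I (toForm s) x ![X, Y]) (u x) +
      b (s x Y) (mder I 𝓘(ℝ, W) u x X) - b (s x X) (mder I 𝓘(ℝ, W) u x Y) := by
  have h1 := differentiableAt_chartForm hα (mem_extChartAt_target (I := I) x)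
  have h2 := differentiableAt_chartForm hs (mem_extChartAt_target (I := I) x)
  have h3 := differentiableAt_comp_chart_symm hu x
  have key (P Q : E) : fderiv ℝ (chartForm I (toForm α) x) (extChartAt I x x) P ![Q] =
      b (s x Q) (mder I 𝓘(ℝ, W) u x P) +
      b (fderiv ℝ (chartForm I (toForm s) x) (extChartAt I x x) P ![Q]) (u x) := by
    rw [← fderiv_form_apply h1, ← fderiv_form_apply h2]
    have e : (fun y => chartForm I (toForm α) x y ![Q]) = fun y =>
        b (chartForm I (toForm s) x y ![Q]) (u ((extChartAt I x).symm y)) := by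
      funext y
      exact h _ _
    have h4 : DifferentiableAt ℝ (fun y => chartForm I (toForm s) x y ![Q]) (extChartAt I x x) :=
      (ContinuousAlternatingMap.apply ℝ E V ![Q]).differentiableAt.comp _ h2
    rw [e, fderiv_bilin b h4 h3, mder_eq_fderiv_chart (hu.mdifferentiableAt (by simp)),
      extChartAt_to_inv, chartForm_self]
    rfl
  rw [extD, extD, extDeriv_one h1, extDeriv_one h2, key, key, map_sub, LinearMap.sub_apply]
  abel

/-- A field of linear maps obtained from a smooth 1-form and a fixed vector by means of a bilinear
map is smooth. -/
theorem SmoothForm.bilin_const (b : V →ₗ[ℝ] W →ₗ[ℝ] U) {α : M → E →L[ℝ] U} {s : M → E →L[ℝ] V}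
    (hs : SmoothForm I (toForm s)) (w : W) (h : ∀ x X, α x X = b (s x X) w) :
    SmoothForm I (toForm α) := by
  have h1 := hs.clm_comp (LinearMap.toContinuousLinearMap (b.flip w))
  have h2 : toForm α = fun x =>
      (LinearMap.toContinuousLinearMap (b.flip w)).compContinuousAlternatingMap (toForm s x) := by
    funext x
    ext v
    exact h x (v 0)
  rwa [h2]

/-- The contraction of a smooth 2-form with a smooth vector field is smooth. -/
theorem SmoothForm.contract {η : M → E [⋀^Fin 2]→L[ℝ] V} (hη : SmoothForm I η) {X : M → E}
    (hX : SmoothField I X) {α : M → E →L[ℝ] V} (h : ∀ x Y, α x Y = η x ![X x, Y]) :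
    SmoothForm I (toForm α) := by
  intro x
  refine contDiffOn_form_iff.mpr fun v => ?_
  have h1 := contDiffOn_form_apply (v := ![fieldRep I X x, fun _ => v 0]) (hη x)
    (fun i => by fin_cases i; exacts [hX.contDiffOn_fieldRep x, contDiffOn_const])
  refine h1.congr fun y hy => ?_
  refine (h _ _).trans ?_
  change _ = η _ fun i => mder 𝓘(ℝ, E) I _ y (![fieldRep I X x, fun _ => v 0] i y)
  congr 1
  ext i
  fin_cases i
  · exact (mder_symm_fieldRep X hy).symm
  · rfl

end Fields

/-! ### Representing functionals by a nondegenerate form -/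

section Musical

variable {𝔥 : Type*} [AddCommGroup 𝔥] [Module ℝ 𝔥] [FiniteDimensional ℝ 𝔥]
  {B : LinearMap.BilinForm ℝ 𝔥}

theorem exists_bilin_representative (hB : ∀ u, (∀ v, B u v = 0) → u = 0) (f : 𝔥 →ₗ[ℝ] ℝ) :
    ∃ w, ∀ v, B w v = f v := by
  have h1 : Function.Injective (B : 𝔥 →ₗ[ℝ] Module.Dual ℝ 𝔥) := by
    refine (injective_iff_map_eq_zero _).mpr fun u hu => hB u fun v => ?_
    exact congrArg (fun g => g v) hu
  have h2 : Function.Surjective (B : 𝔥 →ₗ[ℝ] Module.Dual ℝ 𝔥) :=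
    (LinearMap.injective_iff_surjective_of_finrank_eq_finrank
      (Subspace.dual_finrank_eq (K := ℝ) (V := 𝔥)).symm).mp h1
  obtain ⟨w, hw⟩ := h2 f
  exact ⟨w, fun v => congrArg (fun g => g v) hw⟩

end Musical

section Smoothness

variable {E H M : Type*}
  [NormedAddCommGroup E] [NormedSpace ℝ E] [FiniteDimensional ℝ E] [TopologicalSpace H]
  {I : ModelWithCorners ℝ E H} [I.Boundaryless] [TopologicalSpace M] [ChartedSpace H M]
  [IsManifold I ∞ M]
  {𝔥 : Type*} [NormedAddCommGroup 𝔥] [NormedSpace ℝ 𝔥] [FiniteDimensional ℝ 𝔥]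

/-- Pairing with a basis is an injective linear map, so a linear left inverse recovers `f` from its
pairings. It makes the `𝔥`-valued generator of a smooth section smooth. -/
theorem contMDiff_of_bilin {B : LinearMap.BilinForm ℝ 𝔥} (hB : ∀ u, (∀ v, B u v = 0) → u = 0)
    {f : M → 𝔥} (hf : ∀ v, ContMDiff I 𝓘(ℝ, ℝ) ∞ fun x => B (f x) v) :
    ContMDiff I 𝓘(ℝ, 𝔥) ∞ f := by
  let b := Module.finBasis ℝ 𝔥
  let Φ : 𝔥 →ₗ[ℝ] (Fin (Module.finrank ℝ 𝔥) → ℝ) := LinearMap.pi fun i => B.flip (b i)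
  have hΦ : LinearMap.ker Φ = ⊥ := by
    refine LinearMap.ker_eq_bot'.mpr fun u hu => hB u fun v => ?_
    have h : (B u : 𝔥 →ₗ[ℝ] ℝ) = 0 := b.ext fun i => congrFun hu i
    rw [h]
    rfl
  obtain ⟨g, hg⟩ := Φ.exists_leftInverse_of_injective hΦ
  refine contMDiff_of_chart fun x => ?_
  have h1 : ContDiffOn ℝ ∞ (fun y => Φ (f ((extChartAt I x).symm y))) (extChartAt I x).target :=
    contDiffOn_pi.mpr fun i => contDiffOn_comp_chart_symm (hf (b i)) x
  refine ((LinearMap.toContinuousLinearMap g).contDiff.comp_contDiffOn h1).congr fun y _ => ?_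
  exact (congrArg (fun L => L (f ((extChartAt I x).symm y))) hg).symm

end Smoothness

/-- The data underlying the construction of the twisted Dirac structure of a Manin pair on a
homogeneous space: a transitive action `ρ` of a quadratic Lie algebra `(𝔥, br, B)` with isotropic
stabilizers and an isotropic splitting `s` of it. -/
structure IsSplitAction {E H M : Type*} [NormedAddCommGroup E] [NormedSpace ℝ E]
    [TopologicalSpace H] (I : ModelWithCorners ℝ E H) [TopologicalSpace M] [ChartedSpace H M]
    [IsManifold I ∞ M] {𝔥 : Type*} [NormedAddCommGroup 𝔥] [NormedSpace ℝ 𝔥]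
    (br : 𝔥 →ₗ[ℝ] 𝔥 →ₗ[ℝ] 𝔥) (B : LinearMap.BilinForm ℝ 𝔥) (ρ : M → 𝔥 →L[ℝ] E)
    (s : M → E →L[ℝ] 𝔥) : Prop where
  symm : ∀ u v, B u v = B v u
  nondegenerate : ∀ u, (∀ v, B u v = 0) → u = 0
  invariant : ∀ u v w, B (br u v) w + B v (br u w) = 0
  skew : ∀ u v, br u v = -br v u
  jacobi : ∀ u v w, br u (br v w) = br (br u v) w + br v (br u w)
  smooth_splitting : SmoothForm I (toForm s)
  smooth_action : ∀ u, SmoothField I fun x => ρ x u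
  splitting : ∀ x X, ρ x (s x X) = X
  isotropic_splitting : ∀ x X Y, B (s x X) (s x Y) = 0
  isotropic_ker : ∀ x u v, ρ x u = 0 → ρ x v = 0 → B u v = 0
  bracket : ∀ u v x, lieB I (fun y => ρ y u) (fun y => ρ y v) x = ρ x (br u v)

/-! ### The closed 3-form and the Dirac structures of a split action -/

namespace IsSplitAction

variable {E H M : Type*}
  [NormedAddCommGroup E] [NormedSpace ℝ E] [FiniteDimensional ℝ E] [TopologicalSpace H]
  {I : ModelWithCorners ℝ E H} [I.Boundaryless] [TopologicalSpace M] [ChartedSpace H M]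
  [IsManifold I ∞ M]
  {𝔥 : Type*} [NormedAddCommGroup 𝔥] [NormedSpace ℝ 𝔥] [FiniteDimensional ℝ 𝔥]
  {br : 𝔥 →ₗ[ℝ] 𝔥 →ₗ[ℝ] 𝔥} {B : LinearMap.BilinForm ℝ 𝔥} {ρ : M → 𝔥 →L[ℝ] E}
  {s : M → E →L[ℝ] 𝔥}

/-- With `P = s ∘ ρ`, the vectors `u - P u` and `v - P v` lie in the isotropic kernel of `ρ`, while
`P u` and `P v` lie in the isotropic image of `s`. Expanding the pairing of the former gives `P + Pᵀ
= 1`. -/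
theorem projection_add_adjoint (h : IsSplitAction I br B ρ s) (x : M) (u v : 𝔥) :
    B (s x (ρ x u)) v + B u (s x (ρ x v)) = B u v := by
  have h1 := h.isotropic_ker x (u - s x (ρ x u)) (v - s x (ρ x v))
    (by rw [map_sub, h.splitting, sub_self]) (by rw [map_sub, h.splitting, sub_self])
  have h2 := h.isotropic_splitting x (ρ x u) (ρ x v)
  simp only [map_sub, LinearMap.sub_apply] at h1
  linarith

theorem cyclic (h : IsSplitAction I br B ρ s) (u v w : 𝔥) : B (br u v) w = B (br v w) u := by
  have h1 := h.invariant v u w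
  rw [h.skew v u, map_neg, LinearMap.neg_apply, h.symm u] at h1
  linarith

theorem skew_left (h : IsSplitAction I br B ρ s) (u v w : 𝔥) : B (br v u) w = -B (br u v) w := by
  rw [h.skew v u, map_neg, LinearMap.neg_apply]

/-- The action in a chart. -/
theorem exists_chart_action (h : IsSplitAction I br B ρ s) (x : M) :
    ∃ R : E → 𝔥 →L[ℝ] E, DifferentiableAt ℝ R (extChartAt I x x) ∧
      R (extChartAt I x x) = ρ x ∧
      ∀ f : M → 𝔥, fieldRep I (fun y => ρ y (f y)) x =
        fun y => R y (f ((extChartAt I x).symm y)) := by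
  let R : E → 𝔥 →L[ℝ] E := fun y => (mder I 𝓘(ℝ, E) (extChartAt I x) ((extChartAt I x).symm y)).comp
    (ρ ((extChartAt I x).symm y))
  refine ⟨R, ?_, ?_, fun f => rfl⟩
  · have h1 : ContDiffOn ℝ ∞ R (extChartAt I x).target :=
      contDiffOn_clm_apply.mpr fun u => (h.smooth_action u).contDiffOn_fieldRep x
    exact (h1.contDiffAt (extChartAt_target_mem_nhds x)).differentiableAt (by simp)
  · ext u
    exact fieldRep_self (fun y => ρ y u) x

/-- In a chart, the terms that differentiate the action alone form the bracket of the fields with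
coefficients frozen at `x`, known from `bracket`. The remaining terms differentiate the
coefficients. -/
theorem lieB_action (h : IsSplitAction I br B ρ s) {f g : M → 𝔥} (hf : ContMDiff I 𝓘(ℝ, 𝔥) ∞ f)
    (hg : ContMDiff I 𝓘(ℝ, 𝔥) ∞ g) (x : M) :
    lieB I (fun y => ρ y (f y)) (fun y => ρ y (g y)) x =
      ρ x (br (f x) (g x) + mder I 𝓘(ℝ, 𝔥) g x (ρ x (f x)) -
        mder I 𝓘(ℝ, 𝔥) f x (ρ x (g x))) := by
  obtain ⟨R, hR, hRx, hrep⟩ := h.exists_chart_action x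
  have key {k : M → 𝔥} (hk : ContMDiff I 𝓘(ℝ, 𝔥) ∞ k) (Z : E) :
      fderiv ℝ (fun y => R y (k ((extChartAt I x).symm y))) (extChartAt I x x) Z =
        fderiv ℝ R (extChartAt I x x) Z (k x) + ρ x (mder I 𝓘(ℝ, 𝔥) k x Z) := by
    rw [mder_eq_fderiv_chart (hk.mdifferentiableAt (by simp)),
      fderiv_clm_apply hR (differentiableAt_comp_chart_symm hk x), hRx, extChartAt_to_inv, add_comm]
    rfl
  have hc := h.bracket (f x) (g x) x
  rw [lieB_eq, hrep (fun _ => f x), hrep (fun _ => g x)] at hc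
  rw [lieB_eq, hrep f, hrep g]
  simp only [VectorField.lieBracket] at hc ⊢
  rw [key contMDiff_const, key contMDiff_const, mder_const, mder_const] at hc
  rw [key hf, key hg, extChartAt_to_inv, hRx, map_sub, map_add, ← hc]
  simp only [hRx, zero_apply, map_zero]
  abel

/-- The bracket of two vector fields that both vanish at a point vanishes there. -/
theorem ker_bracket (h : IsSplitAction I br B ρ s) {x : M} {u v : 𝔥} (hu : ρ x u = 0)
    (hv : ρ x v = 0) : ρ x (br u v) = 0 := by
  obtain ⟨R, -, hRx, hrep⟩ := h.exists_chart_action x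
  rw [← h.bracket, lieB_eq, hrep (fun _ => u), hrep (fun _ => v)]
  simp only [VectorField.lieBracket, hRx, hu, hv, map_zero, sub_zero]

/-- The constant `w` and the function `s (ρ w)` generate the same vector field. Bracketing both with
the field of `v` shows that `ρ` kills the derivative of `s (ρ w)` along `X`, and likewise with the
roles exchanged. Cartan's formula for `ds` on the fields of `v` and `w` then leaves only brackets,
which cancel. -/
theorem ker_curvature (h : IsSplitAction I br B ρ s) (x : M) (X Y : E) :
    ρ x (extD I (toForm s) x ![X, Y] + br (s x X) (s x Y)) = 0 := by
  set v := s x X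
  set w := s x Y
  have hX : ρ x v = X := h.splitting x X
  have hY : ρ x w = Y := h.splitting x Y
  have h1 := extD_toForm_apply h.smooth_splitting (h.smooth_action v) (h.smooth_action w) x
  have hsm (u : 𝔥) : ContMDiff I 𝓘(ℝ, 𝔥) ∞ fun y => s y (ρ y u) :=
    h.smooth_splitting.contMDiff_toForm_apply (h.smooth_action u)
  have h2 := h.lieB_action (contMDiff_const (c := v)) (hsm w) x
  have h3 := h.lieB_action (contMDiff_const (c := w)) (hsm v) x
  simp only [h.splitting, hX, hY, mder_const, zero_apply, sub_zero] at h1 h2 h3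
  rw [h.bracket, map_add] at h2 h3
  rw [h1, h.bracket, map_add, map_sub, map_sub, h.splitting]
  change ρ x (mder I 𝓘(ℝ, 𝔥) (fun y => s y (ρ y w)) x X) -
    ρ x (mder I 𝓘(ℝ, 𝔥) (fun y => s y (ρ y v)) x Y) - ρ x (br v w) + ρ x (br v w) = 0
  have h4 : ρ x (mder I 𝓘(ℝ, 𝔥) (fun y => s y (ρ y w)) x X) = 0 := by
    exact left_eq_add.mp h2
  have h5 : ρ x (mder I 𝓘(ℝ, 𝔥) (fun y => s y (ρ y v)) x Y) = 0 := by
    exact left_eq_add.mp h3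
  rw [h4, h5]
  simp

/-- Against stabilizer vectors `ds` may be traded for minus the bracket, since the curvature lies in
the same isotropic stabilizer. -/
theorem curvature_apply (h : IsSplitAction I br B ρ s) (x : M) (X Y : E) {b : 𝔥} (hb : ρ x b = 0) :
    B (extD I (toForm s) x ![X, Y]) b = -B (br (s x X) (s x Y)) b := by
  have h1 := h.isotropic_ker x _ _ (h.ker_curvature x X Y) hb
  rw [map_add, LinearMap.add_apply] at h1
  linarith

/-- The 3-form `½ ⟨ds, s⟩ + ⅙ ⟨[s, s], s⟩`. -/
def twist (I : ModelWithCorners ℝ E H) (br : 𝔥 →ₗ[ℝ] 𝔥 →ₗ[ℝ] 𝔥) (B : LinearMap.BilinForm ℝ 𝔥)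
    (s : M → E →L[ℝ] 𝔥) (x : M) : E [⋀^Fin 3]→L[ℝ] ℝ :=
  (1 / 2 : ℝ) • wedge B (extD I (toForm s) x) (toForm s x) +
    (1 / 6 : ℝ) • wedge B (wedge br (toForm s x) (toForm s x)) (toForm s x)

/-- By invariance and skew-symmetry the six terms of `⟨[s, s], s⟩` coincide, which cancels the
factor `1/6`. -/
theorem twist_apply (h : IsSplitAction I br B ρ s) (x : M) (X Y Z : E) :
    twist I br B s x ![X, Y, Z] =
      (1 / 2) * (B (extD I (toForm s) x ![X, Y]) (s x Z) - B (extD I (toForm s) x ![X, Z]) (s x Y)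
        + B (extD I (toForm s) x ![Y, Z]) (s x X)) + B (br (s x X) (s x Y)) (s x Z) := by
  have h1 : twist I br B s x ![X, Y, Z] =
      (1 / 2) * wedge B (extD I (toForm s) x) (toForm s x) ![X, Y, Z] +
      (1 / 6) * wedge B (wedge br (toForm s x) (toForm s x)) (toForm s x) ![X, Y, Z] := rfl
  have e1 := h.skew_left (s x X) (s x Y) (s x Z)
  have e2 := h.skew_left (s x Y) (s x Z) (s x X)
  have e3 := h.skew_left (s x Z) (s x X) (s x Y)
  have e4 := h.cyclic (s x X) (s x Y) (s x Z)
  have e5 := h.cyclic (s x Y) (s x Z) (s x X)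
  rw [h1, wedge_two_one, wedge_two_one, wedge_one_one, wedge_one_one, wedge_one_one]
  simp only [toForm_apply, Matrix.cons_val_zero, map_sub, LinearMap.sub_apply]
  linarith

theorem smoothForm_twist (h : IsSplitAction I br B ρ s) : SmoothForm I (twist I br B s) :=
  ((h.smooth_splitting.extD.wedge B h.smooth_splitting).smul _).add
    (((h.smooth_splitting.wedge br h.smooth_splitting).wedge B h.smooth_splitting).smul _)

/-- With curvature `F = ds + ½[s, s]`, the differential of the 3-form is `½⟨ds, ds⟩ + ½⟨[s, s],
ds⟩`. It differs from `½⟨F, F⟩` by a multiple of `⟨[s, s], [s, s]⟩`. The first vanishes by isotropy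
of the stabilizers, the second by the Jacobi identity. -/
theorem extD_twist (h : IsSplitAction I br B ρ s) (x : M) : extD I (twist I br B s) x = 0 := by
  have hs := h.smooth_splitting
  have hds := hs.extD
  have hss := hs.wedge br hs
  ext q
  obtain ⟨X, Y, Z, Q, rfl⟩ : ∃ X Y Z Q, q = ![X, Y, Z, Q] :=
    ⟨q 0, q 1, q 2, q 3, by ext i; fin_cases i <;> rfl⟩
  have h0 : extD I (twist I br B s) x ![X, Y, Z, Q] =
      (1 / 2) * extD I (fun x => wedge B (extD I (toForm s) x) (toForm s x)) x ![X, Y, Z, Q] +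
      (1 / 6) * extD I (fun x => wedge B (wedge br (toForm s x) (toForm s x)) (toForm s x)) x
        ![X, Y, Z, Q] := by
    have := extD_add ((hds.wedge B hs).smul (1 / 2)) ((hss.wedge B hs).smul (1 / 6)) x
    rw [extD_smul, extD_smul] at this
    exact congrArg (fun η => η ![X, Y, Z, Q]) this
  have zero_form (v : Fin 3 → E) : (0 : E [⋀^Fin 3]→L[ℝ] 𝔥) v = 0 := rfl
  change _ = (0 : ℝ)
  rw [h0, extD_wedge_two_one B hds hs, extD_wedge_two_one B hss hs, extD_extD hs]
  simp only [extD_wedge_one_one br hs hs, wedge_one_one]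
  simp only [toForm_apply, Matrix.cons_val_zero, map_sub, map_add, LinearMap.sub_apply,
    LinearMap.add_apply, zero_form, map_zero, LinearMap.zero_apply]
  -- Two values of the curvature at the same point pair to zero.
  have F (P Q' P' Q'' : E) : B (extD I (toForm s) x ![P, Q']) (extD I (toForm s) x ![P', Q'']) +
      B (extD I (toForm s) x ![P, Q']) (br (s x P') (s x Q'')) +
      B (extD I (toForm s) x ![P', Q'']) (br (s x P) (s x Q')) +
      B (br (s x P) (s x Q')) (br (s x P') (s x Q'')) = 0 := by
    have := h.isotropic_ker x _ _ (h.ker_curvature x P Q') (h.ker_curvature x P' Q'')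
    simp only [map_add, LinearMap.add_apply] at this
    rw [h.symm (extD I (toForm s) x ![P', Q''])]
    linarith
  have f1 := F X Y Z Q
  have f2 := F X Z Y Q
  have f3 := F X Q Y Z
  -- Invariance moves everything onto `s x X`, where the Jacobi identity remains.
  have J : B (br (s x X) (s x Y)) (br (s x Z) (s x Q)) - B (br (s x X) (s x Z)) (br (s x Y) (s x Q))
      + B (br (s x X) (s x Q)) (br (s x Y) (s x Z)) = 0 := by
    rw [h.cyclic (s x X), h.cyclic (s x X) (s x Z), h.cyclic (s x X) (s x Q), ← LinearMap.sub_apply,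
      ← LinearMap.add_apply, ← map_sub, ← map_add, h.jacobi (s x Y), h.skew (s x Q)]
    simp
  -- The rules `T`, `T2`, `S` and `S2` bring all mixed terms to the form `B (ds) (br (s P) (s Q))`,
  -- with `P`, `Q` in a fixed order, so that a linear combination suffices.
  have T (k : 𝔥) (P Q' : E) : B (br k (s x P)) (s x Q') = B k (br (s x P) (s x Q')) := by
    rw [h.cyclic, h.symm]
  have T2 (k : 𝔥) (P Q' : E) : B (br (s x P) k) (s x Q') = -B k (br (s x P) (s x Q')) := by
    rw [h.skew_left, T]
  have S (k : 𝔥) (P Q' : E) : B k (br (s x P) (s x Q')) = -B k (br (s x Q') (s x P)) := by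
    rw [h.skew, map_neg]
  have S2 (k : 𝔥) (P Q' : E) : B (br (s x P) (s x Q')) k = B k (br (s x P) (s x Q')) := h.symm _ _
  simp only [T, T2]
  rw [h.symm (extD I (toForm s) x ![Y, Z]) (extD I (toForm s) x ![X, Q]),
    h.symm (extD I (toForm s) x ![Y, Q]) (extD I (toForm s) x ![X, Z]),
    h.symm (extD I (toForm s) x ![Z, Q]) (extD I (toForm s) x ![X, Y])]
  rw [S2 (extD I (toForm s) x ![Z, Q]), S2 (extD I (toForm s) x ![Z, Q]),
    S2 (extD I (toForm s) x ![Y, Q]), S2 (extD I (toForm s) x ![Y, Q]),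
    S2 (extD I (toForm s) x ![Y, Z]), S2 (extD I (toForm s) x ![Y, Z]),
    S2 (extD I (toForm s) x ![X, Z]), S2 (extD I (toForm s) x ![X, Z]),
    S2 (extD I (toForm s) x ![X, Y]), S2 (extD I (toForm s) x ![X, Y]),
    S2 (extD I (toForm s) x ![X, Q]), S2 (extD I (toForm s) x ![X, Q])]
  rw [S _ Y X, S _ Z X, S _ Q X, S _ Z Y, S _ Q Y, S _ Q Z]
  linarith


/-- The subspace is cut out by the linear equations `B · v = 0`, which can be differentiated along a
function with values in it. -/
theorem mem_perp_derivative {V : Submodule ℝ 𝔥} (hV : ∀ u, u ∈ V ↔ ∀ v ∈ V, B u v = 0) {u : M → 𝔥}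
    (hu : ContMDiff I 𝓘(ℝ, 𝔥) ∞ u) (huV : ∀ x, u x ∈ V) (x : M) (X : E) {v : 𝔥} (hv : v ∈ V) :
    B (mder I 𝓘(ℝ, 𝔥) u x X) v = 0 := by
  have h1 := mder_bilin B hu (contMDiff_const (c := v)) x X
  have h2 : (fun y => B (u y) v) = fun _ => (0 : ℝ) := funext fun y => (hV _).mp (huV y) v hv
  rw [h2, mder_const, mder_const] at h1
  simpa using h1.symm

/-- Every generalized tangent vector is of the form `(ρ u, ⟨s, u⟩)`. -/
theorem exists_generator (h : IsSplitAction I br B ρ s) (x : M) (X : E) (α : E →L[ℝ] ℝ) :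
    ∃ u, ρ x u = X ∧ (∀ Y, α Y = B (s x Y) u) ∧
      ∀ v, B u v = B (s x X) v + α (ρ x v) := by
  -- The generator is `s X + w`: `s X` accounts for the vector, and `w` represents `α ∘ ρ`. The
  -- adjoint identity forces `s (ρ w) = 0`, so adding `w` does not change the vector part.
  obtain ⟨w, hw⟩ := exists_bilin_representative h.nondegenerate
    (α.toLinearMap.comp (ρ x).toLinearMap)
  have hw' (v : 𝔥) : B w v = α (ρ x v) := hw v
  have h1 : s x (ρ x w) = 0 := by
    refine h.nondegenerate _ fun v => ?_
    have h2 := h.projection_add_adjoint x w v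
    rw [hw', hw', h.splitting] at h2
    linarith
  have h2 : ρ x w = 0 := by rw [← h.splitting x (ρ x w), h1, map_zero]
  refine ⟨s x X + w, ?_, fun Y => ?_, fun v => ?_⟩
  · rw [map_add, h.splitting, h2, add_zero]
  · rw [map_add, h.isotropic_splitting, zero_add, h.symm, hw', h.splitting]
  · rw [map_add, LinearMap.add_apply, hw']

/-- The map `u ↦ (ρ u, ⟨s, u⟩)` carries `B` to the canonical pairing on generalized tangent vectors.
-/
theorem pairing (h : IsSplitAction I br B ρ s) (x : M) (u v : 𝔥) :
    B (s x (ρ x u)) v + B (s x (ρ x v)) u = B u v := by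
  rw [h.symm (s x (ρ x v)), h.projection_add_adjoint]

/-- The involutivity of `{(ρ u, ⟨s, u⟩)}`, tested on a constant section. -/
theorem involutive (h : IsSplitAction I br B ρ s) {V : Submodule ℝ 𝔥}
    (hV : ∀ u, u ∈ V ↔ ∀ v ∈ V, B u v = 0) (hbr : ∀ u ∈ V, ∀ v ∈ V, br u v ∈ V)
    {u₁ u₂ : M → 𝔥} (hu₁ : ContMDiff I 𝓘(ℝ, 𝔥) ∞ u₁) (hu₂ : ContMDiff I 𝓘(ℝ, 𝔥) ∞ u₂)
    (hV₁ : ∀ x, u₁ x ∈ V) (hV₂ : ∀ x, u₂ x ∈ V) {X₁ X₂ : M → E} (hX₁ : SmoothField I X₁)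
    (hX₂ : SmoothField I X₂) {α₁ α₂ : M → E →L[ℝ] ℝ} (hα₁ : SmoothForm I (toForm α₁))
    (hα₂ : SmoothForm I (toForm α₂)) (hX₁u : ∀ x, X₁ x = ρ x (u₁ x))
    (hX₂u : ∀ x, X₂ x = ρ x (u₂ x)) (hα₁u : ∀ x Y, α₁ x Y = B (s x Y) (u₁ x))
    (hα₂u : ∀ x Y, α₂ x Y = B (s x Y) (u₂ x)) (x : M) {w : 𝔥} (hw : w ∈ V) :
    extD I (toForm α₂) x ![X₁ x, ρ x w] +
      mder I 𝓘(ℝ, ℝ) (fun y => α₂ y (X₁ y)) x (ρ x w) - extD I (toForm α₁) x ![X₂ x, ρ x w] +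
      twist I br B s x ![X₁ x, X₂ x, ρ x w] + B (s x (lieB I X₁ X₂ x)) w = 0 := by
  have hX₃ := h.smooth_action w
  let α₃ : M → E →L[ℝ] ℝ := fun x => (LinearMap.toContinuousLinearMap (B.flip w)).comp (s x)
  have hα₃u (x : M) (Y : E) : α₃ x Y = B (s x Y) w := rfl
  have hα₃ : SmoothForm I (toForm α₃) := h.smooth_splitting.bilin_const B w hα₃u
  have hpair (x : M) {u v : 𝔥} (hu : u ∈ V) (hv : v ∈ V) :
      B (s x (ρ x u)) v = -B (s x (ρ x v)) u := by
    have h1 := h.pairing x u v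
    rw [(hV u).mp hu v hv] at h1
    linarith
  -- Isotropy of the three sections turns functions `α_i (X_j)` into `-α_j (X_i)`, so fewer
  -- derivatives occur in Cartan's formulas.
  have p12 : (fun y => α₁ y (X₂ y)) = fun y => (-1 : ℝ) • α₂ y (X₁ y) := by
    funext y
    rw [hα₁u, hα₂u, hX₁u, hX₂u, hpair y (hV₁ y) (hV₂ y)]
    simp
  have p13 : (fun y => α₁ y (ρ y w)) = fun y => (-1 : ℝ) • α₃ y (X₁ y) := by
    funext y
    rw [hα₁u, hα₃u, hX₁u, hpair y (hV₁ y) hw]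
    simp
  have p23 : (fun y => α₂ y (ρ y w)) = fun y => (-1 : ℝ) • α₃ y (X₂ y) := by
    funext y
    rw [hα₂u, hα₃u, hX₂u, hpair y (hV₂ y) hw]
    simp
  have hneg {f : M → ℝ} (hf : ContMDiff I 𝓘(ℝ, ℝ) ∞ f) (Z : E) :
      mder I 𝓘(ℝ, ℝ) (fun y => (-1 : ℝ) • f y) x Z = -mder I 𝓘(ℝ, ℝ) f x Z := by
    have := mder_bilin (LinearMap.mul ℝ ℝ) (contMDiff_const (c := (-1 : ℝ))) hf x Z
    rw [mder_const] at this
    simpa using this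
  have c1 := extD_toForm_apply hα₁ hX₂ hX₃ x
  have c2 := extD_toForm_apply hα₂ hX₁ hX₃ x
  have c3 := extD_toForm_apply hα₃ hX₁ hX₂ x
  rw [p12, p13, hneg (hα₂.contMDiff_toForm_apply hX₁), hneg (hα₃.contMDiff_toForm_apply hX₁)] at c1
  rw [p23, hneg (hα₃.contMDiff_toForm_apply hX₂)] at c2
  -- Each `dα_i` is computed twice: by Cartan's formula (`c1`, `c2`, `c3`) and by the Leibniz rule
  -- for `⟨s, u_i⟩`. Comparing the two eliminates the derivatives of functions.
  have d1 := extD_toForm_bilin B hα₁ h.smooth_splitting hu₁ hα₁u x (X₂ x) (ρ x w)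
  have d2 := extD_toForm_bilin B hα₂ h.smooth_splitting hu₂ hα₂u x (X₁ x) (ρ x w)
  have d3 := extD_toForm_bilin B hα₃ h.smooth_splitting (contMDiff_const (c := w)) hα₃u x (X₁ x)
    (X₂ x)
  have eX₁ : X₁ = fun x => ρ x (u₁ x) := funext hX₁u
  have eX₂ : X₂ = fun x => ρ x (u₂ x) := funext hX₂u
  have l12 := h.lieB_action hu₁ hu₂ x
  have l13 := h.lieB_action hu₁ (contMDiff_const (c := w)) x
  have l23 := h.lieB_action hu₂ (contMDiff_const (c := w)) x
  rw [← eX₁, ← eX₂] at l12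
  rw [← eX₁] at l13
  rw [← eX₂] at l23
  rw [mder_const] at d3 l13 l23
  simp only [zero_apply, add_zero, map_zero, sub_zero] at d3 l13 l23
  rw [hα₁u, l23] at c1
  rw [hα₂u, l13] at c2
  rw [hα₃u, l12] at c3
  rw [h.twist_apply, l12]
  have v1 (Z : E) {v : 𝔥} (hv : v ∈ V) := mem_perp_derivative hV hu₁ hV₁ x Z hv
  have v2 (Z : E) {v : 𝔥} (hv : v ∈ V) := mem_perp_derivative hV hu₂ hV₂ x Z hv
  rw [← hX₁u, ← hX₂u]
  have adj (t u : 𝔥) : B (s x (ρ x t)) u = B t u - B t (s x (ρ x u)) := by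
    linarith [h.projection_add_adjoint x t u]
  have odd (p q r : 𝔥) : B (br p r) q = -B (br p q) r := by
    rw [h.cyclic, h.cyclic, h.skew_left]
  have even (p q r : 𝔥) : B (br q r) p = B (br p q) r := (h.cyclic p q r).symm
  -- The differences `u - s (ρ u)` lie in the stabilizer. Hence the curvature pairs to the bracket
  -- on them (`k1`, `k2`, `k3`), and their triple product vanishes (`hb`).
  have k1 := h.curvature_apply x (X₂ x) (ρ x w) (b := u₁ x - s x (X₁ x))
    (by rw [map_sub, h.splitting, ← hX₁u, sub_self])
  have k2 := h.curvature_apply x (X₁ x) (ρ x w) (b := u₂ x - s x (X₂ x))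
    (by rw [map_sub, h.splitting, ← hX₂u, sub_self])
  have k3 := h.curvature_apply x (X₁ x) (X₂ x) (b := w - s x (ρ x w))
    (by rw [map_sub, h.splitting, sub_self])
  have hb : B (br (u₁ x - s x (X₁ x)) (u₂ x - s x (X₂ x))) (w - s x (ρ x w)) = 0 := by
    refine h.isotropic_ker x _ _ (h.ker_bracket ?_ ?_) ?_
    · rw [map_sub, h.splitting, ← hX₁u, sub_self]
    · rw [map_sub, h.splitting, ← hX₂u, sub_self]
    · rw [map_sub, h.splitting, sub_self]
  -- The only place where closure of `V` under the bracket is used.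
  have hu : B (br (u₁ x) (u₂ x)) w = 0 := (hV _).mp (hbr _ (hV₁ x) _ (hV₂ x)) w hw
  rw [adj, ← hX₁u] at c1
  rw [adj, ← hX₂u] at c2
  rw [adj, ← hX₁u, ← hX₂u] at c3
  rw [adj]
  have w1 := v1 (X₂ x) hw
  have w2 := v2 (X₁ x) hw
  have w3 := v1 (ρ x w) (hV₂ x)
  have w4 := v2 (ρ x w) (hV₁ x)
  rw [even] at k1
  rw [odd] at k2
  simp only [map_sub, map_add, LinearMap.sub_apply, LinearMap.add_apply] at c1 c2 c3 k1 k2 k3 hb ⊢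
  rw [even (u₁ x), even (s x (X₁ x))] at c1
  rw [odd _ (u₂ x), odd _ (s x (X₂ x))] at c2
  rw [h.symm (s x (ρ x w)), h.symm (s x (X₂ x))] at d1
  rw [h.symm (s x (ρ x w)), h.symm (s x (X₁ x))] at d2
  linarith

/-- Under the identification of generalized tangent spaces with `𝔥`, `L` is the constant subbundle
with fibre `V = V^⊥`. Constant sections therefore span it and suffice for testing membership, which
gives all the axioms apart from the twist conditions. -/
theorem isDirac (h : IsSplitAction I br B ρ s) {V : Submodule ℝ 𝔥}
    (hV : ∀ u, u ∈ V ↔ ∀ v ∈ V, B u v = 0) (hbr : ∀ u ∈ V, ∀ v ∈ V, br u v ∈ V)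
    {L : Π x : M, Submodule ℝ (GenTangent I x)}
    (hL : ∀ x (X : E) (α : E →L[ℝ] ℝ), ((X, α) : GenTangent I x) ∈ L x ↔
      ∃ u ∈ V, ρ x u = X ∧ ∀ Y, α Y = B (s x Y) u) :
    IsDirac I L (twist I br B s) := by
  -- A generalized vector lies in `L` as soon as its generator is orthogonal to `V`.
  have hperp (x : M) (X : E) (α : E →L[ℝ] ℝ) : ((X, α) : GenTangent I x) ∈ L x ↔
      ∀ w ∈ V, B (s x X) w + α (ρ x w) = 0 := by
    rw [hL]
    constructor
    · rintro ⟨u, hu, rfl, h1⟩ w hw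
      rw [h1, h.pairing]
      exact (hV u).mp hu w hw
    · intro h1
      obtain ⟨u, h2, h3, h4⟩ := h.exists_generator x X α
      exact ⟨u, (hV u).mpr fun w hw => (h4 w).trans (h1 w hw), h2, h3⟩
  let σ (w : 𝔥) (x : M) : E →L[ℝ] ℝ := (LinearMap.toContinuousLinearMap (B.flip w)).comp (s x)
  have hσ (w : 𝔥) : SmoothForm I (toForm (σ w)) :=
    h.smooth_splitting.bilin_const B w fun _ _ => rfl
  have hmem {w : 𝔥} (hw : w ∈ V) (x : M) : ((ρ x w, σ w x) : GenTangent I x) ∈ L x :=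
    (hL x _ _).mpr ⟨w, hw, rfl, fun _ => rfl⟩
  -- Pairings of the generator with fixed vectors are smooth expressions in the section, so the
  -- generator is a smooth function with values in `V`.
  have hgen {X : M → E} {α : M → E →L[ℝ] ℝ} (hX : SmoothField I X) (hα : SmoothForm I (toForm α))
      (hXα : ∀ x, ((X x, α x) : GenTangent I x) ∈ L x) :
      ∃ u : M → 𝔥, ContMDiff I 𝓘(ℝ, 𝔥) ∞ u ∧ (∀ x, u x ∈ V) ∧ (∀ x, X x = ρ x (u x)) ∧
        ∀ x Y, α x Y = B (s x Y) (u x) := by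
    choose u h1 h2 h3 using fun x => h.exists_generator x (X x) (α x)
    refine ⟨u, contMDiff_of_bilin h.nondegenerate fun v => ?_, fun x => (hV _).mpr fun w hw =>
      (h3 x w).trans ((hperp x _ _).mp (hXα x) w hw), fun x => (h1 x).symm, h2⟩
    simp only [h3]
    have e1 := contMDiff_bilin B (h.smooth_splitting.contMDiff_toForm_apply hX)
      (contMDiff_const (c := v))
    exact e1.add (hα.contMDiff_toForm_apply (h.smooth_action v))
  refine ⟨h.smoothForm_twist, fun x => (dForm_eq_extD _ x).trans (h.extD_twist x), ?_, ?_, ?_⟩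
  · rintro x ⟨X, α⟩ he
    obtain ⟨u, hu, h1, h2⟩ := (hL x X α).mp he
    refine ⟨fun y => ρ y u, σ u, h.smooth_action u, hσ u, hmem hu, ?_⟩
    refine Prod.ext h1 ?_
    ext Y
    exact (h2 Y).symm
  · rintro x ⟨X, α⟩
    refine (hperp x X α).trans ⟨?_, fun h1 w hw => h1 _ (hmem hw x)⟩
    rintro h1 ⟨Y, β⟩ hf
    obtain ⟨w, hw, h2, h3⟩ := (hL x Y β).mp hf
    have h4 := h1 w hw
    rw [h2] at h4
    refine Eq.trans ?_ h4
    exact congrArg (· + α Y) (h3 X)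
  · intro X₁ α₁ X₂ α₂ hX₁ hα₁ hX₂ hα₂ hL₁ hL₂ x
    obtain ⟨u₁, hu₁, hV₁, hX₁u, hα₁u⟩ := hgen hX₁ hα₁ hL₁
    obtain ⟨u₂, hu₂, hV₂, hX₂u, hα₂u⟩ := hgen hX₂ hα₂ hL₂
    refine (hperp x _ _).mpr fun w hw => ?_
    have key := h.involutive hV hbr hu₁ hu₂ hV₁ hV₂ hX₁ hX₂ hα₁ hα₂ hX₁u hX₂u hα₁u hα₂u x hw
    have e1 : contract₂ I (dForm I (oneForm I α₂) x) (X₁ x) (ρ x w) =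
        extD I (toForm α₂) x ![X₁ x, ρ x w] :=
      (contract₂_apply I (dForm I (oneForm I α₂) x) (X₁ x) (ρ x w)).trans
        (congrArg (fun η : E [⋀^Fin 2]→L[ℝ] ℝ => η ![X₁ x, ρ x w]) (dForm_eq_extD (toForm α₂) x))
    have e2 : contract₂ I (dForm I (oneForm I α₁) x) (X₂ x) (ρ x w) =
        extD I (toForm α₁) x ![X₂ x, ρ x w] :=
      (contract₂_apply I (dForm I (oneForm I α₁) x) (X₂ x) (ρ x w)).trans
        (congrArg (fun η : E [⋀^Fin 2]→L[ℝ] ℝ => η ![X₂ x, ρ x w]) (dForm_eq_extD (toForm α₁) x))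
    have e3 := contract₃_apply I (twist (E := E) I br B s x) (X₁ x) (X₂ x) (ρ x w)
    have e : (lieDerivOneForm I X₁ α₂ x - contract₂ I (dForm I (oneForm I α₁) x) (X₂ x) +
        contract₃ I (twist (E := E) I br B s x) (X₁ x) (X₂ x) : E →L[ℝ] ℝ) (ρ x w) =
        extD I (toForm α₂) x ![X₁ x, ρ x w] +
          mder I 𝓘(ℝ, ℝ) (fun y => α₂ y (X₁ y)) x (ρ x w) - extD I (toForm α₁) x ![X₂ x, ρ x w] +
          twist I br B s x ![X₁ x, X₂ x, ρ x w] := by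
      exact congrArg₂ (· + ·) (congrArg₂ (· - ·) (congrArg₂ (· + ·) e1 rfl) e2) e3
    refine Eq.trans ?_ key
    rw [add_comm]
    exact congrArg (· + B (s x (lieB I X₁ X₂ x)) w) e

end IsSplitAction

/-! ### Vector fields on products and functions with vanishing derivative -/

section ProductFields

variable {E H M E' H' M' : Type*}
  [NormedAddCommGroup E] [NormedSpace ℝ E] [FiniteDimensional ℝ E] [TopologicalSpace H]
  {I : ModelWithCorners ℝ E H} [I.Boundaryless] [TopologicalSpace M] [ChartedSpace H M]
  [IsManifold I ∞ M]
  [NormedAddCommGroup E'] [NormedSpace ℝ E'] [FiniteDimensional ℝ E'] [TopologicalSpace H']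
  {I' : ModelWithCorners ℝ E' H'} [I'.Boundaryless] [TopologicalSpace M'] [ChartedSpace H' M']
  [IsManifold I' ∞ M']

theorem mder_fst (z : M × M') (X : E × E') : mder (I.prod I') I Prod.fst z X = X.1 :=
  congrArg (fun L : E × E' →L[ℝ] E => L X) (mfderiv_fst (I := I) (I' := I') (x := z))

theorem mder_snd (z : M × M') (X : E × E') : mder (I.prod I') I' Prod.snd z X = X.2 :=
  congrArg (fun L : E × E' →L[ℝ] E' => L X) (mfderiv_snd (I := I) (I' := I') (x := z))

theorem SmoothField.prod {X : M → E} {Y : M' → E'} (hX : SmoothField I X) (hY : SmoothField I' Y) :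
    SmoothField (I.prod I') fun z : M × M' => (X z.1, Y z.2) := by
  have h1 : ContMDiff (I.prod I') (I.tangent.prod I'.tangent) ∞ (fun z : M × M' =>
      ((⟨z.1, X z.1⟩, ⟨z.2, Y z.2⟩) : TangentBundle I M × TangentBundle I' M')) :=
    (ContMDiff.comp (g := fun x => (⟨x, X x⟩ : TangentBundle I M)) hX contMDiff_fst).prodMk
      (ContMDiff.comp (g := fun x => (⟨x, Y x⟩ : TangentBundle I' M')) hY contMDiff_snd)
  exact contMDiff_equivTangentBundleProd_symm.comp h1

theorem SmoothField.zero : SmoothField I fun _ : M => (0 : E) :=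
  Bundle.contMDiff_zeroSection ℝ (TangentSpace I : M → Type _)

theorem SmoothField.sub {X Y : M → E} (hX : SmoothField I X) (hY : SmoothField I Y) :
    SmoothField I fun x => X x - Y x := fun x =>
  ContMDiffAt.sub_section (hX x) (hY x)

/-- The velocity fields of a smooth family of maps are smooth. -/
theorem smoothField_of_family {F : M' × M → M} (hF : ContMDiff (I'.prod I) I ∞ F) (n : M')
    (hn : ∀ x, F (n, x) = x) (v : E') :
    SmoothField I fun x => mder I' I (fun m => F (m, x)) n v := by
  have h1 : ContMDiff I (I'.tangent.prod I.tangent) ∞ (fun x : M =>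
      ((⟨n, v⟩, ⟨x, (0 : E)⟩) : TangentBundle I' M' × TangentBundle I M)) :=
    contMDiff_const.prodMk (SmoothField.zero (I := I) (M := M))
  have h2 := (hF.contMDiff_tangentMap (m := ∞) (by simp)).comp
    (contMDiff_equivTangentBundleProd_symm.comp h1)
  refine h2.congr fun x => ?_
  refine Bundle.TotalSpace.ext (hn x).symm ?_
  refine heq_of_eq ?_
  change mder I' I (fun m => F (m, x)) n v = mder (I'.prod I) I F (n, x) ((v, 0) : E' × E)
  have h3 : MDifferentiableAt (I'.prod I) I F (n, x) := hF.mdifferentiableAt (by simp)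
  have h4 := mfderiv_prod_eq_add_apply h3 (v := ((v, 0) : E' × E))
  refine Eq.trans ?_ h4.symm
  have h5 : mder I I (fun y => F (n, y)) x 0 = 0 := map_zero _
  refine (add_zero _).symm.trans ?_
  exact congrArg (mder I' I (fun m => F (m, x)) n v + ·) h5.symm

/-- Product fields are related to their components by the two projections. -/
theorem lieB_prod {X₁ X₂ : M → E} {Y₁ Y₂ : M' → E'} (hX₁ : SmoothField I X₁)
    (hX₂ : SmoothField I X₂) (hY₁ : SmoothField I' Y₁) (hY₂ : SmoothField I' Y₂) (z : M × M') :
    lieB (I.prod I') (fun z => (X₁ z.1, Y₁ z.2)) (fun z => (X₂ z.1, Y₂ z.2)) z =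
      (lieB I X₁ X₂ z.1, lieB I' Y₁ Y₂ z.2) := by
  have h1 := lieB_related (I := I.prod I') (M := M × M') (I' := I) (contMDiff_fst (n := ∞))
    (hX₁.prod hY₁) (hX₂.prod hY₂) hX₁ hX₂ (fun z => mder_fst z _) (fun z => mder_fst z _) z
  have h2 := lieB_related (I := I.prod I') (M := M × M') (I' := I') (contMDiff_snd (n := ∞))
    (hX₁.prod hY₁) (hX₂.prod hY₂) hY₁ hY₂ (fun z => mder_snd z _) (fun z => mder_snd z _) z
  rw [mder_fst] at h1
  rw [mder_snd] at h2
  exact Prod.ext h1 h2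

theorem lieB_zero_left (Y : M → E) (x : M) : lieB I (fun _ => 0) Y x = 0 := by
  have h := VectorField.mlieBracket_zero_left (I := I) (W := Y)
  exact congrFun h x

theorem lieB_zero_right (Y : M → E) (x : M) : lieB I Y (fun _ => 0) x = 0 := by
  have h := VectorField.mlieBracket_zero_right (I := I) (W := Y)
  exact congrFun h x

theorem lieB_sub_left {X₁ X₂ Y : M → E} (h₁ : SmoothField I X₁) (h₂ : SmoothField I X₂)
    (x : M) :
    lieB I (fun x => X₁ x - X₂ x) Y x = lieB I X₁ Y x - lieB I X₂ Y x := by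
  have e : fieldRep I (fun x => X₁ x - X₂ x) x = fun y => fieldRep I X₁ x y - fieldRep I X₂ x y :=
    funext fun y => map_sub _ _ _
  rw [lieB_eq, lieB_eq, lieB_eq, e]
  simp only [VectorField.lieBracket, map_sub]
  rw [fderiv_fun_sub (h₁.differentiableAt_fieldRep x) (h₂.differentiableAt_fieldRep x),
    sub_apply]
  abel

theorem lieB_swap (X Y : M → E) (x : M) : lieB I X Y x = -lieB I Y X x :=
  VectorField.mlieBracket_swap_apply

/-- A function with vanishing derivative on a connected manifold is constant. -/
theorem eq_of_mder_eq_zero [ConnectedSpace M] {V : Type*} [NormedAddCommGroup V] [NormedSpace ℝ V]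
    {f : M → V} (hf : ContMDiff I 𝓘(ℝ, V) ∞ f) (h : ∀ x X, mder I 𝓘(ℝ, V) f x X = 0) (x y : M) :
    f x = f y := by
  have : IsLocallyConstant f := by
    refine (IsLocallyConstant.iff_eventually_eq f).mpr fun z => ?_
    obtain ⟨r, hr, hball⟩ := Metric.mem_nhds_iff.mp (extChartAt_target_mem_nhds (I := I) z)
    set g : E → V := fun y => f ((extChartAt I z).symm y)
    have hg : ContDiffOn ℝ ∞ g (extChartAt I z).target := contDiffOn_comp_chart_symm hf z
    have hg0 : ∀ y ∈ Metric.ball (extChartAt I z z) r, fderiv ℝ g y = 0 := by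
      intro y hy
      ext X
      rw [← mder_eq_fderiv, mder_comp_apply (I' := I) (g := f) (hf.mdifferentiableAt (by simp))
        (mdifferentiableAt_extChartAt_symm (hball hy)), h]
      rfl
    have h2 : (extChartAt I z) ⁻¹' Metric.ball (extChartAt I z z) r ∈ nhds z :=
      (continuousAt_extChartAt z).preimage_mem_nhds (Metric.ball_mem_nhds _ hr)
    filter_upwards [h2, extChartAt_source_mem_nhds (I := I) z] with w hw hw2
    have h3 := Metric.isOpen_ball.is_const_of_fderiv_eq_zero (𝕜 := ℝ) (f := g)
      (convex_ball (extChartAt I z z) r).isPreconnected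
      ((hg.mono hball).differentiableOn (by simp)) hg0 hw (Metric.mem_ball_self hr)
    simp only [g, extChartAt_to_inv, (extChartAt I z).left_inv hw2] at h3
    exact h3
  exact this.apply_eq_of_isPreconnected isPreconnected_univ (Set.mem_univ x) (Set.mem_univ y)

end ProductFields

/-! ### Invariant fields, Maurer-Cartan forms and the adjoint action -/

section Group

variable {E H D : Type*} [NormedAddCommGroup E] [NormedSpace ℝ E] [FiniteDimensional ℝ E]
  [TopologicalSpace H] (I : ModelWithCorners ℝ E H) [I.Boundaryless] [TopologicalSpace D]
  [ChartedSpace H D] [Group D]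

/-- Left-invariant vector fields, with values in the model space. -/
def lField (a : D) : E →L[ℝ] E := mder I I (fun x : D => a * x) 1

/-- Right-invariant vector fields, with values in the model space. -/
def rField (a : D) : E →L[ℝ] E := mder I I (fun x : D => x * a) 1

/-- The left Maurer-Cartan form, on the model space. -/
def lMC (a : D) : E →L[ℝ] E := mder I I (fun x : D => a⁻¹ * x) a

/-- The right Maurer-Cartan form, on the model space. -/
def rMC (a : D) : E →L[ℝ] E := mder I I (fun x : D => x * a⁻¹) a

/-- The adjoint action, on the model space. -/
def adj (a : D) : E →L[ℝ] E := mder I I (fun x : D => a * x * a⁻¹) 1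

variable (D) in
/-- The bracket of left-invariant vector fields, on the model space. -/
def lBr [LieGroup I ∞ D] : E →ₗ[ℝ] E →ₗ[ℝ] E :=
  show GroupLieAlgebra I D →ₗ[ℝ] GroupLieAlgebra I D →ₗ[ℝ] GroupLieAlgebra I D from
    (LieAlgebra.ad ℝ (GroupLieAlgebra I D) : GroupLieAlgebra I D →ₗ[ℝ] _)

variable {I} [LieGroup I ∞ D]

theorem mdiff_mul_left (a x : D) : MDifferentiableAt I I (fun x : D => a * x) x :=
  (contMDiff_mul_left (n := ∞)).mdifferentiableAt (by simp)

theorem mdiff_mul_right (a x : D) : MDifferentiableAt I I (fun x : D => x * a) x :=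
  (contMDiff_mul_right (n := ∞)).mdifferentiableAt (by simp)

theorem mdiff_inv (x : D) : MDifferentiableAt I I (fun x : D => x⁻¹) x :=
  (contMDiff_inv I ∞).mdifferentiableAt (by simp)

theorem mder_mul_left (a b : D) (u : E) :
    mder I I (fun x => a * x) b (lField I b u) = lField I (a * b) u := by
  have h := mder_comp_apply (I := I) (I' := I) (I'' := I) (g := fun x => a * x)
    (f := fun x => b * x) (x := 1) (mdiff_mul_left _ _) (mdiff_mul_left _ _) u
  simp only [mul_one, ← mul_assoc] at h
  exact h.symm

theorem mder_mul_right (a b : D) (u : E) :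
    mder I I (fun x => x * a) b (rField I b u) = rField I (b * a) u := by
  have h := mder_comp_apply (I := I) (I' := I) (I'' := I) (g := fun x => x * a)
    (f := fun x => x * b) (x := 1) (mdiff_mul_right _ _) (mdiff_mul_right _ _) u
  simp only [one_mul, mul_assoc] at h
  exact h.symm

theorem lField_one (u : E) : lField I (1 : D) u = u := by
  have h : lField I (1 : D) = ContinuousLinearMap.id ℝ E := by
    rw [lField]
    simp only [one_mul]
    exact mder_id _
  rw [h]
  rfl

theorem rField_one (u : E) : rField I (1 : D) u = u := by
  have h : rField I (1 : D) = ContinuousLinearMap.id ℝ E := by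
    rw [rField]
    simp only [mul_one]
    exact mder_id _
  rw [h]
  rfl

theorem lMC_lField (a : D) (u : E) : lMC I a (lField I a u) = u := by
  rw [lMC, mder_mul_left, inv_mul_cancel, lField_one]

theorem rMC_rField (a : D) (u : E) : rMC I a (rField I a u) = u := by
  rw [rMC, mder_mul_right, mul_inv_cancel, rField_one]

theorem rField_rMC (a : D) (X : E) : rField I a (rMC I a X) = X := by
  obtain ⟨u, rfl⟩ : ∃ u, rField I a u = X :=
    (LinearMap.injective_iff_surjective (f := (rField I a).toLinearMap)).mp
      (Function.LeftInverse.injective (g := rMC I a) (rMC_rField a)) X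
  rw [rMC_rField]

theorem rMC_lField (a : D) (u : E) : rMC I a (lField I a u) = adj I a u := by
  have h := mder_comp_apply (I := I) (I' := I) (I'' := I) (g := fun x => x * a⁻¹)
    (f := fun x => a * x) (x := 1) (mdiff_mul_right _ _) (mdiff_mul_left _ _) u
  simp only [mul_one] at h
  exact h.symm

theorem lField_eq (a : D) (u : E) : lField I a u = rField I a (adj I a u) := by
  rw [← rMC_lField, rField_rMC]

theorem adj_one (u : E) : adj I (1 : D) u = u := by
  rw [← rMC_lField, lField_one]
  have h := rMC_rField (I := I) (1 : D) u
  rwa [rField_one] at h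

theorem adj_mul (a b : D) (u : E) : adj I (a * b) u = adj I a (adj I b u) := by
  have hc (c : D) : MDifferentiableAt I I (fun x : D => c * x * c⁻¹) 1 :=
    MDifferentiableAt.comp (1 : D) (g := fun x => x * c⁻¹) (f := fun x => c * x)
      (mdiff_mul_right _ _) (mdiff_mul_left _ _)
  have h := mder_comp_apply (I := I) (I' := I) (I'' := I) (g := fun x => a * x * a⁻¹)
    (f := fun x => b * x * b⁻¹) (x := (1 : D)) (by simpa using hc a) (hc b) u
  simp only [mul_one, mul_inv_cancel] at h
  rw [adj, adj, adj, ← h]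
  congr 3
  funext x
  group

theorem adj_inv_adj (a : D) (u : E) : adj I a⁻¹ (adj I a u) = u := by
  rw [← adj_mul, inv_mul_cancel, adj_one]

theorem adj_adj_inv (a : D) (u : E) : adj I a (adj I a⁻¹ u) = u := by
  rw [← adj_mul, mul_inv_cancel, adj_one]

theorem rField_eq (a : D) (u : E) : rField I a u = lField I a (adj I a⁻¹ u) := by
  rw [lField_eq, adj_adj_inv]

theorem lMC_eq (a : D) (X : E) : lMC I a X = adj I a⁻¹ (rMC I a X) := by
  obtain ⟨u, rfl⟩ : ∃ u, rField I a u = X := ⟨_, rField_rMC a X⟩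
  rw [rMC_rField, rField_eq, lMC_lField]

/-- The derivative of the product of two maps. -/
theorem mder_mul {E' H' M : Type*} [NormedAddCommGroup E'] [NormedSpace ℝ E']
    [TopologicalSpace H'] {I' : ModelWithCorners ℝ E' H'} [TopologicalSpace M] [ChartedSpace H' M]
    {f g : M → D} {x : M} (hf : MDifferentiableAt I' I f x) (hg : MDifferentiableAt I' I g x)
    (X : E') : mder I' I (fun y => f y * g y) x X =
      mder I I (fun y => y * g x) (f x) (mder I' I f x X) +
        mder I I (fun y => f x * y) (g x) (mder I' I g x X) := by
  have hm : MDifferentiableAt (I.prod I) I (fun z : D × D => z.1 * z.2) (f x, g x) :=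
    (contMDiff_mul I ∞).mdifferentiableAt (by simp)
  have h1 := mder_comp_apply (I'' := I) (g := fun z : D × D => z.1 * z.2)
    (f := fun y => (f y, g y)) hm (hf.prodMk hg) X
  rw [h1]
  have h2 : mder I' (I.prod I) (fun y => (f y, g y)) x X =
      ((mder I' I f x X, mder I' I g x X) : E × E) :=
    congrArg (fun L : E' →L[ℝ] E × E => L X) (hf.mfderiv_prod hg)
  rw [h2]
  exact mfderiv_prod_eq_add_apply hm (v := ((mder I' I f x X, mder I' I g x X) : E × E))

/-- Obtained by differentiating `x * x⁻¹ = 1`. -/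
theorem mder_inv_rField (a : D) (u : E) :
    mder I I (fun x => x⁻¹) a (rField I a u) = -lField I a⁻¹ u := by
  have h := mder_mul (I := I) (I' := I) (f := fun x : D => x) (g := fun x => x⁻¹) (x := a)
    mdifferentiableAt_id (mdiff_inv a) (rField I a u)
  simp only [mul_inv_cancel] at h
  rw [mder_const, mder_id] at h
  change 0 = rMC I a (rField I a u) + _ at h
  rw [rMC_rField] at h
  have h3 : mder I I (fun y => a⁻¹ * y) 1 (mder I I (fun y => a * y) a⁻¹
      (mder I I (fun x => x⁻¹) a (rField I a u))) =
      mder I I (fun x => x⁻¹) a (rField I a u) := by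
    have h4 := mder_comp_apply (I := I) (I' := I) (I'' := I) (g := fun x => a⁻¹ * x)
      (f := fun x => a * x) (x := a⁻¹) (mdiff_mul_left _ _) (mdiff_mul_left _ _)
      (mder I I (fun x => x⁻¹) a (rField I a u))
    simp only [mul_inv_cancel, inv_mul_cancel_left, mder_id] at h4
    exact h4.symm
  rw [← h3, eq_neg_of_add_eq_zero_right h.symm, map_neg]
  rfl

theorem mder_inv_lField (a : D) (u : E) :
    mder I I (fun x => x⁻¹) a (lField I a u) = -rField I a⁻¹ u := by
  rw [lField_eq, mder_inv_rField, lField_eq, ← adj_mul, inv_mul_cancel, adj_one]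

theorem smoothField_lField (u : E) : SmoothField I fun a : D => lField I a u :=
  smoothField_of_family (F := fun z : D × D => z.2 * z.1) (contMDiff_snd.mul contMDiff_fst) 1
    (fun _ => mul_one _) u

theorem smoothField_rField (u : E) : SmoothField I fun a : D => rField I a u :=
  smoothField_of_family (F := fun z : D × D => z.1 * z.2) (contMDiff_fst.mul contMDiff_snd) 1
    (fun _ => one_mul _) u

theorem lieB_lField (u v : E) (a : D) :
    lieB I (fun a : D => lField I a u) (fun a : D => lField I a v) a =
      lField I a (lBr D I u v) :=
  (congrFun (mulInvariantVector_mlieBracket (I := I) (G := D) u v) a).symm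

/-- Inversion relates the left-invariant field of `-u` to the right-invariant field of `u`; the
resulting sign makes the right bracket the opposite of the left one. -/
theorem lieB_rField (u v : E) (a : D) :
    lieB I (fun a : D => rField I a u) (fun a : D => rField I a v) a =
      -rField I a (lBr D I u v) := by
  have h1 (w : E) (a : D) : mder I I (fun x => x⁻¹) a (lField I a (-w)) = rField I a⁻¹ w := by
    rw [map_neg, map_neg, mder_inv_lField, neg_neg]
  have h2 := lieB_related (contMDiff_inv I ∞ (G := D)) (smoothField_lField (-u))
    (smoothField_lField (-v)) (smoothField_rField u) (smoothField_rField v) (h1 u) (h1 v) a⁻¹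
  rw [lieB_lField, mder_inv_lField, inv_inv] at h2
  simp only [map_neg, LinearMap.neg_apply, neg_neg] at h2
  exact h2.symm

/-- Multiplication `D × D → D` relates `(u^r, 0)` and `(0, v^l)` to `u^r` and `v^l`, and fields on
different factors commute. -/
theorem lieB_rField_lField (u v : E) (a : D) :
    lieB I (fun a : D => rField I a u) (fun a : D => lField I a v) a = 0 := by
  have hz := SmoothField.zero (I := I) (M := D)
  have hm (z : D × D) (X Y : E) : mder (I.prod I) I (fun z : D × D => z.1 * z.2) z (X, Y) =
      mder I I (fun y => y * z.2) z.1 X + mder I I (fun y => z.1 * y) z.2 Y := by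
    have h := mder_mul (I := I) (I' := I.prod I) (f := fun z : D × D => z.1) (g := fun z => z.2)
      (x := z) mdifferentiableAt_fst mdifferentiableAt_snd ((X, Y) : E × E)
    have e1 := mder_fst (I := I) (I' := I) z (X, Y)
    have e2 := mder_snd (I := I) (I' := I) z (X, Y)
    change mder (I.prod I) I (fun z : D × D => z.1) z (X, Y) = X at e1
    change mder (I.prod I) I (fun z : D × D => z.2) z (X, Y) = Y at e2
    rw [e1, e2] at h
    exact h
  have h := lieB_related (I := I.prod I) (M := D × D) (I' := I)
    (f := fun z : D × D => z.1 * z.2) (contMDiff_mul I ∞)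
    ((smoothField_rField (I := I) (D := D) u).prod hz)
    (hz.prod (smoothField_lField (I := I) (D := D) v)) (smoothField_rField u)
    (smoothField_lField v) (fun z => by rw [hm, mder_mul_right, map_zero, add_zero])
    (fun z => by rw [hm, mder_mul_left, map_zero, zero_add]) (a, 1)
  rw [lieB_prod (smoothField_rField u) hz hz (smoothField_lField v), lieB_zero_left,
    lieB_zero_right] at h
  rw [hm, map_zero, map_zero, add_zero] at h
  simpa using h.symm

/-- In a chart the form is the pointwise inverse of the smooth operator `u ↦ u^r`, and operator
inversion is smooth at invertible operators. -/
theorem smoothForm_rMC : SmoothForm I (toForm (rMC I : D → E →L[ℝ] E)) := by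
  intro x
  let R : E → E →L[ℝ] E := fun y =>
    (mder I 𝓘(ℝ, E) (extChartAt I x) ((extChartAt I x).symm y)).comp
      (rField I ((extChartAt I x).symm y))
  let S : E → E →L[ℝ] E := fun y => (rMC I ((extChartAt I x).symm y)).comp
    (mder 𝓘(ℝ, E) I (extChartAt I x).symm y)
  have hR : ContDiffOn ℝ ∞ R (extChartAt I x).target :=
    contDiffOn_clm_apply.mpr fun u => (smoothField_rField u).contDiffOn_fieldRep x
  have hRS {y : E} (hy : y ∈ (extChartAt I x).target) : (R y).comp (S y) = .id ℝ E := by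
    ext v
    change mder I 𝓘(ℝ, E) (extChartAt I x) _ (rField I _ (rMC I _
      (mder 𝓘(ℝ, E) I (extChartAt I x).symm y v))) = v
    rw [rField_rMC, mder_chart_mder_symm hy]
  have hSR {y : E} (hy : y ∈ (extChartAt I x).target) : (S y).comp (R y) = .id ℝ E := by
    ext v
    change rMC I _ (mder 𝓘(ℝ, E) I (extChartAt I x).symm y
      (fieldRep I (fun a => rField I a v) x y)) = v
    rw [mder_symm_fieldRep _ hy, rMC_rField]
  have hS : ContDiffOn ℝ ∞ S (extChartAt I x).target := by
    intro y hy
    have h1 : ContDiffAt ℝ ∞ R y := hR.contDiffAt ((isOpen_extChartAt_target x).mem_nhds hy)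
    let e : E ≃L[ℝ] E := ContinuousLinearEquiv.equivOfInverse (R y) (S y)
      (fun v => congrArg (fun L => L v) (hSR hy)) (fun v => congrArg (fun L => L v) (hRS hy))
    have h2 : ContDiffAt ℝ ∞ ContinuousLinearMap.inverse (R y) :=
      ContinuousLinearMap.IsInvertible.contDiffAt_map_inverse ⟨e, rfl⟩
    refine ((h2.comp y h1).congr_of_eventuallyEq ?_).contDiffWithinAt
    filter_upwards [(isOpen_extChartAt_target x).mem_nhds hy] with z hz
    exact (ContinuousLinearMap.inverse_eq (hRS hz) (hSR hz)).symm
  exact contDiffOn_form_iff.mpr fun v => hS.clm_apply contDiffOn_const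

/-- The Maurer-Cartan equation, by Cartan's formula on right-invariant fields, where the form is
constant. The sign is plus because `lBr` is the left bracket. -/
theorem extD_rMC (x : D) (X Y : E) :
    extD I (toForm (rMC I : D → E →L[ℝ] E)) x ![X, Y] = lBr D I (rMC I x X) (rMC I x Y) := by
  have h := extD_toForm_apply (smoothForm_rMC (I := I) (D := D))
    (smoothField_rField (rMC I x X)) (smoothField_rField (rMC I x Y)) x
  simp only [rField_rMC, lieB_rField, map_neg, rMC_rField, mder_const] at h
  rw [h]
  simp

theorem contMDiff_adj (u : E) : ContMDiff I 𝓘(ℝ, E) ∞ fun a : D => adj I a u :=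
  (smoothForm_rMC.contMDiff_toForm_apply (smoothField_lField u)).congr fun a =>
    (rMC_lField a u).symm

/-- The Maurer-Cartan equation is evaluated on the commuting fields `w^r` and `u^l`: the form is
constant on the first and equals `Ad_a u` on the second. -/
theorem mder_adj (x : D) (w u : E) :
    mder I 𝓘(ℝ, E) (fun a : D => adj I a u) x (rField I x w) = lBr D I w (adj I x u) := by
  have h := extD_toForm_apply (smoothForm_rMC (I := I) (D := D))
    (smoothField_rField w) (smoothField_lField u) x
  rw [extD_rMC, lieB_rField_lField] at h
  simp only [rMC_rField, rMC_lField, mder_const, map_zero, sub_zero] at h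
  rw [h]
  simp

/-- Infinitesimally invariant forms are invariant under the adjoint action of a connected group. -/
theorem bilin_adj [ConnectedSpace D] {B : LinearMap.BilinForm ℝ E}
    (hB : ∀ x y z, B (lBr D I x y) z + B y (lBr D I x z) = 0) (a : D) (u v : E) :
    B (adj I a u) (adj I a v) = B u v := by
  have h := eq_of_mder_eq_zero (I := I)
    (contMDiff_bilin B (contMDiff_adj (I := I) (D := D) u) (contMDiff_adj v)) (fun x X => ?_) a 1
  · rwa [adj_one, adj_one] at h
  · rw [mder_bilin B (contMDiff_adj u) (contMDiff_adj v)]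
    obtain ⟨w, rfl⟩ : ∃ w, rField I x w = X := ⟨_, rField_rMC x X⟩
    rw [mder_adj, mder_adj, add_comm]
    exact hB _ _ _

end Group

/-! ### Local sections of submersions and curves with given velocity -/

section Submersion

variable {E H M E' H' N : Type*}
  [NormedAddCommGroup E] [NormedSpace ℝ E] [TopologicalSpace H]
  {I : ModelWithCorners ℝ E H} [I.Boundaryless] [TopologicalSpace M] [ChartedSpace H M]
  [NormedAddCommGroup E'] [NormedSpace ℝ E'] [TopologicalSpace H']
  {I' : ModelWithCorners ℝ E' H'} [I'.Boundaryless] [TopologicalSpace N] [ChartedSpace H' N]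

theorem contMDiff_of_isSubmersion {f : M → N} (hf : Manifold.IsSubmersion I I' ∞ f) :
    ContMDiff I I' ∞ f := by
  obtain ⟨F, _, _, hF⟩ := hf
  exact hF.contMDiff

/-- Submersions have smooth local sections. -/
theorem exists_local_section {f : M → N} (hf : Manifold.IsSubmersion I I' ∞ f) (x : M) :
    ∃ σ : N → M, σ (f x) = x ∧ ∀ᶠ y in nhds (f x), ContMDiffAt I' I ∞ σ y ∧ f (σ y) = y := by
  obtain ⟨F, _, _, hF⟩ := hf
  have h := hF x
  set e := h.equiv
  have hx := h.mem_domChart_source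
  set z := h.domChart.extend I x
  have hz : z ∈ (h.domChart.extend I).target :=
    (h.domChart.extend I).map_source (by rwa [h.domChart.extend_source])
  have hzx : (h.domChart.extend I).symm z = x :=
    (h.domChart.extend I).left_inv (by rwa [h.domChart.extend_source])
  have hfx : h.codChart.extend I' (f x) = (e z).1 := by
    have h1 := h.writtenInCharts hz
    simp only [Function.comp_apply, hzx] at h1
    exact h1
  let g : N → E := fun y => e.symm (h.codChart.extend I' y, (e z).2)
  have hgz : g (f x) = z := by
    simp only [g, hfx]
    exact e.symm_apply_apply z
  have hg {y : N} (hy : y ∈ h.codChart.source) : ContMDiffAt I' 𝓘(ℝ, E) ∞ g y := by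
    have h1 : ContMDiffAt I' 𝓘(ℝ, E') ∞ (h.codChart.extend I') y :=
      h.codChart.contMDiffAt_extend h.codChart_mem_maximalAtlas hy
    have h2 : ContDiff ℝ ∞ fun w : E' => e.symm (w, (e z).2) :=
      e.symm.contDiff.comp (contDiff_id.prodMk contDiff_const)
    exact h2.contMDiff.contMDiffAt.comp y h1
  have htarget {w : E} (hw : w ∈ (h.domChart.extend I).target) :
      (h.domChart.extend I).target ∈ nhds w :=
    (h.domChart.isOpen_extend_target).mem_nhds hw
  have hsymm {w : E} (hw : w ∈ (h.domChart.extend I).target) :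
      ContMDiffAt 𝓘(ℝ, E) I ∞ (h.domChart.extend I).symm w := by
    have h1 := contMDiffOn_extend_symm h.domChart_mem_maximalAtlas
    refine h1.contMDiffAt ?_
    rw [← h.domChart.extend_target']
    exact htarget hw
  refine ⟨fun y => (h.domChart.extend I).symm (g y), ?_, ?_⟩
  · simp only [hgz, hzx]
  · have h0 := htarget hz
    rw [← hgz] at h0
    have h1 : ∀ᶠ y in nhds (f x), y ∈ h.codChart.source :=
      h.codChart.open_source.mem_nhds h.mem_codChart_source
    filter_upwards [(hg h.mem_codChart_source).continuousAt.eventually_mem h0, h1] with y hy1 hy2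
    refine ⟨(hsymm hy1).comp y (hg hy2), ?_⟩
    have h2 := h.writtenInCharts hy1
    have h3 : (e (g y)).1 = h.codChart.extend I' y := by simp only [g, e.apply_symm_apply]
    have h4 : (h.domChart.extend I).symm (g y) ∈ h.domChart.source := by
      have := (h.domChart.extend I).map_target hy1
      rwa [h.domChart.extend_source] at this
    refine (h.codChart.extend I').injOn ?_ ?_ (h2.trans h3)
    · rw [h.codChart.extend_source]
      exact h.source_subset_preimage_source h4
    · rwa [h.codChart.extend_source]

/-- Locally the field is the image under the tangent map of `Y` along a smooth section of `f`. -/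
theorem SmoothField.of_isSubmersion [IsManifold I ∞ M] [IsManifold I' ∞ N] {f : M → N}
    (hf : Manifold.IsSubmersion I I' ∞ f) (hsurj : Function.Surjective f) {Y : M → E} {X : N → E'}
    (hY : SmoothField I Y) (hXY : ∀ a, mder I I' f a (Y a) = X (f a)) : SmoothField I' X := by
  intro y
  obtain ⟨x, rfl⟩ := hsurj y
  obtain ⟨σ, h2, h3⟩ := exists_local_section hf x
  have h1 := h3.self_of_nhds.1
  have h4 : ContMDiff I.tangent I'.tangent ∞ (tangentMap I I' f) :=
    (contMDiff_of_isSubmersion hf).contMDiff_tangentMap (m := ∞) (by simp)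
  have h5 : ContMDiffAt I' I.tangent ∞ (fun y => (⟨σ y, Y (σ y)⟩ : TangentBundle I M)) (f x) :=
    ContMDiffAt.comp (g := fun x => (⟨x, Y x⟩ : TangentBundle I M)) (f x) (hY _) h1
  refine ((h4.contMDiffAt).comp (f x) h5).congr_of_eventuallyEq ?_
  filter_upwards [h3] with y hy0
  have hy := hy0.2
  refine Bundle.TotalSpace.ext hy.symm (heq_of_eq ?_)
  exact (congrArg X hy).symm.trans (hXY (σ y)).symm

/-- Smooth curves with a given velocity, defined for all times. -/
theorem exists_curve [IsManifold I ∞ M] [FiniteDimensional ℝ E] (x : M) (X : E) {U : Set M}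
    (hU : U ∈ nhds x) : ∃ c : ℝ → M, ContMDiff 𝓘(ℝ, ℝ) I ∞ c ∧ c 0 = x ∧
      mder 𝓘(ℝ, ℝ) I c 0 1 = X ∧ ∀ t, c t ∈ U := by
  have hV : (extChartAt I x).target ∩ (extChartAt I x).symm ⁻¹' U ∈ nhds (extChartAt I x x) :=
    Filter.inter_mem (extChartAt_target_mem_nhds x)
      ((continuousAt_extChartAt_symm x).preimage_mem_nhds (by rwa [extChartAt_to_inv]))
  obtain ⟨r, hr, hball⟩ := Metric.mem_nhds_iff.mp hV
  -- The function `ε sin (t / ε)` has derivative `1` at `0` and is bounded by `ε`. With this `ε` the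
  -- curve stays within distance `r / 2` of the centre for all times.
  set ε : ℝ := r / (2 * (‖X‖ + 1)) with hε
  have hX : 0 < ‖X‖ + 1 := by positivity
  have hε0 : 0 < ε := by positivity
  let k : ℝ → E := fun t => extChartAt I x x + (ε * Real.sin (ε⁻¹ * t)) • X
  have hk (t : ℝ) : k t ∈ Metric.ball (extChartAt I x x) r := by
    rw [Metric.mem_ball, dist_eq_norm]
    simp only [k, add_sub_cancel_left, norm_smul, norm_mul, Real.norm_eq_abs, abs_of_pos hε0]
    have h1 : ε * |Real.sin (ε⁻¹ * t)| * ‖X‖ ≤ ε * 1 * (‖X‖ + 1) := by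
      gcongr
      · exact Real.abs_sin_le_one _
      · linarith
    have h2 : ε * 1 * (‖X‖ + 1) = r / 2 := by
      rw [hε]; field_simp
    linarith
  have hks : ContDiff ℝ ∞ k := by
    have h1 : ContDiff ℝ ∞ fun t => ε * Real.sin (ε⁻¹ * t) :=
      contDiff_const.mul (Real.contDiff_sin.comp (contDiff_const.mul contDiff_id))
    exact contDiff_const.add (h1.smul contDiff_const)
  have hk0 : k 0 = extChartAt I x x := by simp [k]
  have hkd : HasFDerivAt k (ContinuousLinearMap.toSpanSingleton ℝ X) 0 := by
    have h1 : HasDerivAt (fun t => ε * Real.sin (ε⁻¹ * t)) 1 0 := by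
      have h2 := (((hasDerivAt_id (0 : ℝ)).const_mul ε⁻¹).sin).const_mul ε
      refine h2.congr_deriv ?_
      simp [hε0.ne']
    have h3 := (h1.smul_const X).const_add (extChartAt I x x)
    rw [one_smul] at h3
    exact h3.hasFDerivAt
  refine ⟨fun t => (extChartAt I x).symm (k t), ?_, ?_, ?_, fun t => (hball (hk t)).2⟩
  · exact (contMDiffOn_extChartAt_symm x).comp_contMDiff hks.contMDiff fun t => (hball (hk t)).1
  · simp only [hk0, extChartAt_to_inv]
  · have h1 := mdifferentiableAt_extChartAt_symm (I := I) (mem_extChartAt_target (I := I) x)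
    rw [← hk0] at h1
    rw [mder_comp_apply (I' := 𝓘(ℝ, E)) h1
      (hks.contMDiff.mdifferentiableAt (by simp)), hk0, mder_extChartAt_symm_self, mder_eq_fderiv,
      hkd.fderiv]
    simp

end Submersion

/-! ### Maximal isotropic subspaces in split signature -/

section Perp

variable {V : Type*} [AddCommGroup V] [Module ℝ V] [FiniteDimensional ℝ V]
  {B : LinearMap.BilinForm ℝ V}

theorem finrank_orthogonal_add (hsymm : ∀ x y, B x y = B y x)
    (hB : ∀ u, (∀ v, B u v = 0) → u = 0) (W : Submodule ℝ V) :
    Module.finrank ℝ (B.orthogonal W) + Module.finrank ℝ W = Module.finrank ℝ V := by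
  have h1 : B.Nondegenerate :=
    ⟨hB, fun u hu => hB u fun v => (hsymm u v).trans (hu v)⟩
  have h2 := LinearMap.BilinForm.finrank_orthogonal h1 W
  have h3 := Submodule.finrank_le W
  omega

/-- A subspace `P` of at least half the dimension that meets `W^⊥` trivially bounds `dim W^⊥` by
half the dimension, while `W ⊆ W^⊥` and the two dimensions add up to the full one. -/
theorem orthogonal_eq_self (hsymm : ∀ x y, B x y = B y x)
    (hB : ∀ u, (∀ v, B u v = 0) → u = 0) {W P : Submodule ℝ V}
    (hW : ∀ x ∈ W, ∀ y ∈ W, B x y = 0) (hP : Module.finrank ℝ V ≤ 2 * Module.finrank ℝ P)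
    (h : ∀ x ∈ P, x ∈ B.orthogonal W → x = 0) : B.orthogonal W = W := by
  have h1 := finrank_orthogonal_add hsymm hB W
  have h2 : W ≤ B.orthogonal W := fun x hx y hy => hW y hy x hx
  have h3 : Disjoint P (B.orthogonal W) := Submodule.disjoint_def.mpr h
  have h4 := Submodule.finrank_add_finrank_le_of_disjoint h3
  exact (Submodule.eq_of_le_of_finrank_le h2 (by omega)).symm

theorem eq_zero_of_mem_span_orthogonal {n : ℕ} {v : Fin n → V} {ε : ℝ} (hε : ε ≠ 0)
    (hv : ∀ i, B (v i) (v i) = ε) (ho : ∀ i j, i ≠ j → B (v i) (v j) = 0) {x : V}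
    (hx : x ∈ Submodule.span ℝ (Set.range v)) (h : ε * B x x ≤ 0) : x = 0 := by
  obtain ⟨c, rfl⟩ := (Submodule.mem_span_range_iff_exists_fun ℝ).mp hx
  have h1 : B (∑ i, c i • v i) (∑ i, c i • v i) = ε * ∑ i, c i ^ 2 := by
    simp only [map_sum, LinearMap.sum_apply, map_smul, LinearMap.smul_apply, smul_eq_mul]
    rw [Finset.mul_sum]
    refine Finset.sum_congr rfl fun i _ => ?_
    rw [Finset.sum_eq_single i (fun j _ hj => by rw [ho j i hj]; ring) (by simp), hv]
    ring
  rw [h1] at h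
  have h2 : 0 < ε * ε := mul_self_pos.mpr hε
  have h3 : ∑ i, c i ^ 2 = 0 := by
    have h4 : 0 ≤ ∑ i, c i ^ 2 := Finset.sum_nonneg fun i _ => sq_nonneg _
    nlinarith
  have h5 := (Finset.sum_eq_zero_iff_of_nonneg fun i _ => sq_nonneg (c i)).mp h3
  refine Finset.sum_eq_zero fun i hi => ?_
  rw [pow_eq_zero_iff (two_ne_zero) |>.mp (h5 i hi), zero_smul]

/-- Adjoining to `W` an isotropic vector orthogonal to it keeps the space isotropic. -/
theorem mem_of_maximal_isotropic (hsymm : ∀ x y, B x y = B y x) {W : Submodule ℝ V}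
    (hW : ∀ x ∈ W, ∀ y ∈ W, B x y = 0)
    (hmax : ∀ W' : Submodule ℝ V, (∀ x ∈ W', ∀ y ∈ W', B x y = 0) → W ≤ W' → W' = W) {x : V}
    (hx : x ∈ B.orthogonal W) (hxx : B x x = 0) : x ∈ W := by
  have hx' (w : V) (hw : w ∈ W) : B w x = 0 := hx w hw
  have h1 : W ⊔ Submodule.span ℝ {x} = W := by
    refine hmax _ (fun y hy z hz => ?_) le_sup_left
    obtain ⟨w, hw, _, ha, rfl⟩ := Submodule.mem_sup.mp hy
    obtain ⟨c, rfl⟩ := Submodule.mem_span_singleton.mp ha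
    obtain ⟨w', hw', _, ha', rfl⟩ := Submodule.mem_sup.mp hz
    obtain ⟨c', rfl⟩ := Submodule.mem_span_singleton.mp ha'
    simp [hW w hw w' hw', hx' w hw, hsymm x w', hx' w' hw', hxx]
  rw [← h1]
  exact Submodule.mem_sup_right (Submodule.mem_span_singleton_self x)

/-- A maximal isotropic subspace for a form of signature `(n, n)` is lagrangian. -/
theorem orthogonal_eq_of_maximal_isotropic (hsymm : ∀ x y, B x y = B y x)
    (hB : ∀ u, (∀ v, B u v = 0) → u = 0) {n : ℕ} (b : Module.Basis (Fin n ⊕ Fin n) ℝ V)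
    (hb1 : ∀ i, B (b (Sum.inl i)) (b (Sum.inl i)) = 1)
    (hb2 : ∀ i, B (b (Sum.inr i)) (b (Sum.inr i)) = -1)
    (hb3 : ∀ i j, i ≠ j → B (b i) (b j) = 0) {W : Submodule ℝ V}
    (hW : ∀ x ∈ W, ∀ y ∈ W, B x y = 0)
    (hmax : ∀ W' : Submodule ℝ V, (∀ x ∈ W', ∀ y ∈ W', B x y = 0) → W ≤ W' → W' = W) :
    B.orthogonal W = W := by
  have hdim : Module.finrank ℝ V = n + n := by
    rw [Module.finrank_eq_card_basis b]
    simp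
  have hrank (f : Fin n → Fin n ⊕ Fin n) (hf : Function.Injective f) :
      Module.finrank ℝ (Submodule.span ℝ (Set.range fun i => b (f i))) = n := by
    exact (finrank_span_eq_card (b.linearIndependent.comp f hf)).trans (Fintype.card_fin n)
  -- The form turns out to be semidefinite on `W^⊥`. In either case the maximal subspace of opposite
  -- definiteness, spanned by half of the basis, meets `W^⊥` trivially.
  by_cases hneg : ∀ y ∈ B.orthogonal W, 0 ≤ B y y
  · refine orthogonal_eq_self hsymm hB hW
      (P := Submodule.span ℝ (Set.range fun i => b (Sum.inr i)))
      (by rw [hrank _ Sum.inr_injective]; omega) fun x hx hxW => ?_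
    refine eq_zero_of_mem_span_orthogonal (ε := -1) (by norm_num) hb2
      (fun i j hij => hb3 _ _ fun h => hij (Sum.inr_injective h)) hx ?_
    linarith [hneg x hxW]
  · push Not at hneg
    obtain ⟨z, hz, hzz⟩ := hneg
    refine orthogonal_eq_self hsymm hB hW
      (P := Submodule.span ℝ (Set.range fun i => b (Sum.inl i)))
      (by rw [hrank _ Sum.inl_injective]; omega) fun y hy hyW => ?_
    refine eq_zero_of_mem_span_orthogonal (ε := 1) (by norm_num) hb1
      (fun i j hij => hb3 _ _ fun h => hij (Sum.inl_injective h)) hy ?_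
    rw [one_mul]
    by_contra! hyy
    -- If `W^⊥` contains vectors of both signs, the plane of `y` and `z` contains two distinct
    -- isotropic lines, both in `W` by maximality. The difference of their generators `y + t z` is a
    -- nonzero multiple of `z`, so `z ∈ W`, although `B z z < 0`.
    have hmem (t : ℝ) (ht : B y y + 2 * t * B y z + t ^ 2 * B z z = 0) : y + t • z ∈ W := by
      refine mem_of_maximal_isotropic hsymm hW hmax
        (Submodule.add_mem _ hyW (Submodule.smul_mem _ t hz)) ?_
      simp only [map_add, map_smul, LinearMap.add_apply, LinearMap.smul_apply, smul_eq_mul,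
        hsymm z y]
      linarith
    set Δ := Real.sqrt (B y z ^ 2 - B y y * B z z) with hΔ
    have h0 : 0 < B y z ^ 2 - B y y * B z z := by nlinarith [sq_nonneg (B y z)]
    have hΔ0 : 0 < Δ := Real.sqrt_pos.mpr h0
    have hΔ2 : Δ ^ 2 = B y z ^ 2 - B y y * B z z := Real.sq_sqrt h0.le
    have hz0 := hzz.ne
    have h1 := hmem ((-B y z + Δ) / B z z) (by field_simp; linear_combination hΔ2)
    have h2 := hmem ((-B y z - Δ) / B z z) (by field_simp; linear_combination hΔ2)
    have h3 := W.sub_mem h1 h2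
    rw [add_sub_add_left_eq_sub, ← sub_smul, ← sub_div] at h3
    have h4 : z ∈ W := by
      refine (W.smul_mem_iff ?_).mp h3
      rw [show -B y z + Δ - (-B y z - Δ) = 2 * Δ by ring]
      exact div_ne_zero (by positivity) hzz.ne
    exact hzz.ne (hW z h4 z h4)

end Perp

/-! ### The dressing action on the homogeneous space and its stabilizers -/

section Homogeneous

variable {E H D E' H' : Type*} [NormedAddCommGroup E] [NormedSpace ℝ E] [FiniteDimensional ℝ E]
  [TopologicalSpace H] {I : ModelWithCorners ℝ E H} [I.Boundaryless] [TopologicalSpace D]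
  [ChartedSpace H D] [Group D] [LieGroup I ∞ D]
  [NormedAddCommGroup E'] [NormedSpace ℝ E'] [FiniteDimensional ℝ E'] [TopologicalSpace H']
  {I' : ModelWithCorners ℝ E' H'} [I'.Boundaryless] {G : Subgroup D} [ChartedSpace H' (D ⧸ G)]
  [IsManifold I' ∞ (D ⧸ G)]

variable (I I' G) in
/-- The infinitesimal dressing action, on the model spaces. -/
def dress (x : D ⧸ G) : E →L[ℝ] E' := mder I I' (fun a : D => a • x) 1

theorem proj_surjective : Function.Surjective (proj G) := Quotient.mk_surjective

theorem dress_proj (hp : Manifold.IsSubmersion I I' ∞ (proj G)) (a : D) (u : E) :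
    dress I I' G (proj G a) u = mder I I' (proj G) a (rField I a u) := by
  have h1 : MDifferentiableAt I I' (proj G) (1 * a) :=
    (contMDiff_of_isSubmersion hp).mdifferentiableAt (by simp)
  have h2 := mder_comp_apply (f := fun x => x * a) (x := 1) h1 (mdiff_mul_right a 1) u
  rw [one_mul] at h2
  exact h2

theorem smoothField_dress (hp : Manifold.IsSubmersion I I' ∞ (proj G)) (u : E) :
    SmoothField I' fun x => dress I I' G x u :=
  SmoothField.of_isSubmersion hp proj_surjective (smoothField_rField u)
    fun a => (dress_proj hp a u).symm

theorem lieB_dress (hp : Manifold.IsSubmersion I I' ∞ (proj G)) (u v : E) (x : D ⧸ G) :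
    lieB I' (fun x => dress I I' G x u) (fun x => dress I I' G x v) x =
      -dress I I' G x (lBr D I u v) := by
  obtain ⟨a, rfl⟩ := proj_surjective x
  have h := lieB_related (contMDiff_of_isSubmersion hp) (smoothField_rField (I := I) u)
    (smoothField_rField v) (smoothField_dress hp u) (smoothField_dress hp v)
    (fun a => (dress_proj hp a u).symm) (fun a => (dress_proj hp a v).symm) a
  rw [← h, lieB_rField, map_neg, dress_proj hp]

/-- For a curve `c` through `a` with velocity `X` and a local section `σ`, the curve `σ(p(c))⁻¹ c`
lies in `G`. Its first factor has zero velocity because `dp X = 0`, so its own velocity is `θ^L X`.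
The curve must exist for all times and remain where `σ` is a section. -/
theorem lMC_mem_of_mder_proj_eq_zero (hp : Manifold.IsSubmersion I I' ∞ (proj G)) {𝔤 : Set E}
    (h𝔤 : IsLieAlgebraOf I G 𝔤) {a : D} {X : E} (hX : mder I I' (proj G) a X = 0) :
    lMC I a X ∈ 𝔤 := by
  have hps := contMDiff_of_isSubmersion hp
  obtain ⟨σ, hσa, hσp⟩ := exists_local_section hp a
  have hU : {b : D | ContMDiffAt I' I ∞ σ (proj G b) ∧ proj G (σ (proj G b)) = proj G b} ∈
      nhds a :=
    hps.continuous.continuousAt.preimage_mem_nhds hσp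
  obtain ⟨c, hc, hc0, hcX, hcU⟩ := exists_curve (I := I) a X hU
  have hcp : ContMDiff 𝓘(ℝ, ℝ) I' ∞ fun t => proj G (c t) := hps.comp hc
  have hσc : ContMDiff 𝓘(ℝ, ℝ) I ∞ fun t => σ (proj G (c t)) := fun t =>
    ContMDiffAt.comp t (hcU t).1 (hcp t)
  have hinv : ContMDiff 𝓘(ℝ, ℝ) I ∞ fun t => (σ (proj G (c t)))⁻¹ := hσc.inv
  refine (h𝔤 _).mpr ⟨fun t => (σ (proj G (c t)))⁻¹ * c t, hinv.mul hc, ?_, fun t => ?_, ?_⟩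
  · simp only [hc0, hσa, inv_mul_cancel]
  · exact QuotientGroup.eq.mp (hcU t).2
  · change mder 𝓘(ℝ, ℝ) I (fun t => (σ (proj G (c t)))⁻¹ * c t) 0 1 = _
    have hz : mder 𝓘(ℝ, ℝ) I (fun t => (σ (proj G (c t)))⁻¹) 0 1 = 0 := by
      have e1 := mder_comp_apply (I' := I') (I'' := I) (g := fun y => (σ y)⁻¹)
        (f := fun t => proj G (c t)) (x := (0 : ℝ))
        ((hcU 0).1.inv.mdifferentiableAt (by simp)) (hcp.mdifferentiableAt (by simp)) 1
      have e2 := mder_comp_apply (I' := I) (I'' := I') (g := proj G) (f := c) (x := (0 : ℝ))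
        (hps.mdifferentiableAt (by simp)) (hc.mdifferentiableAt (by simp)) 1
      rw [e1, e2, hcX, hc0, hX, map_zero]
    rw [mder_mul (hinv.mdifferentiableAt (by simp)) (hc.mdifferentiableAt (by simp)), hz, hcX,
      map_zero, zero_add, hc0, hσa]
    rfl

/-- The projection is constant along `a γ(t)` for a curve `γ` in `G`. -/
theorem mder_proj_lField (hp : Manifold.IsSubmersion I I' ∞ (proj G)) {𝔤 : Set E}
    (h𝔤 : IsLieAlgebraOf I G 𝔤) (a : D) {u : E} (hu : u ∈ 𝔤) :
    mder I I' (proj G) a (lField I a u) = 0 := by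
  have hps := contMDiff_of_isSubmersion hp
  obtain ⟨γ, hγ, hγ0, hγG, hγu⟩ := (h𝔤 u).mp hu
  have h1 : (fun t => proj G (a * γ t)) = fun _ => proj G a := by
    funext t
    refine QuotientGroup.eq.mpr ?_
    simpa using hγG t
  have e1 := mder_comp_apply (I' := I) (I'' := I) (g := fun x => a * x) (f := γ) (x := (0 : ℝ))
    (mdiff_mul_left _ _) (hγ.mdifferentiableAt (by simp)) 1
  have e2 := mder_comp_apply (I' := I) (I'' := I') (g := proj G) (f := fun t => a * γ t)
    (x := (0 : ℝ)) (hps.mdifferentiableAt (by simp))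
    ((contMDiff_const.mul hγ).mdifferentiableAt (by simp)) 1
  rw [h1, mder_const, e1, hγ0, mul_one] at e2
  have e3 : mder 𝓘(ℝ, ℝ) I γ 0 1 = u := hγu
  rw [e3] at e2
  exact e2.symm

/-- The stabilizer at `p(a)` is `Ad_a 𝔤`; with the invariance of the form, this is what makes all
stabilizers isotropic. -/
theorem dress_eq_zero_iff (hp : Manifold.IsSubmersion I I' ∞ (proj G)) {𝔤 : Set E}
    (h𝔤 : IsLieAlgebraOf I G 𝔤) (a : D) (u : E) :
    dress I I' G (proj G a) u = 0 ↔ adj I a⁻¹ u ∈ 𝔤 := by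
  rw [dress_proj hp]
  constructor
  · intro h
    have h1 := lMC_mem_of_mder_proj_eq_zero hp h𝔤 h
    rwa [lMC_eq, rMC_rField] at h1
  · intro h
    rw [rField_eq]
    exact mder_proj_lField hp h𝔤 a h

theorem lBr_skew (u v : E) : lBr D I u v = -lBr D I v u :=
  (lie_skew (L := GroupLieAlgebra I D) u v).symm

theorem lBr_jacobi (u v w : E) :
    lBr D I u (lBr D I v w) = lBr D I (lBr D I u v) w + lBr D I v (lBr D I u w) :=
  LieRing.leibniz_lie (L := GroupLieAlgebra I D) u v w

/-- The dressing action of a Manin pair, with an isotropic splitting. -/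
theorem isSplitAction_dress [ConnectedSpace D] (hp : Manifold.IsSubmersion I I' ∞ (proj G))
    {𝔤 : Submodule ℝ E} (h𝔤 : IsLieAlgebraOf I G (𝔤 : Set E)) {B : LinearMap.BilinForm ℝ E}
    (hsymm : ∀ u v, B u v = B v u) (hnondeg : ∀ u, (∀ v, B u v = 0) → u = 0)
    (hinv : ∀ x y z, B (lBr D I x y) z + B y (lBr D I x z) = 0)
    (hiso : ∀ x ∈ 𝔤, ∀ y ∈ 𝔤, B x y = 0) {s : D ⧸ G → E' →L[ℝ] E} (hs : SmoothForm I' (toForm s))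
    (hs1 : ∀ x X, dress I I' G x (s x X) = X) (hs2 : ∀ x X Y, B (s x X) (s x Y) = 0) :
    IsSplitAction I' (-lBr D I) B (dress I I' G) s where
  symm := hsymm
  nondegenerate := hnondeg
  invariant u v w := by
    have h := hinv u v w
    simp only [LinearMap.neg_apply, map_neg]
    linarith
  skew u v := by
    simp only [LinearMap.neg_apply, neg_neg]
    rw [lBr_skew, neg_neg]
  jacobi u v w := by
    simp only [LinearMap.neg_apply, map_neg, neg_neg]
    exact lBr_jacobi u v w
  smooth_splitting := hs
  smooth_action := smoothField_dress hp
  splitting := hs1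
  isotropic_splitting := hs2
  isotropic_ker x u v hu hv := by
    obtain ⟨a, rfl⟩ := proj_surjective x
    rw [dress_eq_zero_iff hp h𝔤] at hu hv
    rw [← bilin_adj hinv a⁻¹]
    exact hiso _ hu _ hv
  bracket u v x := by
    rw [lieB_dress hp, LinearMap.neg_apply, LinearMap.neg_apply, map_neg]

end Homogeneous

/-! ### Graphs of 2-forms as Dirac structures -/

section Graph

variable {E H M : Type*}
  [NormedAddCommGroup E] [NormedSpace ℝ E] [FiniteDimensional ℝ E] [TopologicalSpace H]
  {I : ModelWithCorners ℝ E H} [I.Boundaryless] [TopologicalSpace M] [ChartedSpace H M]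
  [IsManifold I ∞ M]

theorem mem_graph {η : M → E [⋀^Fin 2]→L[ℝ] ℝ} {x : M} {X : E} {α : E →L[ℝ] ℝ} :
    ((X, α) : GenTangent I x) ∈ graph I η x ↔ ∀ Y, α Y = η x ![X, Y] := Iff.rfl

/-- The graph of a 2-form `η` is a Dirac structure, twisted by `-dη`. -/
theorem isDirac_graph {η : M → E [⋀^Fin 2]→L[ℝ] ℝ} (hη : SmoothForm I η)
    (hframe : ∀ (x : M) (X : E), ∃ Y : M → E, SmoothField I Y ∧ Y x = X) :
    IsDirac I (graph I η) fun x => (-1 : ℝ) • extD I η x := by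
  have hdη := hη.extD
  have hcontract (X : M → E) : ∃ α : M → E →L[ℝ] ℝ, ∀ x Y, α x Y = η x ![X x, Y] :=
    ⟨fun x => contract₂ (E := E) (M := M) I (x := x) (η x) (X x),
      fun x Y => contract₂_apply (E := E) (M := M) I (x := x) (η x) (X x) Y⟩
  refine ⟨hdη.smul _, fun x => ?_, ?_, ?_, ?_⟩
  · refine (dForm_eq_extD _ x).trans ?_
    refine (extD_smul (-1) (extD I η) x).trans ?_
    rw [extD_extD hη]
    exact smul_zero (-1 : ℝ)
  · rintro x ⟨X, α⟩ he
    obtain ⟨Y, hY, rfl⟩ := hframe x X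
    obtain ⟨β, hβ⟩ := hcontract Y
    refine ⟨Y, β, hY, hη.contract hY hβ, hβ, Prod.ext rfl ?_⟩
    ext Z
    exact (hβ x Z).trans (he Z).symm
  -- Skew-symmetry makes the graph isotropic. Conversely, orthogonality to every `(Y, i_Y η)`
  -- determines the covector.
  · have key (x : M) (X : E) (α : E →L[ℝ] ℝ) : (∀ Y, α Y = η x ![X, Y]) ↔
        ∀ (Y : E) (β : E →L[ℝ] ℝ), (∀ Z, β Z = η x ![Y, Z]) → β X + α Y = 0 := by
      constructor
      · intro h Y β hβ
        rw [h Y, hβ X, form_swap₂, neg_add_cancel]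
      · intro h Y
        obtain ⟨β, hβ⟩ := hcontract fun _ => Y
        have h1 := h Y (β x) (hβ x)
        rw [hβ, form_swap₂] at h1
        linarith
    rintro x ⟨X, α⟩
    exact (key x X α).trans ⟨fun h f hf => h f.1 f.2 hf, fun h Y β hβ => h (Y, β) hβ⟩
  · intro (X : M → E) (α : M → E →L[ℝ] ℝ) (Y : M → E) (β : M → E →L[ℝ] ℝ) hX hα hY hβ hXα hYβ x
    refine mem_graph.mpr fun (Z₀ : E) => ?_
    -- The test vector is extended to a smooth field so that Cartan's formulas for `dα`, `dβ` and
    -- `dη` can be compared.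
    obtain ⟨Z, hZ, rfl⟩ := hframe x Z₀
    have hα' (x : M) (W : E) : α x W = η x ![X x, W] := hXα x W
    have hβ' (x : M) (W : E) : β x W = η x ![Y x, W] := hYβ x W
    have c1 : extD I (toForm β) x ![X x, Z x] = mder I 𝓘(ℝ, ℝ) (fun y => β y (Z y)) x (X x) -
        mder I 𝓘(ℝ, ℝ) (fun y => β y (X y)) x (Z x) - β x (lieB I X Z x) :=
      extD_toForm_apply hβ hX hZ x
    have c2 : extD I (toForm α) x ![Y x, Z x] = mder I 𝓘(ℝ, ℝ) (fun y => α y (Z y)) x (Y x) -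
        mder I 𝓘(ℝ, ℝ) (fun y => α y (Y y)) x (Z x) - α x (lieB I Y Z x) :=
      extD_toForm_apply hα hY hZ x
    have c3 := extD_two_apply hη hX hY hZ x
    have c4 : (fun y => β y (X y)) = fun y => (-1 : ℝ) • α y (Y y) := by
      funext y
      refine (hβ' y (X y)).trans ((form_swap₂ (η y) (X y) (Y y)).trans ?_)
      refine Eq.trans ?_ (congrArg ((-1 : ℝ) • ·) (hα' y (Y y)).symm)
      simp
    have hαY : ContMDiff I 𝓘(ℝ, ℝ) ∞ fun y => α y (Y y) :=
      SmoothForm.contMDiff_toForm_apply hα hY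
    have c5 : mder I 𝓘(ℝ, ℝ) (fun y => β y (X y)) x (Z x) =
        -mder I 𝓘(ℝ, ℝ) (fun y => α y (Y y)) x (Z x) := by
      rw [c4]
      have := mder_bilin (LinearMap.mul ℝ ℝ) (contMDiff_const (c := (-1 : ℝ))) hαY x (Z x)
      rw [mder_const] at this
      simpa using this
    have e1 : contract₂ I (dForm I (oneForm I β) x) (X x) (Z x) =
        extD I (toForm β) x ![X x, Z x] :=
      (contract₂_apply I (dForm I (oneForm I β) x) (X x) (Z x)).trans
        (congrArg (fun η : E [⋀^Fin 2]→L[ℝ] ℝ => η ![X x, Z x]) (dForm_eq_extD (toForm β) x))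
    have e2 : contract₂ I (dForm I (oneForm I α) x) (Y x) (Z x) =
        extD I (toForm α) x ![Y x, Z x] :=
      (contract₂_apply I (dForm I (oneForm I α) x) (Y x) (Z x)).trans
        (congrArg (fun η : E [⋀^Fin 2]→L[ℝ] ℝ => η ![Y x, Z x]) (dForm_eq_extD (toForm α) x))
    have e3 := contract₃_apply (E := E) (M := M) I (x := x) ((-1 : ℝ) • extD I η x) (X x) (Y x)
      (Z x)
    refine Eq.trans (b := extD I (toForm β) x ![X x, Z x] +
          mder I 𝓘(ℝ, ℝ) (fun y => β y (X y)) x (Z x) - extD I (toForm α) x ![Y x, Z x] +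
          (-1 : ℝ) * extD I η x ![X x, Y x, Z x]) ?_ ?_
    · exact congrArg₂ (· + ·) (congrArg₂ (· - ·) (congrArg₂ (· + ·) e1 rfl) e2) e3
    · change _ = η x ![lieB I X Y x, Z x]
      have f1 : (fun y => β y (Z y)) = fun y => η y ![Y y, Z y] := funext fun y => hβ' y (Z y)
      have f2 : (fun y => α y (Z y)) = fun y => η y ![X y, Z y] := funext fun y => hα' y (Z y)
      have f3 : (fun y => α y (Y y)) = fun y => η y ![X y, Y y] := funext fun y => hα' y (Y y)
      have f4 : β x (lieB I X Z x) = -η x ![lieB I X Z x, Y x] :=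
        (hβ' x _).trans (form_swap₂ (η x) _ _)
      have f5 : α x (lieB I Y Z x) = -η x ![lieB I Y Z x, X x] :=
        (hα' x _).trans (form_swap₂ (η x) _ _)
      rw [c1, c2, c3, f4, f5, c5, f1, f2, f3]
      ring

end Graph

/-! ### The 2-form on the group and its exterior derivative -/

section TwoForm

variable {E H D E' H' : Type*} [NormedAddCommGroup E] [NormedSpace ℝ E] [FiniteDimensional ℝ E]
  [TopologicalSpace H] {I : ModelWithCorners ℝ E H} [I.Boundaryless] [TopologicalSpace D]
  [ChartedSpace H D] [Group D] [LieGroup I ∞ D]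
  [NormedAddCommGroup E'] [NormedSpace ℝ E'] [FiniteDimensional ℝ E'] [TopologicalSpace H']
  {I' : ModelWithCorners ℝ E' H'} [I'.Boundaryless] {G : Subgroup D} [ChartedSpace H' (D ⧸ G)]
  [IsManifold I' ∞ (D ⧸ G)] {B : LinearMap.BilinForm ℝ E} {s : D ⧸ G → E' →L[ℝ] E}

/-- Conjugation by `a` relates the left-invariant field of `w` to that of `Ad_a w`. -/
theorem adj_lBr (a : D) (u v : E) : adj I a (lBr D I u v) = lBr D I (adj I a u) (adj I a v) := by
  have hc : ContMDiff I I ∞ fun x : D => a * x * a⁻¹ :=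
    (contMDiff_const.mul contMDiff_id).mul contMDiff_const
  have h1 (w : E) (x : D) : mder I I (fun x => a * x * a⁻¹) x (lField I x w) =
      lField I (a * x * a⁻¹) (adj I a w) := by
    have e := mder_comp_apply (I' := I) (I'' := I) (g := fun y : D => y * a⁻¹)
      (f := fun x : D => a * x) (x := x) (mdiff_mul_right _ _) (mdiff_mul_left _ _) (lField I x w)
    rw [e, mder_mul_left, lField_eq, mder_mul_right, lField_eq (a * x * a⁻¹), adj_mul, adj_mul,
      adj_mul, adj_inv_adj]
  have h2 := lieB_related hc (smoothField_lField u) (smoothField_lField v)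
    (smoothField_lField (adj I a u)) (smoothField_lField (adj I a v)) (h1 u) (h1 v) 1
  rw [lieB_lField, h1, lieB_lField] at h2
  have h3 := congrArg (lMC I (a * 1 * a⁻¹)) h2
  rwa [lMC_lField, lMC_lField] at h3

theorem rMC_mder_inv (a : D) (X : E) :
    rMC I a⁻¹ (mder I I (fun x => x⁻¹) a X) = -adj I a⁻¹ (rMC I a X) := by
  obtain ⟨u, rfl⟩ : ∃ u, rField I a u = X := ⟨_, rField_rMC a X⟩
  rw [mder_inv_rField, map_neg, rMC_lField, rMC_rField]

variable (I I' G s) in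
/-- The pull-back `p^* s`, on the model spaces. -/
def pullSplitting (a : D) : E →L[ℝ] E := (s (proj G a)).comp (mder I I' (proj G) a)

variable (I I' G s B) in
/-- The 2-form `½ ⟨θ^R, p^* s⟩`. -/
def halfForm (a : D) : E [⋀^Fin 2]→L[ℝ] ℝ :=
  (1 / 2 : ℝ) • wedge B (toForm (rMC I) a) (toForm (pullSplitting I I' G s) a)

variable (I I' G s B) in
/-- The 2-form `ω_D`, on the model spaces. -/
def omega (a : D) : E [⋀^Fin 2]→L[ℝ] ℝ :=
  halfForm I I' G B s a + formPull I I (fun x : D => x⁻¹) (halfForm I I' G B s) a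

theorem halfForm_apply (a : D) (X Y : E) : halfForm I I' G B s a ![X, Y] =
    (1 / 2) * (B (rMC I a X) (pullSplitting I I' G s a Y) -
      B (rMC I a Y) (pullSplitting I I' G s a X)) := by
  have h := wedge_one_one B (toForm (rMC I) a) (toForm (pullSplitting I I' G s) a) X Y
  exact congrArg ((1 / 2 : ℝ) * ·) h

theorem toForm_pullSplitting : toForm (pullSplitting I I' G s) =
    formPull I I' (proj G) (toForm s) :=
  (formPull_toForm _ _).symm

theorem smoothForm_pullSplitting (hp : Manifold.IsSubmersion I I' ∞ (proj G))
    (hs : SmoothForm I' (toForm s)) : SmoothForm I (toForm (pullSplitting I I' G s)) := by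
  rw [toForm_pullSplitting]
  exact hs.formPull (contMDiff_of_isSubmersion hp)

theorem smoothForm_halfForm (hp : Manifold.IsSubmersion I I' ∞ (proj G))
    (hs : SmoothForm I' (toForm s)) : SmoothForm I (halfForm I I' G B s) :=
  (smoothForm_rMC.wedge B (smoothForm_pullSplitting hp hs)).smul _

theorem smoothForm_omega (hp : Manifold.IsSubmersion I I' ∞ (proj G))
    (hs : SmoothForm I' (toForm s)) : SmoothForm I (omega I I' G B s) :=
  (smoothForm_halfForm hp hs).add ((smoothForm_halfForm hp hs).formPull (contMDiff_inv I ∞))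

theorem formPull_two_apply {η : D → E [⋀^Fin 2]→L[ℝ] ℝ} (f : D → D) (a : D) (X Y : E) :
    formPull I I f η a ![X, Y] = η (f a) ![mder I I f a X, mder I I f a Y] := by
  rw [formPull_apply]
  congr 1
  ext i
  fin_cases i <;> rfl

theorem formPull_three_apply {E' H' M' : Type*} [NormedAddCommGroup E'] [NormedSpace ℝ E']
    [FiniteDimensional ℝ E'] [TopologicalSpace H'] {I' : ModelWithCorners ℝ E' H'}
    [I'.Boundaryless] [TopologicalSpace M'] [ChartedSpace H' M'] [IsManifold I' ∞ M']
    {η : M' → E' [⋀^Fin 3]→L[ℝ] ℝ} (f : D → M') (a : D) (X Y Z : E) :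
    formPull I I' f η a ![X, Y, Z] =
      η (f a) ![mder I I' f a X, mder I I' f a Y, mder I I' f a Z] := by
  rw [formPull_apply]
  congr 1
  ext i
  fin_cases i <;> rfl

/-- The Leibniz rule gives `½⟨dθ^R, p^*s⟩ - ½⟨θ^R, p^*ds⟩`. Writing `θ^R = p^*s + k` with `k` in the
stabilizer, `ds` paired with `k` becomes a bracket term, and the triple product of three values of
`k` vanishes. What remains is the twist and the Cartan 3-form. -/
theorem extD_halfForm (hp : Manifold.IsSubmersion I I' ∞ (proj G))
    (h : IsSplitAction I' (-lBr D I) B (dress I I' G) s) (a : D) (X Y Z : E) :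
    extD I (halfForm I I' G B s) a ![X, Y, Z] =
      -formPull I I' (proj G) (IsSplitAction.twist I' (-lBr D I) B s) a ![X, Y, Z] +
        (1 / 2) * B (lBr D I (rMC I a X) (rMC I a Y)) (rMC I a Z) := by
  have hs := h.smooth_splitting
  have h0 : extD I (halfForm I I' G B s) a ![X, Y, Z] = (1 / 2) *
      extD I (fun a => wedge B (toForm (rMC I) a) (toForm (pullSplitting I I' G s) a)) a
        ![X, Y, Z] :=
    congrArg (fun η => η ![X, Y, Z]) (extD_smul (1 / 2) (fun a => wedge B (toForm (rMC I) a)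
      (toForm (pullSplitting I I' G s) a)) a)
  have hA (P Q : E) : extD I (toForm (pullSplitting I I' G s)) a ![P, Q] =
      extD I' (toForm s) (proj G a) ![mder I I' (proj G) a P, mder I I' (proj G) a Q] := by
    rw [toForm_pullSplitting, extD_formPull hs (contMDiff_of_isSubmersion hp), formPull_apply]
    congr 1
    ext i
    fin_cases i <;> rfl
  rw [h0, extD_wedge_one_one B smoothForm_rMC (smoothForm_pullSplitting hp hs),
    formPull_three_apply, h.twist_apply]
  simp only [extD_rMC, hA, toForm_apply, Matrix.cons_val_zero]
  simp only [pullSplitting, ContinuousLinearMap.comp_apply, LinearMap.neg_apply, map_neg]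
  have hk (P : E) : dress I I' G (proj G a) (rMC I a P - s (proj G a) (mder I I' (proj G) a P)) =
      0 := by
    rw [map_sub, h.splitting, dress_proj hp, rField_rMC, sub_self]
  set p₁ := mder I I' (proj G) a X
  set p₂ := mder I I' (proj G) a Y
  set p₃ := mder I I' (proj G) a Z
  set a₁ := s (proj G a) p₁
  set a₂ := s (proj G a) p₂
  set a₃ := s (proj G a) p₃
  set r₁ := rMC I a X
  set r₂ := rMC I a Y
  set r₃ := rMC I a Z
  have hk₁ : dress I I' G (proj G a) (r₁ - a₁) = 0 := hk X
  have hk₂ : dress I I' G (proj G a) (r₂ - a₂) = 0 := hk Y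
  have hk₃ : dress I I' G (proj G a) (r₃ - a₃) = 0 := hk Z
  -- Here `r_i - a_i` are the stabilizer components `k` of the three vectors.
  have k3 := h.curvature_apply (proj G a) p₁ p₂ hk₃
  have k2 := h.curvature_apply (proj G a) p₁ p₃ hk₂
  have k1 := h.curvature_apply (proj G a) p₂ p₃ hk₁
  have hb := h.isotropic_ker _ _ _ (h.ker_bracket hk₁ hk₂) hk₃
  have even (p q r : E) : B (lBr D I q r) p = B (lBr D I p q) r := by
    have := h.cyclic p q r
    simp only [LinearMap.neg_apply, map_neg] at this
    linarith
  have odd (p q r : E) : B (lBr D I p r) q = -B (lBr D I p q) r := by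
    have := h.invariant p r q
    simp only [LinearMap.neg_apply, map_neg] at this
    rw [h.symm r] at this
    linarith
  simp only [LinearMap.neg_apply, map_neg] at k1 k2 k3 hb
  rw [odd] at k2
  rw [even] at k1
  simp only [map_sub, LinearMap.sub_apply] at k1 k2 k3 hb
  rw [h.symm r₁, h.symm r₂, h.symm r₃]
  rw [odd r₁ a₂ r₃, even a₁ r₂ r₃]
  linarith

/-- The Cartan 3-form is Ad-invariant, and inversion acts on `θ^R` by `-Ad_{a⁻¹}`. Its contributions
from the two summands of `omega` therefore have opposite signs, leaving only the two twists. -/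
theorem extD_omega [ConnectedSpace D] (hp : Manifold.IsSubmersion I I' ∞ (proj G))
    (h : IsSplitAction I' (-lBr D I) B (dress I I' G) s) (a : D) (X Y Z : E) :
    extD I (omega I I' G B s) a ![X, Y, Z] =
      -(formPull I I' (proj G) (IsSplitAction.twist I' (-lBr D I) B s) a ![X, Y, Z] +
        formPull I I' (fun x : D => proj G x⁻¹) (IsSplitAction.twist I' (-lBr D I) B s) a
          ![X, Y, Z]) := by
  have hs := h.smooth_splitting
  have hinv (x y z : E) : B (lBr D I x y) z + B y (lBr D I x z) = 0 := by
    have := h.invariant x y z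
    simp only [LinearMap.neg_apply, map_neg] at this
    linarith
  have hH := smoothForm_halfForm (B := B) hp hs
  have e1 : extD I (omega I I' G B s) a = extD I (halfForm I I' G B s) a +
      formPull I I (fun x : D => x⁻¹) (extD I (halfForm I I' G B s)) a :=
    (extD_add hH (hH.formPull (contMDiff_inv I ∞)) a).trans
      (congrArg (extD I (halfForm I I' G B s) a + ·)
        (extD_formPull hH (contMDiff_inv I ∞) a))
  have e2 (P : E) : mder I I' (fun x : D => proj G x⁻¹) a P =
      mder I I' (proj G) a⁻¹ (mder I I (fun x : D => x⁻¹) a P) :=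
    mder_comp_apply (I' := I) (I'' := I') (g := proj G) (f := fun x : D => x⁻¹)
      ((contMDiff_of_isSubmersion hp).mdifferentiableAt (by simp)) (mdiff_inv a) P
  rw [e1, ContinuousAlternatingMap.add_apply, formPull_three_apply, extD_halfForm hp h,
    extD_halfForm hp h]
  simp only [formPull_three_apply, e2, rMC_mder_inv]
  have e3 : B (lBr D I (-adj I a⁻¹ (rMC I a X)) (-adj I a⁻¹ (rMC I a Y)))
      (-adj I a⁻¹ (rMC I a Z)) = -B (lBr D I (rMC I a X) (rMC I a Y)) (rMC I a Z) := by
    simp only [map_neg, LinearMap.neg_apply, neg_neg]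
    rw [← adj_lBr, bilin_adj hinv]
  rw [e3]
  ring

end TwoForm

/-! ### Rewriting the 2-form and the moment map identity -/

section Realization

variable {E H D E' H' : Type*} [NormedAddCommGroup E] [NormedSpace ℝ E] [FiniteDimensional ℝ E]
  [TopologicalSpace H] {I : ModelWithCorners ℝ E H} [I.Boundaryless] [TopologicalSpace D]
  [ChartedSpace H D] [Group D] [LieGroup I ∞ D]
  [NormedAddCommGroup E'] [NormedSpace ℝ E'] [FiniteDimensional ℝ E'] [TopologicalSpace H']
  {I' : ModelWithCorners ℝ E' H'} [I'.Boundaryless] {G : Subgroup D} [ChartedSpace H' (D ⧸ G)]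
  [IsManifold I' ∞ (D ⧸ G)] {B : LinearMap.BilinForm ℝ E} {s : D ⧸ G → E' →L[ℝ] E}

theorem bilin_adj_left [ConnectedSpace D]
    (hinv : ∀ x y z, B (lBr D I x y) z + B y (lBr D I x z) = 0) (a : D) (u v : E) :
    B (adj I a u) v = B u (adj I a⁻¹ v) := by
  rw [← bilin_adj hinv a⁻¹, adj_inv_adj]

/-- In `θ = θ^L - Ad_{a⁻¹} p^*s` the Maurer-Cartan part contributes `⟨θ^L, θ^L⟩` and, since
`Inv^*θ^L = -θ^R`, also `⟨θ^R, θ^R⟩`. Both vanish by symmetry of the form. Ad-invariance turns the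
remaining parts into `½⟨θ^R, p^*s⟩` and its pull-back by inversion. -/
theorem omegaD_eq_omega [ConnectedSpace D] (hsymm : ∀ u v, B u v = B v u)
    (hinv : ∀ x y z, B (lBr D I x y) z + B y (lBr D I x z) = 0) (a : D) :
    omegaD I I' G B s a = omega I I' G B s a := by
  have key (X Y : E) : omegaD I I' G B s a ![X, Y] = omega I I' G B s a ![X, Y] := by
    have hc (b : D) (Z : E) : connectionForm I I' G s b Z =
        lMC I b Z - adj I b⁻¹ (pullSplitting I I' G s b Z) := rfl
    have h1 : omegaD I I' G B s a ![X, Y] = (1 / 2 : ℝ) *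
        ((B (rMC I a X) (connectionForm I I' G s a⁻¹ (mder I I (fun c : D => c⁻¹) a Y)) -
          B (rMC I a Y) (connectionForm I I' G s a⁻¹ (mder I I (fun c : D => c⁻¹) a X))) -
        (B (lMC I a X) (connectionForm I I' G s a Y) -
          B (lMC I a Y) (connectionForm I I' G s a X))) :=
      congrArg ((1 / 2 : ℝ) * ·) (congrArg₂ (· - ·) (wedge_one_one B _ _ X Y)
        (wedge_one_one B _ _ X Y))
    have h2 : omega I I' G B s a ![X, Y] = halfForm I I' G B s a ![X, Y] +
        formPull I I (fun x : D => x⁻¹) (halfForm I I' G B s) a ![X, Y] := rfl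
    rw [h1, h2, formPull_two_apply, halfForm_apply, halfForm_apply, hc, hc, hc, hc]
    simp only [rMC_mder_inv, lMC_eq, inv_inv, map_sub, map_neg, LinearMap.neg_apply,
      bilin_adj_left hinv, adj_adj_inv]
    rw [hsymm (rMC I a X) (rMC I a Y)]
    ring
  ext v
  have hv : v = ![v 0, v 1] := by
    ext i
    fin_cases i <;> rfl
  rw [hv]
  exact key (v 0) (v 1)

variable (I I') in
theorem mder_proj_inv (hp : Manifold.IsSubmersion I I' ∞ (proj G)) (a : D) (w : E) :
    mder I I' (fun x : D => proj G x⁻¹) a (rField I a w) =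
      -dress I I' G (proj G a⁻¹) (adj I a⁻¹ w) := by
  have h1 : mder I I' (fun x : D => proj G x⁻¹) a (rField I a w) =
      mder I I' (proj G) a⁻¹ (mder I I (fun x : D => x⁻¹) a (rField I a w)) :=
    mder_comp_apply (I' := I) (I'' := I') (g := proj G) (f := fun x : D => x⁻¹)
      ((contMDiff_of_isSubmersion hp).mdifferentiableAt (by simp)) (mdiff_inv a) _
  rw [h1, mder_inv_rField, map_neg, lField_eq, dress_proj hp]

/-- The 2-form `ω_D` in terms of the projections `s ∘ ρ_S`. -/
theorem omega_rField [ConnectedSpace D] (hp : Manifold.IsSubmersion I I' ∞ (proj G))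
    (h : IsSplitAction I' (-lBr D I) B (dress I I' G) s)
    (hinv : ∀ x y z, B (lBr D I x y) z + B y (lBr D I x z) = 0) (a : D) (w w' : E) :
    omega I I' G B s a ![rField I a w, rField I a w'] =
      B w w' - B (s (proj G a) (dress I I' G (proj G a) w)) w' -
        B (s (proj G a⁻¹) (dress I I' G (proj G a⁻¹) (adj I a⁻¹ w))) (adj I a⁻¹ w') := by
  have h2 : omega I I' G B s a ![rField I a w, rField I a w'] =
      halfForm I I' G B s a ![rField I a w, rField I a w'] +
        formPull I I (fun x : D => x⁻¹) (halfForm I I' G B s) a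
          ![rField I a w, rField I a w'] := rfl
  have hA (w : E) : pullSplitting I I' G s a (rField I a w) =
      s (proj G a) (dress I I' G (proj G a) w) :=
    congrArg (s (proj G a)) (dress_proj hp a w).symm
  have hA' (w : E) : pullSplitting I I' G s a⁻¹ (lField I a⁻¹ w) =
      s (proj G a⁻¹) (dress I I' G (proj G a⁻¹) (adj I a⁻¹ w)) := by
    rw [lField_eq]
    exact congrArg (s (proj G a⁻¹)) (dress_proj hp a⁻¹ _).symm
  rw [h2, formPull_two_apply, halfForm_apply, halfForm_apply]
  simp only [mder_inv_rField, map_neg, rMC_rField, rMC_lField, LinearMap.neg_apply, neg_neg, hA,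
    hA']
  have p1 := h.projection_add_adjoint (proj G a) w w'
  have p2 := h.projection_add_adjoint (proj G a⁻¹) (adj I a⁻¹ w) (adj I a⁻¹ w')
  rw [bilin_adj hinv] at p2
  rw [h.symm w', h.symm (adj I a⁻¹ w')]
  linarith

/-- The moment map condition for the realization `(p, p ∘ Inv)`. -/
theorem moment_iff [ConnectedSpace D] (hp : Manifold.IsSubmersion I I' ∞ (proj G))
    (h : IsSplitAction I' (-lBr D I) B (dress I I' G) s)
    (hinv : ∀ x y z, B (lBr D I x y) z + B y (lBr D I x z) = 0) {a : D} {u v X : E}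
    (hu : mder I I' (proj G) a X = dress I I' G (proj G a) u)
    (hv : mder I I' (fun x : D => proj G x⁻¹) a X = dress I I' G (proj G a⁻¹) v) :
    (∀ Y, B (s (proj G a) (mder I I' (proj G) a Y)) u +
      B (s (proj G a⁻¹) (mder I I' (fun x : D => proj G x⁻¹) a Y)) v =
        omega I I' G B s a ![X, Y]) ↔ X = rField I a u - lField I a v := by
  obtain ⟨w, rfl⟩ : ∃ w, rField I a w = X := ⟨_, rField_rMC a X⟩
  rw [← dress_proj hp] at hu
  rw [mder_proj_inv I I' hp] at hv
  -- The defect of the moment condition is a single pairing. `P + Pᵀ = 1` at `p(a)` and `p(a⁻¹)`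
  -- converts the two pulled-back covectors, and the hypotheses replace `P u` by `P w` and `P v` by
  -- `-P (Ad_{a⁻¹} w)`, so all projections cancel.
  have key (w' : E) : B (s (proj G a) (mder I I' (proj G) a (rField I a w'))) u +
      B (s (proj G a⁻¹) (mder I I' (fun x : D => proj G x⁻¹) a (rField I a w'))) v -
        omega I I' G B s a ![rField I a w, rField I a w'] = B (u - adj I a v - w) w' := by
    rw [omega_rField hp h hinv, ← dress_proj hp, mder_proj_inv I I' hp]
    have p1 := h.projection_add_adjoint (proj G a) u w'
    have p2 := h.projection_add_adjoint (proj G a⁻¹) v (adj I a⁻¹ w')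
    rw [← hu, h.symm u] at p1
    rw [← hv, h.symm v (s _ _)] at p2
    simp only [map_neg, map_sub, LinearMap.neg_apply, LinearMap.sub_apply, bilin_adj_left hinv] at *
    linarith
  have hlast : u - adj I a v - w = 0 ↔ rField I a w = rField I a u - lField I a v := by
    rw [lField_eq, ← map_sub, sub_eq_zero]
    constructor
    · rintro rfl
      rfl
    · intro e
      have e' := congrArg (rMC I a) e
      rw [rMC_rField, rMC_rField] at e'
      exact e'.symm
  rw [← hlast]
  constructor
  · intro hY
    refine h.nondegenerate _ fun w' => ?_
    rw [← key, hY, sub_self]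
  · intro h0 Y
    have e := key (rMC I a Y)
    rw [h0, rField_rMC, map_zero, LinearMap.zero_apply] at e
    exact sub_eq_zero.mp e

end Realization

/-! ### Products of split actions -/

section ProductAction

variable {𝔥 𝔥' : Type*} [NormedAddCommGroup 𝔥] [NormedSpace ℝ 𝔥] [FiniteDimensional ℝ 𝔥]
  [NormedAddCommGroup 𝔥'] [NormedSpace ℝ 𝔥'] [FiniteDimensional ℝ 𝔥']

/-- The product of two brackets. -/
def prodBracket (br : 𝔥 →ₗ[ℝ] 𝔥 →ₗ[ℝ] 𝔥) (br' : 𝔥' →ₗ[ℝ] 𝔥' →ₗ[ℝ] 𝔥') :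
    𝔥 × 𝔥' →ₗ[ℝ] 𝔥 × 𝔥' →ₗ[ℝ] 𝔥 × 𝔥' :=
  LinearMap.mk₂ ℝ (fun p q => (br p.1 q.1, br' p.2 q.2)) (fun _ _ _ => by simp)
    (fun _ _ _ => by simp) (fun _ _ _ => by simp) (fun _ _ _ => by simp)

/-- The orthogonal direct sum of two bilinear forms. -/
def prodBilin (B : LinearMap.BilinForm ℝ 𝔥) (B' : LinearMap.BilinForm ℝ 𝔥') :
    LinearMap.BilinForm ℝ (𝔥 × 𝔥') :=
  LinearMap.mk₂ ℝ (fun p q => B p.1 q.1 + B' p.2 q.2) (fun _ _ _ => by simp; ring)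
    (fun _ _ _ => by simp; ring) (fun _ _ _ => by simp; ring) (fun _ _ _ => by simp; ring)

@[simp] theorem prodBracket_apply (br : 𝔥 →ₗ[ℝ] 𝔥 →ₗ[ℝ] 𝔥) (br' : 𝔥' →ₗ[ℝ] 𝔥' →ₗ[ℝ] 𝔥')
    (p q : 𝔥 × 𝔥') : prodBracket br br' p q = (br p.1 q.1, br' p.2 q.2) := rfl

@[simp] theorem prodBilin_apply (B : LinearMap.BilinForm ℝ 𝔥) (B' : LinearMap.BilinForm ℝ 𝔥')
    (p q : 𝔥 × 𝔥') : prodBilin B B' p q = B p.1 q.1 + B' p.2 q.2 := rfl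

variable {E H M E' H' M' : Type*}
  [NormedAddCommGroup E] [NormedSpace ℝ E] [FiniteDimensional ℝ E] [TopologicalSpace H]
  {I : ModelWithCorners ℝ E H} [I.Boundaryless] [TopologicalSpace M] [ChartedSpace H M]
  [IsManifold I ∞ M]
  [NormedAddCommGroup E'] [NormedSpace ℝ E'] [FiniteDimensional ℝ E'] [TopologicalSpace H']
  {I' : ModelWithCorners ℝ E' H'} [I'.Boundaryless] [TopologicalSpace M'] [ChartedSpace H' M']
  [IsManifold I' ∞ M']
  {br : 𝔥 →ₗ[ℝ] 𝔥 →ₗ[ℝ] 𝔥} {B : LinearMap.BilinForm ℝ 𝔥} {ρ : M → 𝔥 →L[ℝ] E}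
  {s : M → E →L[ℝ] 𝔥}
  {br' : 𝔥' →ₗ[ℝ] 𝔥' →ₗ[ℝ] 𝔥'} {B' : LinearMap.BilinForm ℝ 𝔥'} {ρ' : M' → 𝔥' →L[ℝ] E'}
  {s' : M' → E' →L[ℝ] 𝔥'}

variable (s s') in
/-- The product of two fields of linear maps. -/
def prodMaps (z : M × M') : E × E' →L[ℝ] 𝔥 × 𝔥' := (s z.1).prodMap (s' z.2)

theorem prodMaps_apply (z : M × M') (X : E × E') :
    prodMaps s s' z X = (s z.1 X.1, s' z.2 X.2) := rfl

/-- As a sum of pull-backs along the projections, the product splitting inherits smoothness and its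
differential from naturality. -/
theorem toForm_prodMaps : toForm (prodMaps s s') = fun z =>
    (ContinuousLinearMap.inl ℝ 𝔥 𝔥').compContinuousAlternatingMap
        (formPull (I.prod I') I Prod.fst (toForm s) z) +
      (ContinuousLinearMap.inr ℝ 𝔥 𝔥').compContinuousAlternatingMap
        (formPull (I.prod I') I' Prod.snd (toForm s') z) := by
  funext z
  ext v
  · change s z.1 (v 0).1 = s z.1 (mder (I.prod I') I Prod.fst z (v 0)) + 0
    rw [mder_fst, add_zero]
  · change s' z.2 (v 0).2 = 0 + s' z.2 (mder (I.prod I') I' Prod.snd z (v 0))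
    rw [mder_snd, zero_add]

theorem SmoothForm.prodMaps (hs : SmoothForm I (toForm s)) (hs' : SmoothForm I' (toForm s')) :
    SmoothForm (I.prod I') (toForm (DiracManin.prodMaps s s')) := by
  rw [toForm_prodMaps (I := I) (I' := I')]
  exact ((hs.formPull contMDiff_fst).clm_comp _).add ((hs'.formPull contMDiff_snd).clm_comp _)

theorem extD_prodMaps (hs : SmoothForm I (toForm s)) (hs' : SmoothForm I' (toForm s'))
    (z : M × M') (X Y : E × E') :
    extD (I.prod I') (toForm (prodMaps s s')) z ![X, Y] =
      (extD I (toForm s) z.1 ![X.1, Y.1], extD I' (toForm s') z.2 ![X.2, Y.2]) := by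
  have h1 := hs.formPull (I := I.prod I') (M := M × M') contMDiff_fst
  have h2 := hs'.formPull (I := I.prod I') (M := M × M') contMDiff_snd
  have e1 : formPull (I.prod I') I (Prod.fst : M × M' → M) (extD I (toForm s)) z ![X, Y] =
      extD I (toForm s) z.1 ![X.1, Y.1] := by
    rw [formPull_apply]
    congr 1
    ext i
    fin_cases i
    exacts [mder_fst z X, mder_fst z Y]
  have e2 : formPull (I.prod I') I' (Prod.snd : M × M' → M') (extD I' (toForm s')) z ![X, Y] =
      extD I' (toForm s') z.2 ![X.2, Y.2] := by
    rw [formPull_apply]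
    congr 1
    ext i
    fin_cases i
    exacts [mder_snd z X, mder_snd z Y]
  rw [toForm_prodMaps (I := I) (I' := I'), extD_add (h1.clm_comp _) (h2.clm_comp _),
    ContinuousAlternatingMap.add_apply, extD_clm_comp _ h1, extD_clm_comp _ h2,
    extD_formPull hs contMDiff_fst, extD_formPull hs' contMDiff_snd, e1, e2]
  simp

namespace IsSplitAction

theorem prod (h : IsSplitAction I br B ρ s) (h' : IsSplitAction I' br' B' ρ' s') :
    IsSplitAction (I.prod I') (prodBracket br br') (prodBilin B B') (prodMaps ρ ρ')
      (prodMaps s s') where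
  symm u v := by simp [h.symm u.1, h'.symm u.2]
  nondegenerate u hu := by
    refine Prod.ext (h.nondegenerate _ fun v => ?_) (h'.nondegenerate _ fun v => ?_)
    · simpa using hu (v, 0)
    · simpa using hu (0, v)
  invariant u v w := by
    have h1 := h.invariant u.1 v.1 w.1
    have h2 := h'.invariant u.2 v.2 w.2
    simp only [prodBilin_apply, prodBracket_apply]
    linarith
  skew u v := Prod.ext (h.skew u.1 v.1) (h'.skew u.2 v.2)
  jacobi u v w := Prod.ext (h.jacobi u.1 v.1 w.1) (h'.jacobi u.2 v.2 w.2)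
  smooth_splitting := h.smooth_splitting.prodMaps h'.smooth_splitting
  smooth_action u := (h.smooth_action u.1).prod (h'.smooth_action u.2)
  splitting z X := Prod.ext (h.splitting z.1 X.1) (h'.splitting z.2 X.2)
  isotropic_splitting z X Y := by
    simp [prodMaps_apply, h.isotropic_splitting, h'.isotropic_splitting]
  isotropic_ker z u v hu hv := by
    rw [prodBilin_apply, h.isotropic_ker z.1 u.1 v.1 (congrArg Prod.fst hu) (congrArg Prod.fst hv),
      h'.isotropic_ker z.2 u.2 v.2 (congrArg Prod.snd hu) (congrArg Prod.snd hv), add_zero]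
  bracket u v z := by
    refine (lieB_prod (h.smooth_action u.1) (h.smooth_action v.1) (h'.smooth_action u.2)
      (h'.smooth_action v.2) z).trans ?_
    rw [h.bracket, h'.bracket]
    rfl

theorem twist_prod (h : IsSplitAction I br B ρ s) (h' : IsSplitAction I' br' B' ρ' s')
    (z : M × M') :
    twist (I.prod I') (prodBracket br br') (prodBilin B B') (prodMaps s s') z =
      formPull (I.prod I') I Prod.fst (twist I br B s) z +
        formPull (I.prod I') I' Prod.snd (twist I' br' B' s') z := by
  have key (X Y Z : E × E') :
      twist (I.prod I') (prodBracket br br') (prodBilin B B') (prodMaps s s') z ![X, Y, Z] =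
        twist I br B s z.1 ![X.1, Y.1, Z.1] + twist I' br' B' s' z.2 ![X.2, Y.2, Z.2] := by
    rw [(h.prod h').twist_apply, h.twist_apply, h'.twist_apply]
    simp only [extD_prodMaps h.smooth_splitting h'.smooth_splitting, prodMaps_apply,
      prodBilin_apply, prodBracket_apply]
    ring
  ext v
  have hv : v = ![v 0, v 1, v 2] := by
    ext i : 1
    fin_cases i <;> rfl
  rw [ContinuousAlternatingMap.add_apply, formPull_apply, formPull_apply]
  conv_lhs => rw [hv]
  rw [key]
  congr 2
  · ext i
    fin_cases i
    exacts [(mder_fst z (v 0)).symm, (mder_fst z (v 1)).symm, (mder_fst z (v 2)).symm]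
  · ext i
    fin_cases i
    exacts [(mder_snd z (v 0)).symm, (mder_snd z (v 1)).symm, (mder_snd z (v 2)).symm]

end IsSplitAction

end ProductAction

/-! ### Products of families of generalized subspaces -/

section Products

variable {E H M E' H' M' : Type*}
  [NormedAddCommGroup E] [NormedSpace ℝ E] [FiniteDimensional ℝ E] [TopologicalSpace H]
  {I : ModelWithCorners ℝ E H} [I.Boundaryless] [TopologicalSpace M] [ChartedSpace H M]
  [IsManifold I ∞ M]
  [NormedAddCommGroup E'] [NormedSpace ℝ E'] [FiniteDimensional ℝ E'] [TopologicalSpace H']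
  {I' : ModelWithCorners ℝ E' H'} [I'.Boundaryless] [TopologicalSpace M'] [ChartedSpace H' M']
  [IsManifold I' ∞ M']

theorem prodCovector_apply (z : M × M') (β : E →L[ℝ] ℝ) (β' : E' →L[ℝ] ℝ) (W : E × E') :
    (prodCovector I I' z β β' : E × E' →L[ℝ] ℝ) W = β W.1 + β' W.2 :=
  congrArg₂ (· + ·) (congrArg β (mder_fst z W)) (congrArg β' (mder_snd z W))

theorem mem_prodFamily {L : Π x : M, Submodule ℝ (GenTangent I x)}
    {L' : Π y : M', Submodule ℝ (GenTangent I' y)} {z : M × M'} {X : E × E'}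
    {α : E × E' →L[ℝ] ℝ} : ((X, α) : GenTangent (I.prod I') z) ∈ prodFamily I I' L L' z ↔
      ∃ (β : E →L[ℝ] ℝ) (β' : E' →L[ℝ] ℝ), ((X.1, β) : GenTangent I z.1) ∈ L z.1 ∧
        ((X.2, β') : GenTangent I' z.2) ∈ L' z.2 ∧ ∀ W, α W = β W.1 + β' W.2 := by
  refine exists_congr fun (β : E →L[ℝ] ℝ) => exists_congr fun (β' : E' →L[ℝ] ℝ) =>
    and_congr ?_ (and_congr ?_ ?_)
  · exact Iff.of_eq (congrArg (fun Y : E => ((Y, β) : GenTangent I z.1) ∈ L z.1) (mder_fst z X))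
  · exact Iff.of_eq
      (congrArg (fun Y : E' => ((Y, β') : GenTangent I' z.2) ∈ L' z.2) (mder_snd z X))
  · constructor
    · intro e W
      exact (congrArg (fun γ : E × E' →L[ℝ] ℝ => γ W) e).trans (prodCovector_apply z β β' W)
    · intro e
      exact ContinuousLinearMap.ext fun W : E × E' => (e W).trans
        (prodCovector_apply z β β' W).symm

end Products

/-! ### The map to the product, its forward image and its twist -/

section Realization

variable {E H D E' H' : Type*} [NormedAddCommGroup E] [NormedSpace ℝ E] [FiniteDimensional ℝ E]
  [TopologicalSpace H] {I : ModelWithCorners ℝ E H} [I.Boundaryless] [TopologicalSpace D]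
  [ChartedSpace H D] [Group D] [LieGroup I ∞ D]
  [NormedAddCommGroup E'] [NormedSpace ℝ E'] [FiniteDimensional ℝ E'] [TopologicalSpace H']
  {I' : ModelWithCorners ℝ E' H'} [I'.Boundaryless] {G : Subgroup D} [ChartedSpace H' (D ⧸ G)]
  [IsManifold I' ∞ (D ⧸ G)] {B : LinearMap.BilinForm ℝ E} {s : D ⧸ G → E' →L[ℝ] E}
  {𝔤 : Submodule ℝ E}

theorem mem_diracS {x : D ⧸ G} {X : E'} {α : E' →L[ℝ] ℝ} :
    ((X, α) : GenTangent I' x) ∈ diracS I I' G B s 𝔤 x ↔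
      ∃ u ∈ 𝔤, dress I I' G x u = X ∧ ∀ Y, α Y = B (s x Y) u := by
  constructor
  · rintro ⟨u, hu, e⟩
    refine ⟨u, hu, congrArg Prod.fst e, fun Y => ?_⟩
    exact (congrArg (fun p : E' × (E' →L[ℝ] ℝ) => p.2 Y) e).symm
  · rintro ⟨u, hu, rfl, e⟩
    refine ⟨u, hu, Prod.ext rfl ?_⟩
    exact ContinuousLinearMap.ext fun Y : E' => (e Y).symm

theorem phiS_eq_twist (x : D ⧸ G) :
    phiS I I' G B s x = IsSplitAction.twist I' (-lBr D I) B s x := by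
  have h : dSplitting I I' G s x = extD I' (toForm s) x := by
    ext v
    exact congrArg (fun η : E' [⋀^Fin 2]→L[ℝ] E => η v) (dForm_eq_extD (toForm s) x)
  exact congrArg (fun η : E' [⋀^Fin 2]→L[ℝ] E => (1 / 2 : ℝ) • wedge B η (toForm s x) +
    (1 / 6 : ℝ) • wedge B (wedge (-lBr D I) (toForm s x) (toForm s x)) (toForm s x)) h

/-- The product `L_S × L_S` is again the family generated by a constant subspace, namely `𝔤 × 𝔤` for
the product split action, so the general theorem applies to it. -/
theorem mem_prodFamily_diracS {z : (D ⧸ G) × (D ⧸ G)} {X : E' × E'} {α : E' × E' →L[ℝ] ℝ} :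
    ((X, α) : GenTangent (I'.prod I') z) ∈
        prodFamily I' I' (diracS I I' G B s 𝔤) (diracS I I' G B s 𝔤) z ↔
      ∃ u ∈ 𝔤.prod 𝔤, prodMaps (dress I I' G) (dress I I' G) z u = X ∧
        ∀ Y, α Y = prodBilin B B (prodMaps s s z Y) u := by
  rw [mem_prodFamily]
  constructor
  · rintro ⟨β, β', hβ, hβ', e⟩
    obtain ⟨u, hu, hu1, hu2⟩ := mem_diracS.mp hβ
    obtain ⟨v, hv, hv1, hv2⟩ := mem_diracS.mp hβ'
    refine ⟨(u, v), ⟨hu, hv⟩, Prod.ext hu1 hv1, fun Y => ?_⟩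
    rw [e, hu2, hv2]
    rfl
  · rintro ⟨⟨u, v⟩, ⟨hu, hv⟩, e, h⟩
    refine ⟨sigma I I' G B s z.1 u, sigma I I' G B s z.2 v,
      mem_diracS.mpr ⟨u, hu, congrArg Prod.fst e, fun _ => rfl⟩,
      mem_diracS.mpr ⟨v, hv, congrArg Prod.snd e, fun _ => rfl⟩, h⟩

variable (G) in
/-- The map `(p, p ∘ Inv)`. -/
def projPair (a : D) : (D ⧸ G) × (D ⧸ G) := (proj G a, proj G a⁻¹)

theorem contMDiff_projPair (hp : Manifold.IsSubmersion I I' ∞ (proj G)) :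
    ContMDiff I (I'.prod I') ∞ (projPair G) :=
  (contMDiff_of_isSubmersion hp).prodMk ((contMDiff_of_isSubmersion hp).comp (contMDiff_inv I ∞))

theorem mder_projPair (hp : Manifold.IsSubmersion I I' ∞ (proj G)) (a : D) (X : E) :
    mder I (I'.prod I') (projPair G) a X =
      (mder I I' (proj G) a X, mder I I' (fun x : D => proj G x⁻¹) a X) := by
  have h1 := contMDiff_of_isSubmersion hp
  have h2 : ContMDiff I I' ∞ fun x : D => proj G x⁻¹ := h1.comp (contMDiff_inv I ∞)
  exact congrArg (fun L : E →L[ℝ] E' × E' => L X) (mfderiv_prodMk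
    (h1.mdifferentiableAt (x := a) (by simp)) (h2.mdifferentiableAt (x := a) (by simp)))

variable (I I') in
theorem dress_adj_inv_eq_zero (hp : Manifold.IsSubmersion I I' ∞ (proj G))
    (h𝔤 : IsLieAlgebraOf I G (𝔤 : Set E)) (a : D) (u : E) :
    dress I I' G (proj G a⁻¹) (adj I a⁻¹ u) = 0 ↔ u ∈ 𝔤 := by
  rw [dress_eq_zero_iff hp h𝔤, inv_inv, adj_adj_inv]
  rfl

/-- Each component of `u` contributes to only one factor: `p` kills `v^l` for `v ∈ 𝔤`, and `p ∘ Inv`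
kills `u^r` for `u ∈ 𝔤`. -/
theorem mder_projPair_field (hp : Manifold.IsSubmersion I I' ∞ (proj G))
    (h𝔤 : IsLieAlgebraOf I G (𝔤 : Set E)) (a : D) {u : E × E} (hu : u ∈ 𝔤.prod 𝔤) :
    mder I (I'.prod I') (projPair G) a (rField I a u.1 - lField I a u.2) =
      prodMaps (dress I I' G) (dress I I' G) (projPair G a) u := by
  rw [mder_projPair hp, map_sub, map_sub, mder_proj_lField hp h𝔤 a hu.2, lField_eq,
    mder_proj_inv I I' hp, mder_proj_inv I I' hp, adj_inv_adj,
    (dress_adj_inv_eq_zero I I' hp h𝔤 a u.1).mpr hu.1, ← dress_proj hp, sub_zero, neg_zero,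
    zero_sub, neg_neg]
  rfl

theorem moment_projPair_iff [ConnectedSpace D] (hp : Manifold.IsSubmersion I I' ∞ (proj G))
    (h : IsSplitAction I' (-lBr D I) B (dress I I' G) s)
    (hinv : ∀ x y z, B (lBr D I x y) z + B y (lBr D I x z) = 0) {a : D} {u : E × E} {X : E}
    (hX : mder I (I'.prod I') (projPair G) a X =
      prodMaps (dress I I' G) (dress I I' G) (projPair G a) u) :
    (∀ Y, prodBilin B B (prodMaps s s (projPair G a) (mder I (I'.prod I') (projPair G) a Y)) u =
      omega I I' G B s a ![X, Y]) ↔ X = rField I a u.1 - lField I a u.2 := by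
  rw [mder_projPair hp] at hX
  refine (forall_congr' fun Y => ?_).trans
    (moment_iff hp h hinv (u := u.1) (v := u.2) (congrArg Prod.fst hX) (congrArg Prod.snd hX))
  rw [mder_projPair hp]
  rfl

/-- From left to right the preimage is `u^r - v^l`. Conversely, `(dJ Z, α)` has some generator `(u,
v)` in `𝔡 × 𝔡`, and the moment identity forces `Z = u^r - v^l`. Comparing `dp Z` with `ρ_S u` and
`dp̄ Z` with `ρ_S v` gives `dp (v^l) = 0` and `dp̄ (u^r) = 0`, so `v` and `u` lie in `𝔤`. -/
theorem forward_projPair [ConnectedSpace D] (hp : Manifold.IsSubmersion I I' ∞ (proj G))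
    (h𝔤 : IsLieAlgebraOf I G (𝔤 : Set E)) (h : IsSplitAction I' (-lBr D I) B (dress I I' G) s)
    (hinv : ∀ x y z, B (lBr D I x y) z + B y (lBr D I x z) = 0) (a : D) (X : E' × E')
    (α : E' × E' →L[ℝ] ℝ) :
    (∃ u ∈ 𝔤.prod 𝔤, prodMaps (dress I I' G) (dress I I' G) (projPair G a) u = X ∧
        ∀ Y, α Y = prodBilin B B (prodMaps s s (projPair G a) Y) u) ↔
      ∃ Z : E, mder I (I'.prod I') (projPair G) a Z = X ∧
        ∀ Y, α (mder I (I'.prod I') (projPair G) a Y) = omega I I' G B s a ![Z, Y] := by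
  constructor
  · rintro ⟨u, hu, rfl, hα⟩
    have hd := mder_projPair_field hp h𝔤 a hu
    exact ⟨_, hd, fun Y => (hα _).trans ((moment_projPair_iff hp h hinv hd).mpr rfl Y)⟩
  · rintro ⟨Z, rfl, hZ⟩
    obtain ⟨u, hu, hα, -⟩ := (h.prod h).exists_generator (projPair G a)
      (mder I (I'.prod I') (projPair G) a Z) α
    have e : Z = rField I a u.1 - lField I a u.2 :=
      (moment_projPair_iff hp h hinv hu.symm).mp fun Y => (hα _).symm.trans (hZ Y)
    have h1 := hu.symm
    rw [mder_projPair hp, e, map_sub, map_sub, ← dress_proj hp] at h1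
    have h2 : mder I I' (proj G) a (lField I a u.2) = 0 := sub_eq_self.mp (congrArg Prod.fst h1)
    have h3 : mder I I' (fun x : D => proj G x⁻¹) a (rField I a u.1) -
        mder I I' (fun x : D => proj G x⁻¹) a (lField I a u.2) =
          dress I I' G (proj G a⁻¹) u.2 := congrArg Prod.snd h1
    rw [lField_eq, mder_proj_inv I I' hp, mder_proj_inv I I' hp, adj_inv_adj, sub_neg_eq_add,
      add_eq_right, neg_eq_zero, dress_adj_inv_eq_zero I I' hp h𝔤] at h3
    have h4 := lMC_mem_of_mder_proj_eq_zero hp h𝔤 h2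
    rw [lMC_lField] at h4
    exact ⟨u, ⟨h3, h4⟩, hu, hα⟩

theorem isDirac_prodFamily [ConnectedSpace D]
    (h : IsSplitAction I' (-lBr D I) B (dress I I' G) s)
    (hV : ∀ u, u ∈ 𝔤 ↔ ∀ v ∈ 𝔤, B u v = 0) (hbr : ∀ u ∈ 𝔤, ∀ v ∈ 𝔤, lBr D I u v ∈ 𝔤) :
    IsDirac (I'.prod I') (prodFamily I' I' (diracS I I' G B s 𝔤) (diracS I I' G B s 𝔤))
      (prodForm I' I' (phiS I I' G B s) (phiS I I' G B s)) := by
  have e : prodForm I' I' (phiS I I' G B s) (phiS I I' G B s) =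
      IsSplitAction.twist (I'.prod I') (prodBracket (-lBr D I) (-lBr D I)) (prodBilin B B)
        (prodMaps s s) := by
    funext z
    have h1 : phiS I I' G B s = IsSplitAction.twist I' (-lBr D I) B s := funext phiS_eq_twist
    rw [h.twist_prod h, h1]
    rfl
  rw [e]
  refine (h.prod h).isDirac (V := 𝔤.prod 𝔤) (fun u => ?_) ?_ fun z X α => mem_prodFamily_diracS
  · constructor
    · intro hu v hv
      rw [prodBilin_apply, (hV _).mp hu.1 _ hv.1, (hV _).mp hu.2 _ hv.2, add_zero]
    · intro hu
      refine ⟨(hV _).mpr fun v hv => ?_, (hV _).mpr fun v hv => ?_⟩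
      · simpa using hu (v, 0) ⟨hv, 𝔤.zero_mem⟩
      · simpa using hu (0, v) ⟨𝔤.zero_mem, hv⟩
  · intro u hu v hv
    exact ⟨𝔤.neg_mem (hbr _ hu.1 _ hv.1), 𝔤.neg_mem (hbr _ hu.2 _ hv.2)⟩

theorem pullbackForm_projPair [ConnectedSpace D] (hp : Manifold.IsSubmersion I I' ∞ (proj G))
    (h : IsSplitAction I' (-lBr D I) B (dress I I' G) s) (a : D) :
    (-1 : ℝ) • extD I (omega I I' G B s) a =
      pullbackForm I (I'.prod I') (projPair G)
        (prodForm I' I' (phiS I I' G B s) (phiS I I' G B s)) a := by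
  have h1 : phiS I I' G B s = IsSplitAction.twist I' (-lBr D I) B s := funext phiS_eq_twist
  have e1 (P : E) : mder (I'.prod I') I' Prod.fst (projPair G a)
      (mder I (I'.prod I') (projPair G) a P) = mder I I' (proj G) a P := by
    rw [mder_fst, mder_projPair hp]
  have e2 (P : E) : mder (I'.prod I') I' Prod.snd (projPair G a)
      (mder I (I'.prod I') (projPair G) a P) = mder I I' (fun x : D => proj G x⁻¹) a P := by
    rw [mder_snd, mder_projPair hp]
  have key (v : Fin 3 → E) : (-1 : ℝ) • extD I (omega I I' G B s) a v =
      formPull I I' (proj G) (IsSplitAction.twist I' (-lBr D I) B s) a v +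
        formPull I I' (fun x : D => proj G x⁻¹) (IsSplitAction.twist I' (-lBr D I) B s) a v := by
    have hv : v = ![v 0, v 1, v 2] := by
      ext i : 1
      fin_cases i <;> rfl
    rw [hv, extD_omega hp h]
    simp
  rw [h1]
  ext v
  refine (key v).trans ?_
  exact congrArg₂ (· + ·)
    (congrArg (IsSplitAction.twist I' (-lBr D I) B s (proj G a)) (funext fun i => (e1 (v i)).symm))
    (congrArg (IsSplitAction.twist I' (-lBr D I) B s (proj G a⁻¹))
      (funext fun i => (e2 (v i)).symm))

/-- Left and right fields commute, and the minus sign before `v^l` reverses the left bracket, so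
both factors carry the bracket of right-invariant fields. -/
theorem lieB_rField_sub_lField (u₁ u₂ v₁ v₂ : E) (a : D) :
    lieB I (fun a : D => rField I a u₁ - lField I a v₁) (fun a => rField I a u₂ - lField I a v₂) a =
      rField I a (-lBr D I u₁ u₂) - lField I a (-lBr D I v₁ v₂) := by
  have hr (u : E) := smoothField_rField (I := I) (D := D) u
  have hl (u : E) := smoothField_lField (I := I) (D := D) u
  rw [lieB_sub_left (hr u₁) (hl v₁), lieB_swap (fun a => rField I a u₁),
    lieB_swap (fun a => lField I a v₁), lieB_sub_left (hr u₂) (hl v₂),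
    lieB_sub_left (hr u₂) (hl v₂), lieB_swap (fun a => lField I a v₂) (fun a => rField I a u₁),
    lieB_rField, lieB_rField_lField, lieB_rField_lField, lieB_lField, lBr_skew u₂ u₁,
    lBr_skew v₂ v₁]
  simp

end Realization

/-! ### The presymplectic realization and the induced action -/

section Realization

variable {E H D E' H' : Type*} [NormedAddCommGroup E] [NormedSpace ℝ E] [FiniteDimensional ℝ E]
  [TopologicalSpace H] {I : ModelWithCorners ℝ E H} [I.Boundaryless] [TopologicalSpace D]
  [ChartedSpace H D] [Group D] [LieGroup I ∞ D] [ConnectedSpace D]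
  [NormedAddCommGroup E'] [NormedSpace ℝ E'] [FiniteDimensional ℝ E'] [TopologicalSpace H']
  {I' : ModelWithCorners ℝ E' H'} [I'.Boundaryless] {G : Subgroup D} [ChartedSpace H' (D ⧸ G)]
  [IsManifold I' ∞ (D ⧸ G)] {B : LinearMap.BilinForm ℝ E} {s : D ⧸ G → E' →L[ℝ] E}
  {𝔤 : Submodule ℝ E}

theorem isPresymplecticRealization_projPair (hp : Manifold.IsSubmersion I I' ∞ (proj G))
    (h𝔤 : IsLieAlgebraOf I G (𝔤 : Set E)) (h : IsSplitAction I' (-lBr D I) B (dress I I' G) s)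
    (hinv : ∀ x y z, B (lBr D I x y) z + B y (lBr D I x z) = 0)
    (hV : ∀ u, u ∈ 𝔤 ↔ ∀ v ∈ 𝔤, B u v = 0) (hbr : ∀ u ∈ 𝔤, ∀ v ∈ 𝔤, lBr D I u v ∈ 𝔤) :
    IsPresymplecticRealization I (I'.prod I') (omega I I' G B s)
      (prodFamily I' I' (diracS I I' G B s 𝔤) (diracS I I' G B s 𝔤))
      (prodForm I' I' (phiS I I' G B s) (phiS I I' G B s)) (projPair G) := by
  have hω := smoothForm_omega (B := B) hp h.smooth_splitting
  refine ⟨hω, fun a => (-1 : ℝ) • extD I (omega I I' G B s) a, ?_, isDirac_prodFamily h hV hbr,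
    contMDiff_projPair hp, pullbackForm_projPair hp h, ?_, ?_⟩
  · exact isDirac_graph hω fun a X =>
      ⟨fun b => rField I b (rMC I a X), smoothField_rField _, rField_rMC a X⟩
  · intro a e
    refine (mem_prodFamily_diracS (X := e.1) (α := e.2)).trans ?_
    exact forward_projPair hp h𝔤 h hinv a e.1 e.2
  -- A vector in the kernel of the derivative and of the 2-form satisfies the moment condition for
  -- the zero element, hence equals the zero field.
  · intro a X hX hXω
    have h0 : mder I (I'.prod I') (projPair G) a X =
        prodMaps (dress I I' G) (dress I I' G) (projPair G a) 0 :=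
      (show mder I (I'.prod I') (projPair G) a X = 0 from hX).trans (map_zero _).symm
    have e := (moment_projPair_iff hp h hinv h0).mp fun Y =>
      (map_zero (prodBilin B B _)).trans (mem_graph.mp hXω Y)
    exact e.trans ((congrArg₂ (· - ·) (map_zero (rField I a)) (map_zero (lField I a))).trans
      (sub_zero (0 : E)))

theorem isInducedAction_projPair (hp : Manifold.IsSubmersion I I' ∞ (proj G))
    {𝔤 : LieSubalgebra ℝ (GroupLieAlgebra I D)}
    (h𝔤 : IsLieAlgebraOf I G (𝔤 : Set (GroupLieAlgebra I D)))
    (h : IsSplitAction I' (-lBr D I) B (dress I I' G) s)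
    (hinv : ∀ x y z, B (lBr D I x y) z + B y (lBr D I x z) = 0) :
    IsInducedAction I (I'.prod I') (𝔨 := 𝔤 × 𝔤) (fun u v => (-⁅u.1, v.1⁆, -⁅u.2, v.2⁆))
      (fun u z => prodVector I' I' z (dressing I I' G z.1 u.1) (dressing I I' G z.2 u.2))
      (fun u z => prodCovector I' I' z (sigma I I' G B s z.1 u.1) (sigma I I' G B s z.2 u.2))
      (graph I (omega I I' G B s)) (projPair G)
      (fun u a => rightField I (u.1 : GroupLieAlgebra I D) a -
        leftField I (u.2 : GroupLieAlgebra I D) a) := by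
  -- Elements of `𝔤 × 𝔤` are read in the model space, where the moment identity is stated.
  let val (u : 𝔤 × 𝔤) : E × E := ((u.1 : GroupLieAlgebra I D), (u.2 : GroupLieAlgebra I D))
  let W : Submodule ℝ E := 𝔤.toSubmodule
  have hmem (u : 𝔤 × 𝔤) : val u ∈ W.prod W := ⟨u.1.2, u.2.2⟩
  have hd (u : 𝔤 × 𝔤) (a : D) := mder_projPair_field (𝔤 := W) hp h𝔤 a (hmem u)
  have hcov (u : 𝔤 × 𝔤) (a : D) (Y : E) :
      ((prodCovector I' I' (projPair G a) (sigma I I' G B s (proj G a) u.1)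
        (sigma I I' G B s (proj G a⁻¹) u.2)).comp
          (mfderiv I (I'.prod I') (projPair G) a) : E →L[ℝ] ℝ) Y =
        prodBilin B B (prodMaps s s (projPair G a) (mder I (I'.prod I') (projPair G) a Y))
          (val u) :=
    prodCovector_apply (E := E') (E' := E') (M := D ⧸ G) (M' := D ⧸ G) (I := I') (I' := I')
      (projPair G a) _ _ _
  have hmom (u : 𝔤 × 𝔤) (a : D) (X : E) :
      ((X, (prodCovector I' I' (projPair G a) (sigma I I' G B s (proj G a) u.1)
        (sigma I I' G B s (proj G a⁻¹) u.2)).comp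
          (mfderiv I (I'.prod I') (projPair G) a)) : GenTangent I a) ∈
          graph I (omega I I' G B s) a ↔
        ∀ Y, prodBilin B B (prodMaps s s (projPair G a)
          (mder I (I'.prod I') (projPair G) a Y)) (val u) = omega I I' G B s a ![X, Y] :=
    mem_graph.trans (forall_congr' fun Y => Eq.congr_left (hcov u a Y))
  constructor
  · intro u v a
    change rField I a ((val u).1 + (val v).1) - lField I a ((val u).2 + (val v).2) =
      rField I a (val u).1 - lField I a (val u).2 + (rField I a (val v).1 - lField I a (val v).2)
    rw [map_add, map_add]
    abel
  · intro c v a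
    change rField I a (c • (val v).1) - lField I a (c • (val v).2) =
      c • (rField I a (val v).1 - lField I a (val v).2)
    rw [map_smul, map_smul, smul_sub]
  · intro v
    exact (smoothField_rField (I := I) (val v).1).sub (smoothField_lField (val v).2)
  · intro u v a
    exact (lieB_rField_sub_lField (val u).1 (val v).1 (val u).2 (val v).2 a).symm
  · intro v a
    exact hd v a
  · intro v a
    exact (hmom v a _).mpr ((moment_projPair_iff hp h hinv (hd v a)).mpr rfl)
  · intro v a X hX hXω
    exact (moment_projPair_iff hp h hinv (u := val v) hX).mp ((hmom v a X).mp hXω)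

end Realization

end DiracManin

end

theorem theorem4p3
    {E F : Type*} [NormedAddCommGroup E] [NormedSpace ℝ E] [FiniteDimensional ℝ E]
    [NormedAddCommGroup F] [NormedSpace ℝ F] [FiniteDimensional ℝ F]
    {D : Type*} [TopologicalSpace D] [ChartedSpace E D] [Group D] [LieGroup 𝓘(ℝ, E) ∞ D]
    [ConnectedSpace D]
    (G : Subgroup D) (hG_closed : IsClosed (G : Set D)) (hG_conn : IsConnected (G : Set D))
    [ChartedSpace F (D ⧸ G)] [IsManifold 𝓘(ℝ, F) ∞ (D ⧸ G)]
    (hp : Manifold.IsSubmersion 𝓘(ℝ, E) 𝓘(ℝ, F) ∞ (DiracManin.proj G))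
    (B : LinearMap.BilinForm ℝ (GroupLieAlgebra 𝓘(ℝ, E) D))
    (𝔤 : LieSubalgebra ℝ (GroupLieAlgebra 𝓘(ℝ, E) D))
    (h_manin : DiracManin.IsManinPair B 𝔤)
    (h_lie : DiracManin.IsLieAlgebraOf 𝓘(ℝ, E) G (𝔤 : Set (GroupLieAlgebra 𝓘(ℝ, E) D)))
    (s : Π x : D ⧸ G, TangentSpace 𝓘(ℝ, F) x →L[ℝ] GroupLieAlgebra 𝓘(ℝ, E) D)
    (hs : DiracManin.IsIsotropicSplitting 𝓘(ℝ, E) 𝓘(ℝ, F) G B s) :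
    DiracManin.IsPresymplecticRealization 𝓘(ℝ, E) (𝓘(ℝ, F).prod 𝓘(ℝ, F))
      (DiracManin.omegaD 𝓘(ℝ, E) 𝓘(ℝ, F) G B s)
      (DiracManin.prodFamily 𝓘(ℝ, F) 𝓘(ℝ, F)
        (DiracManin.diracS 𝓘(ℝ, E) 𝓘(ℝ, F) G B s 𝔤.toSubmodule)
        (DiracManin.diracS 𝓘(ℝ, E) 𝓘(ℝ, F) G B s 𝔤.toSubmodule))
      (DiracManin.prodForm 𝓘(ℝ, F) 𝓘(ℝ, F)
        (DiracManin.phiS 𝓘(ℝ, E) 𝓘(ℝ, F) G B s) (DiracManin.phiS 𝓘(ℝ, E) 𝓘(ℝ, F) G B s))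
      (fun a : D => (DiracManin.proj G a, DiracManin.proj G a⁻¹)) ∧
    DiracManin.IsInducedAction 𝓘(ℝ, E) (𝓘(ℝ, F).prod 𝓘(ℝ, F)) (𝔨 := 𝔤 × 𝔤)
      (fun u v => (-⁅u.1, v.1⁆, -⁅u.2, v.2⁆))
      (fun u z => DiracManin.prodVector 𝓘(ℝ, F) 𝓘(ℝ, F) z
        (DiracManin.dressing 𝓘(ℝ, E) 𝓘(ℝ, F) G z.1 u.1)
        (DiracManin.dressing 𝓘(ℝ, E) 𝓘(ℝ, F) G z.2 u.2))
      (fun u z => DiracManin.prodCovector 𝓘(ℝ, F) 𝓘(ℝ, F) z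
        (DiracManin.sigma 𝓘(ℝ, E) 𝓘(ℝ, F) G B s z.1 u.1)
        (DiracManin.sigma 𝓘(ℝ, E) 𝓘(ℝ, F) G B s z.2 u.2))
      (DiracManin.graph 𝓘(ℝ, E) (DiracManin.omegaD 𝓘(ℝ, E) 𝓘(ℝ, F) G B s))
      (fun a : D => (DiracManin.proj G a, DiracManin.proj G a⁻¹))
      (fun u a => DiracManin.rightField 𝓘(ℝ, E) (u.1 : GroupLieAlgebra 𝓘(ℝ, E) D) a -
        DiracManin.leftField 𝓘(ℝ, E) (u.2 : GroupLieAlgebra 𝓘(ℝ, E) D) a) := by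
  have hsymm := h_manin.symm
  have hnondeg : ∀ u, (∀ v, B u v = 0) → u = 0 := h_manin.nondegenerate.1
  obtain ⟨n, b, hb1, hb2, hb3⟩ := h_manin.signature
  -- The signature and maximality enter only through `𝔤 = 𝔤^⊥`.
  have hperp := DiracManin.orthogonal_eq_of_maximal_isotropic hsymm hnondeg b hb1 hb2 hb3
    h_manin.isotropic h_manin.maximal
  have hV (u : GroupLieAlgebra 𝓘(ℝ, E) D) :
      u ∈ 𝔤.toSubmodule ↔ ∀ v ∈ 𝔤.toSubmodule, B u v = 0 := by
    conv_lhs => rw [← hperp]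
    rw [LinearMap.BilinForm.mem_orthogonal_iff]
    exact forall₂_congr fun v _ => Eq.congr_left (hsymm v u)
  have h := DiracManin.isSplitAction_dress (I := 𝓘(ℝ, E)) (I' := 𝓘(ℝ, F)) (B := B)
    (𝔤 := 𝔤.toSubmodule) hp h_lie hsymm hnondeg h_manin.invariant h_manin.isotropic
    hs.smooth hs.splitting hs.isotropic
  have hω : DiracManin.omegaD 𝓘(ℝ, E) 𝓘(ℝ, F) G B s =
      DiracManin.omega (E := E) (E' := F) 𝓘(ℝ, E) 𝓘(ℝ, F) G B s :=
    funext fun a => DiracManin.omegaD_eq_omega (E := E) (E' := F) (I := 𝓘(ℝ, E))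
      (I' := 𝓘(ℝ, F)) (B := B) (s := s) hsymm h_manin.invariant a
  rw [hω]
  exact ⟨DiracManin.isPresymplecticRealization_projPair hp h_lie h h_manin.invariant hV
      fun u hu v hv => 𝔤.lie_mem hu hv,
    DiracManin.isInducedAction_projPair hp h_lie h h_manin.invariant⟩
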